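/- **Setting.** Let $M=(\mathcal S,\mathcal A,P,r,H,s_1)$ be an episodic MDP with horizon $H\ge 1$, transition kernels $P_h$ and known deterministic rewards $r_h:\mathcal S\times\mathcal A\to[0,1]$ ($h\in[H]$), which has an optimal (measurable, deterministic) policy $\pi^*$. Write $V_h^\pi,Q_h^\pi$ for the value functions of a policy $\pi$, $V_h^*=V_h^{\pi^*}$, $Q_h^*=Q_h^{\pi^*}$, $\mathrm{gap}_h(s,a)=V_h^*(s)-Q_h^*(s,a)$, and suppose that $\mathrm{gap}_{\min}=\inf\{\mathrm{gap}_h(s,a):\mathrm{gap}_h(s,a)\ne 0\}>0$ (if all gaps vanish, the term with $1/\mathrm{gap}_{\min}$ below is read as $0$). Let $K\ge 1$ be the number of episodes and $T=KH$. For every $h$, $P_h$ belongs to a known class $\mathcal P_h$ of kernels from $\mathcal S\times\mathcal A$ to finite signed measures on $\mathcal S$. Let $\mathcal V$ be the set of measurable $V:\mathcal S\to[0,H]$ and let $\mathcal F_h$ be the set of the functions $(s,a,V)\mapsto\int \tilde P(ds'\mid s,a)V(s')$, $\tilde P\in\mathcal P_h$, on $\mathcal S\times\mathcal A\times\mathcal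 V$. Assume that any two functions in $\mathcal F_h$ differ by at most $H+1$ everywhere (automatic if all members of $\mathcal P_h$ are probability kernels). For all $\varepsilon>0$ let $\mathcal N(\mathcal F_h,\varepsilon)\in\mathbb N$ be a bound on the size of a minimal $\varepsilon$-cover of $\mathcal F_h$ by elements of $\mathcal F_h$ in the sup norm. Let $\dim_E(\mathcal F_h,\varepsilon)$ be the $\varepsilon$-eluder dimension: the length of the longest sequence of points for which, for some $\varepsilon'\ge\varepsilon$, every point $x$ is $\varepsilon'$-independent of its predecessors $Z$, i.e. there are $f,f'\in\mathcal F_h$ with $\|f-f'\|_Z=(\sum_{z\in Z}(f(z)-f'(z))^2)^{1/2}\le\varepsilon'$ and $|f(x)-f'(x)|>\varepsilon'$. Put $\mathcal N(\mathcal F,\varepsilon)=\max_h\mathcal N(\mathcal F_h,\varepsilon)$ and $\dim_E(\mathcal F,\varepsilon)=\max_h\dim_E(\mathcal F_h,\varepsilon)$. **Algorithm** (parameters $\delta\in(0,1)$, $\beta>0$, $C_s>0$). It keeps sub-sampled datasets (multisets) $\hat Z_h^k$, $\hat Z_h^1=\emptyset$. After episode $k$, with $z=z_h^k=(s_h^k,a_h^k,V_{h+1}^k)$,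 let $$x=\min\Big\{1,\;C_s\,\mathrm{sens}(z)\,\log\frac{T\,\mathcal N(\mathcal F,\sqrt{\delta/(64T^3)})}{\delta}\Big\},\qquad \mathrm{sens}(z)=\min\Big\{\sup_{f_1,f_2\in\mathcal F_h}\frac{(f_1(z)-f_2(z))^2}{\min\{\|f_1-f_2\|^2_{\hat Z_h^k},T(H+1)^2\}+\beta},\,1\Big\},$$ and let $p_z$ be the smallest $p\ge x$ with $1/p\in\mathbb N$ ($p_z=0$ if $x=0$); with probability $p_z$, independently, $1/p_z$ copies of $z$ are added to $\hat Z_h^k$, giving $\hat Z_h^{k+1}$. In episode $1$, and whenever some $\hat Z_h^k$ differs from what it was at the last recomputation, the policy is recomputed: $V_{H+1}^k=0$ and, for $h=H,\dots,1$, $\hat P_h^k\in\arg\min_{P\in\mathcal P_h}\sum_{k'<k}\big(\langle P(\cdot|s_h^{k'},a_h^{k'}),V_{h+1}^{k'}\rangle-V_{h+1}^{k'}(s_{h+1}^{k'})\big)^2$, $$b_h^k(s,a)=\sup\big\{|f_1(s,a,V_{h+1}^k)-f_2(s,a,V_{h+1}^k)|: f_1,f_2\in\mathcal F_h,\ \min\{\|f_1-f_2\|^2_{\hat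 Z_h^k},T(H+1)^2\}\le\beta\big\},$$ $Q_h^k=\min\{r_h+\langle\hat P_h^k,V_{h+1}^k\rangle+b_h^k,\,H\}$, $V_h^k(s)=\max_aQ_h^k(s,a)$, $\pi_h^k(s)\in\arg\max_aQ_h^k(s,a)$ (minimizers and maximizers are assumed to exist and to be chosen measurably from the past; ties are broken arbitrarily). Otherwise $V^k$ and $\pi^k$ are kept. Episode $k$ is played with $\pi^k$. **Theorem.** There are absolute constants $C,C_\beta,C_s>0$ such that, in every setting as above, for all $\delta\in(0,1)$ and $\tau>0$, the algorithm with $$\beta=C_\beta\Big(4H^2\log\frac{2T\,\mathcal N(\mathcal F,1/T)}{\delta}+\frac4H\Big(C_\beta+\sqrt{\tfrac{H^2}{4}\log\tfrac T\delta}\Big)\Big)$$ satisfies, with probability at least $1-\lceil\log T\rceil e^{-\tau}-\delta$, both $$\sum_{k=1}^K\big(V_1^*(s_1)-V_1^{\pi^k}(s_1)\big)\le\frac{C\,\log(\mathcal N(\mathcal F,1/T)/\delta)\,\dim_E^2(\mathcal F,1/T)\,H^5\log T}{\mathrm{gap}_{\min}}+\frac{16H^2\tau}{3}+2$$ and $$\sum_{k=1}^{K-1}\mathbf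 1[\pi^k\neq\pi^{k+1}]\le C\,H\,\log\!\Big(\frac{T\,\mathcal N(\mathcal F,\sqrt{\delta/(64T^3)})}{\delta}\Big)\,\max\{1,\dim_E(\mathcal F,1/T)\}\,\log^2T .$$ -/

import Mathlib

open MeasureTheory ProbabilityTheory
open scoped ENNReal

noncomputable section

namespace ModelBasedRL

/-! ### Function classes on a set of points: data norm, covers, eluder dimension, sensitivity -/

section Classes

variable {X : Type*}

/-- The data-dependent norm `‖f‖_Z = (∑_{z ∈ Z} f(z)²)^{1/2}`; points are counted with
multiplicity. -/
def dataNorm (Z : Multiset X) (f : X → ℝ) : ℝ :=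
  Real.sqrt (Z.map fun z => f z ^ 2).sum

/-- `N ε` bounds the `ε`-covering number of `F` (covers by elements of `F`, in the sup norm over the
domain `D`), for every `ε > 0`. -/
def IsCoveringBound (F : Set (X → ℝ)) (D : Set X) (N : ℝ → ℕ) : Prop :=
  ∀ ε : ℝ, 0 < ε → ∃ C : Finset (X → ℝ), (C : Set (X → ℝ)) ⊆ F ∧ C.card ≤ N ε ∧
    ∀ f ∈ F, ∃ g ∈ C, ∀ x ∈ D, |f x - g x| ≤ ε

/-- `x` is `ε`-dependent on the points of `Z` with respect to `F`. -/
def IsDependent (F : Set (X → ℝ)) (ε : ℝ) (Z : Multiset X) (x : X) : Prop :=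
  ∀ f ∈ F, ∀ g ∈ F, dataNorm Z (f - g) ≤ ε → |f x - g x| ≤ ε

/-- The `ε`-eluder dimension of `F` over the domain `D`: the supremum of the lengths of the sequences
in `D` for which there is an `ε' ≥ ε` such that every element is `ε'`-independent of its
predecessors. -/
def eluderDim (F : Set (X → ℝ)) (D : Set X) (ε : ℝ) : ℕ∞ :=
  ⨆ l ∈ {l : List X | (∀ x ∈ l, x ∈ D) ∧ ∃ ε' : ℝ, ε ≤ ε' ∧
      ∀ (i : ℕ) (hi : i < l.length), ¬ IsDependent F ε' (l.take i : Multiset X) l[i]},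
    (l.length : ℕ∞)

/-- The sensitivity of `z` with respect to the dataset `Z` and the class `F`,
`min {sup_{f₁, f₂ ∈ F} (f₁(z) - f₂(z))² / (min {‖f₁ - f₂‖_Z², B} + β), 1}`. -/
def sensitivity (F : Set (X → ℝ)) (B β : ℝ) (Z : Multiset X) (z : X) : ℝ :=
  (min (⨆ f₁ ∈ F, ⨆ f₂ ∈ F,
    ENNReal.ofReal ((f₁ z - f₂ z) ^ 2 / (min (dataNorm Z (f₁ - f₂) ^ 2) B + β))) 1).toReal

end Classes

/-! ### Episodic Markov decision processes -/

/-- A finite-horizon MDP. Steps are numbered `0, …, H - 1`; the data at later indices are never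
used. -/
structure MDP (S A : Type*) [MeasurableSpace S] [MeasurableSpace A] where
  /-- the horizon -/
  H : ℕ
  H_pos : 1 ≤ H
  /-- the transition kernels -/
  P : ℕ → Kernel (S × A) S
  markov : ∀ h, IsMarkovKernel (P h)
  /-- the reward functions -/
  r : ℕ → S → A → ℝ
  r_measurable : ∀ h, Measurable fun z : S × A => r h z.1 z.2
  r_mem : ∀ h s a, r h s a ∈ Set.Icc (0 : ℝ) 1
  /-- the initial state -/
  s₁ : S

namespace MDP

variable {S A : Type*} [MeasurableSpace S] [MeasurableSpace A] (M : MDP S A)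

/-- The law of the state `n` steps after step `h` when the state at step `h` has law `ν` and the
policy `π` is followed from step `h` on. -/
def visitLaw (π : ℕ → S → A) (h : ℕ) (ν : Measure S) : ℕ → Measure S
  | 0 => ν
  | n + 1 => (visitLaw π h ν n).bind fun x => M.P (h + n) (x, π (h + n) x)

/-- The expected total reward collected in the steps `h, …, H - 1` when the state at step `h` has law
`ν` and the policy `π` is followed from step `h` on. -/
def expReturn (π : ℕ → S → A) (h : ℕ) (ν : Measure S) : ℝ :=
  ∑ n ∈ Finset.range (M.H - h), ∫ x, M.r (h + n) x (π (h + n) x) ∂(M.visitLaw π h ν n)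

/-- The value function `V_h^π`. -/
def V (π : ℕ → S → A) (h : ℕ) (s : S) : ℝ :=
  M.expReturn π h (Measure.dirac s)

/-- The Q-function `Q_h^π`. -/
def Q (π : ℕ → S → A) (h : ℕ) (s : S) (a : A) : ℝ :=
  M.r h s a + M.expReturn π (h + 1) (M.P h (s, a))

/-- `π` is an optimal policy: it is measurable, and its value is maximal at every step and state. -/
def IsOptimal (π : ℕ → S → A) : Prop :=
  (∀ h, Measurable (π h)) ∧
    ∀ π' : ℕ → S → A, (∀ h, Measurable (π' h)) → ∀ h < M.H, ∀ s, M.V π' h s ≤ M.V π h s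

/-- The sub-optimality gap `V_h^*(s) - Q_h^*(s, a)`, for an optimal policy `πs`. -/
def gap (πs : ℕ → S → A) (h : ℕ) (s : S) (a : A) : ℝ :=
  M.V πs h s - M.Q πs h s a

/-- The set of all nonzero gaps. -/
def gapSet (πs : ℕ → S → A) : Set ℝ :=
  {g | g ≠ 0 ∧ ∃ h < M.H, ∃ s a, g = M.gap πs h s a}

/-- The minimum sub-optimality gap. If there is no nonzero gap this is `0`, and `x / gapMin` is then
`0`, the value of `x / ∞`. -/
def gapMin (πs : ℕ → S → A) : ℝ := sInf (M.gapSet πs)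

end MDP

/-! ### Model classes -/

/-- A measurable transition kernel whose values are (finite) signed measures. -/
structure SignedKernel (S A : Type*) [MeasurableSpace S] [MeasurableSpace A] where
  toFun : S → A → SignedMeasure S
  measurable_toFun : ∀ B : Set S, MeasurableSet B → Measurable fun z : S × A => toFun z.1 z.2 B

/-- The points `(s, a, V)` at which the functions of the classes `F_h` are evaluated. -/
abbrev Pt (S A : Type*) : Type _ := S × A × (S → ℝ)

section Models

variable {S A : Type*} [MeasurableSpace S] [MeasurableSpace A]

/-- The function `(s, a, V) ↦ ∫ P(s' | s, a) V(s')`. -/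
def modelFun (P : SignedKernel S A) (z : Pt S A) : ℝ :=
  ∫ᵛ x, z.2.2 x ∂<•(P.toFun z.1 z.2.1)

/-- The class `F_h` belonging to the model class `cP h`. -/
def modelFunClass (cP : Set (SignedKernel S A)) : Set (Pt S A → ℝ) :=
  modelFun '' cP

/-- The domain `S × A × 𝒱` of the functions in `F_h`, where `𝒱` is the set of all measurable
functions with values in `[0, H]`. -/
def dom (S A : Type*) [MeasurableSpace S] (H : ℕ) : Set (Pt S A) :=
  {z | Measurable z.2.2 ∧ ∀ x, z.2.2 x ∈ Set.Icc (0 : ℝ) H}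

/-- The transition kernels of `M` belong to the model classes. -/
def Realizable (M : MDP S A) (cP : ℕ → Set (SignedKernel S A)) : Prop :=
  ∀ h < M.H, ∃ P ∈ cP h, ∀ s a, ∀ B : Set S, MeasurableSet B →
    P.toFun s a B = (M.P h (s, a)).real B

end Models

/-! ### The algorithm -/

/-- The input of the algorithm: the MDP (of which it uses `H`, `s₁` and the rewards), the model
classes, the number `K` of episodes, the bonus parameter `β`, and the factor `lam` by which
sensitivities are multiplied in the sampling routine. -/
structure Input (S A : Type*) [MeasurableSpace S] [MeasurableSpace A] where
  M : MDP S A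
  cP : ℕ → Set (SignedKernel S A)
  K : ℕ
  β : ℝ
  lam : ℝ

namespace Input

variable {S A : Type*} [MeasurableSpace S] [MeasurableSpace A] (I : Input S A)

/-- The class `F_h`. -/
def F (h : ℕ) : Set (Pt S A → ℝ) := modelFunClass (I.cP h)

/-- The truncation level `T (H + 1)²`, with `T = K H`. -/
def trunc : ℝ := ((I.K : ℝ) * I.M.H) * ((I.M.H : ℝ) + 1) ^ 2

/-- For `x = min {1, lam * sensitivity}`, the number `⌊1 / x⌋` of copies that are added when `z` is
sampled (and `0` if `x = 0`). -/
def copies (h : ℕ) (Z : Multiset (Pt S A)) (z : Pt S A) : ℕ :=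
  ⌊1 / min 1 (I.lam * sensitivity (I.F h) I.trunc I.β Z z)⌋₊

/-- The sampling probability `p_z`: the smallest `p ≥ min {1, lam * sensitivity}` for which `1 / p`
is an integer (and `0` if the sensitivity is `0`). -/
def prob (h : ℕ) (Z : Multiset (Pt S A)) (z : Pt S A) : ℝ :=
  1 / (I.copies h Z z : ℝ)

/-- The bonus `b_h(s, a)`, the supremum of `|f₁(s, a, V) - f₂(s, a, V)|` over all `f₁, f₂ ∈ F_h` with
`min {‖f₁ - f₂‖_Z², T (H + 1)²} ≤ β`. -/
def bonus (h : ℕ) (Z : Multiset (Pt S A)) (z : Pt S A) : ℝ≥0∞ :=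
  ⨆ f₁ ∈ I.F h, ⨆ f₂ ∈ I.F h, ⨆ (_ : min (dataNorm Z (f₁ - f₂) ^ 2) I.trunc ≤ I.β),
    ENNReal.ofReal |f₁ z - f₂ z|

end Input

/-- The random quantities produced by the interaction. Episodes are numbered `0, …, K - 1` and steps
`0, …, H - 1`; the first argument is the episode, the second one the step. -/
structure Interaction (S A Ω : Type*) [MeasurableSpace S] [MeasurableSpace A] where
  /-- the state `s_h^k`, for `h ≤ H` -/
  state : ℕ → ℕ → Ω → S
  /-- the event that `z_h^k` is added to the sub-sampled dataset after episode `k` -/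
  coin : ℕ → ℕ → Set Ω
  /-- the estimated model -/
  model : ℕ → ℕ → Ω → SignedKernel S A
  /-- the estimated value function `V_h^k`, for `h ≤ H` -/
  val : ℕ → ℕ → Ω → S → ℝ
  /-- the policy `π_h^k` -/
  policy : ℕ → ℕ → Ω → S → A

namespace Interaction

variable {S A Ω : Type*} [MeasurableSpace S] [MeasurableSpace A]
  (R : Interaction S A Ω) (I : Input S A)

/-- The action `a_h^k`. -/
def act (k h : ℕ) (ω : Ω) : A := R.policy k h ω (R.state k h ω)

/-- The data point `z_h^k = (s_h^k, a_h^k, V_{h+1}^k)`. -/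
def pt (k h : ℕ) (ω : Ω) : Pt S A := (R.state k h ω, R.act k h ω, R.val k (h + 1) ω)

open Classical in
/-- The sub-sampled dataset at the beginning of episode `k`. -/
def dataset : ℕ → ℕ → Ω → Multiset (Pt S A)
  | 0, _, _ => 0
  | k + 1, h, ω => dataset k h ω +
      if ω ∈ R.coin k h then
        Multiset.replicate (I.copies h (dataset k h ω) (R.pt k h ω)) (R.pt k h ω)
      else 0

open Classical in
/-- The last episode up to `k` at the beginning of which the policy was recomputed: the first episode,
and then every episode in which the dataset of some step differs from its value at the preceding
recomputation. -/
def lastUpdate : ℕ → Ω → ℕ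
  | 0, _ => 0
  | k + 1, ω =>
      if ∃ h < I.M.H, R.dataset I (k + 1) h ω ≠ R.dataset I (lastUpdate k ω) h ω then k + 1
      else lastUpdate k ω

/-- The value-targeted least-squares loss of the model `P` at step `h`, before episode `k`. -/
def loss (k h : ℕ) (ω : Ω) (P : SignedKernel S A) : ℝ :=
  ∑ j ∈ Finset.range k,
    (modelFun P (R.pt j h ω) - R.val j (h + 1) ω (R.state j (h + 1) ω)) ^ 2

/-- The optimistic estimate
`Q_h^k(s, a) = min {r_h(s, a) + ⟨P̂_h^k(· | s, a), V_{h+1}^k⟩ + b_h^k(s, a), H}`. -/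
def qEst (k h : ℕ) (ω : Ω) (s : S) (a : A) : ℝ :=
  (min (((I.M.r h s a + modelFun (R.model k h ω) (s, a, R.val k (h + 1) ω) : ℝ) : EReal)
      + ((I.bonus h (R.dataset I k h ω) (s, a, R.val k (h + 1) ω) : ℝ≥0∞) : EReal))
    ((I.M.H : ℝ) : EReal)).toReal

/-- `R` is an execution of the low-switching-cost value iteration algorithm with the model-based
Q-estimator and sampling routine, in the MDP `I.M`, on the probability space `(Ω, μ)`.

The filtration is indexed by pairs (episode, time) in the lexicographic order: `filt (k, h)` with
`h ≤ H` is the information available when the state `s_h^k` has been observed, and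
`filt (k, H + h + 1)` the information available when, after the episode, it has also been decided
which ones of the points `z_0^k, …, z_h^k` are added to the datasets. The minimizers in the
regression and the maximizing actions are arbitrary ones. -/
structure IsExecution [mΩ : MeasurableSpace Ω] (μ : Measure Ω)
    (filt : Filtration (ℕ ×ₗ ℕ) mΩ) : Prop where
  /-- recomputation: least-squares model, terminal value, greedy policy and its value -/
  model_mem : ∀ k < I.K, ∀ ω, R.lastUpdate I k ω = k → ∀ h < I.M.H, R.model k h ω ∈ I.cP h
  model_min : ∀ k < I.K, ∀ ω, R.lastUpdate I k ω = k → ∀ h < I.M.H, ∀ P ∈ I.cP h,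
    R.loss k h ω (R.model k h ω) ≤ R.loss k h ω P
  val_last : ∀ k < I.K, ∀ ω, R.lastUpdate I k ω = k → ∀ s, R.val k I.M.H ω s = 0
  val_eq : ∀ k < I.K, ∀ ω, R.lastUpdate I k ω = k → ∀ h < I.M.H, ∀ s,
    R.val k h ω s = R.qEst I k h ω s (R.policy k h ω s)
  greedy : ∀ k < I.K, ∀ ω, R.lastUpdate I k ω = k → ∀ h < I.M.H, ∀ s a,
    R.qEst I k h ω s a ≤ R.qEst I k h ω s (R.policy k h ω s)
  /-- without recomputation everything is kept -/
  val_keep : ∀ k < I.K, ∀ ω, ∀ h ≤ I.M.H, R.val k h ω = R.val (R.lastUpdate I k ω) h ω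
  policy_keep : ∀ k < I.K, ∀ ω, ∀ h < I.M.H,
    R.policy k h ω = R.policy (R.lastUpdate I k ω) h ω
  /-- value estimates and policy are fixed at the beginning of the episode -/
  val_measurable : ∀ k < I.K, ∀ h ≤ I.M.H,
    Measurable[(filt (toLex (k, 0))).prod inferInstance] fun q : Ω × S => R.val k h q.1 q.2
  policy_measurable : ∀ k < I.K, ∀ h < I.M.H,
    Measurable[(filt (toLex (k, 0))).prod inferInstance] fun q : Ω × S => R.policy k h q.1 q.2
  /-- the states follow the transition kernels of the MDP -/
  state_zero : ∀ k < I.K, ∀ ω, R.state k 0 ω = I.M.s₁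
  state_measurable : ∀ k < I.K, ∀ h ≤ I.M.H, Measurable[filt (toLex (k, h))] (R.state k h)
  state_law : ∀ k < I.K, ∀ h < I.M.H, ∀ B : Set S, MeasurableSet B →
    μ[(R.state k (h + 1) ⁻¹' B).indicator (fun _ => (1 : ℝ)) | filt (toLex (k, h))]
      =ᵐ[μ] fun ω => (I.M.P h (R.state k h ω, R.act k h ω)).real B
  /-- after the episode, `z_h^k` is sampled with probability `p_z` -/
  coin_measurable : ∀ k < I.K, ∀ h < I.M.H,
    MeasurableSet[filt (toLex (k, I.M.H + h + 1))] (R.coin k h)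
  coin_law : ∀ k < I.K, ∀ h < I.M.H,
    μ[(R.coin k h).indicator (fun _ => (1 : ℝ)) | filt (toLex (k, I.M.H + h))]
      =ᵐ[μ] fun ω => I.prob h (R.dataset I k h ω) (R.pt k h ω)

/-- The regret `∑_k (V_1^*(s_1) - V_1^{π^k}(s_1))`, for an optimal policy `πs`. -/
def regret (πs : ℕ → S → A) (ω : Ω) : ℝ :=
  ∑ k ∈ Finset.range I.K,
    (I.M.V πs 0 I.M.s₁ - I.M.V (fun h => R.policy k h ω) 0 I.M.s₁)

open Classical in
/-- The switching cost: the number of episodes `k < K - 1` with `π^k ≠ π^{k+1}`. -/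
def switches (ω : Ω) : ℕ :=
  ((Finset.range (I.K - 1)).filter fun k =>
    ∃ h < I.M.H, R.policy k h ω ≠ R.policy (k + 1) h ω).card

end Interaction

end ModelBasedRL

end

/-! Randomness enters only through exponential supermartingales (`IsStep`, `measure_sum_ge_le`), one
Markov bound, and union bounds over covers, dyadic levels, steps and episodes. On the resulting
event (`GoodEvent`, `Favorable`) the rest of the argument is deterministic.

Confidence. For each element of a cover at scale `1 / T` the weighted regression noise is small, so
the least-squares model is close to the truth in squared distance over all past data
(`lsq_fullSum_le`). Sub-sampling costs only constants: unless a point is taken with certainty, its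
effect on the squared distance of any pair is at most a fraction `1 / lam` of the current value plus
`β`, and `lam` exceeds the logarithm of the size of the union bound. Hence distances on all data are
at most `12` times those on the sub-sample plus `β` (`fullSum_le`), and pairs close on all data are
within `β` on the sub-sample (`subSum_le`). So the bonus dominates the model error, and induction
over episodes and steps gives optimism and values in `[0, H]` (`optimism_step`, `inRange`).

Counting. A pair that differs by more than `u` at the current point, while its squared distance on
the past is at most `B`, can occur at most `(B / u² + 1) d` times: the points are distributed
greedily into independent sequences, and every sequence that refuses a point contributes `u²` to the
distance (`exists_bucket`, `card_le_of_separated`). Thus large bonuses are rare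
(`card_large_bon_le`). The same buckets with harmonic weights bound the total sensitivity by `max 1
d * log² T` (`sum_sens_le`). A policy changes only after a coin has succeeded, and the number of
successes is at most twice the sum of the probabilities plus a logarithm, which is the switching
bound (`switches_le_of_good`).

Regret. The sub-optimality of a policy is the expected sum of the gaps met on its trajectory; the
supermartingale `exp (-∑ gap / H) (1 - Δ / (2 H))` makes this pathwise at an additive cost `2 H τ`
(`measure_gap_sum_le`). By optimism a realised gap is at most twice the later bonuses plus
transition noise (`gap_le_sum`). Summed over the episodes whose gap at a step exceeds `ε`, half of
the left side absorbs the part of the right side proportional to the number of episodes, so there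
are `O(β d H² / ε²)` such episodes (`card_large_gap_le`). Gaps are zero or at least `gapMin`, so the
dyadic levels above `gapMin / 2` sum geometrically to `O(β d H² / gapMin)` per step (`sum_gap_le`).
With `β` of order `H² log (N / δ) log T` the claim follows, even with `d` in place of `d²`.
Parameters for which this bound degenerates are treated directly in `regret_bound`. -/

namespace ModelBasedRL

/-! ### Measurability of integrals against signed kernels. -/

section ModelFun

open Filter Topology

/-- Induction for bounded measurable functions. -/
theorem bounded_measurable_induction {X : Type*} [MeasurableSpace X] {C : (X → ℝ) → Prop}
    (ind : ∀ s, MeasurableSet s → C (s.indicator fun _ => 1))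
    (add : ∀ f g : X → ℝ, Measurable f → Measurable g → (∃ c, ∀ x, |f x| ≤ c) →
      (∃ c, ∀ x, |g x| ≤ c) → C f → C g → C (f + g))
    (smul : ∀ (a : ℝ) (f : X → ℝ), C f → C (a • f))
    (lim : ∀ (F : ℕ → X → ℝ) (f : X → ℝ) (c : ℝ), (∀ n, Measurable (F n)) →
      (∀ n x, |F n x| ≤ c) → (∀ x, Tendsto (fun n => F n x) atTop (𝓝 (f x))) →
      (∀ n, C (F n)) → C f)
    {f : X → ℝ} (hf : Measurable f) {c : ℝ} (hc : ∀ x, |f x| ≤ c) : C f := by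
  have simple : ∀ g : SimpleFunc X ℝ, C g := by
    intro g
    induction g using SimpleFunc.induction with
    | const a hs =>
      rename_i s
      have h := smul a _ (ind s hs)
      convert h using 1
      ext x
      by_cases hx : x ∈ s <;> simp [hx]
    | add hd hf hg =>
      rename_i f g
      exact add _ _ f.measurable g.measurable
        (by obtain ⟨c, hc⟩ := f.exists_forall_norm_le; exact ⟨c, hc⟩)
        (by obtain ⟨c, hc⟩ := g.exists_forall_norm_le; exact ⟨c, hc⟩) hf hg
  -- On an empty space nothing forces `0 ≤ c`, which the bounded approximation needs; but there all
  -- functions coincide.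
  rcases isEmpty_or_nonempty X with hX | ⟨⟨x₀⟩⟩
  · have h := ind ∅ MeasurableSet.empty
    convert h using 1
  have h0 : 0 ≤ c := (abs_nonneg _).trans (hc x₀)
  have hs := hf.stronglyMeasurable
  exact lim (fun n => hs.approxBounded c n) f c (fun n => (hs.approxBounded c n).measurable)
    (fun n x => hs.norm_approxBounded_le h0 n x)
    (fun x => hs.tendsto_approxBounded_of_norm_le (hc x)) (fun n => simple _)

instance isFiniteMeasure_variation {X : Type*} [MeasurableSpace X] (ν : SignedMeasure X) :
    IsFiniteMeasure ν.variation := by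
  rw [← ν.totalVariation_eq_variation]
  infer_instance

theorem integrable_variation {X : Type*} [MeasurableSpace X] (ν : SignedMeasure X) {f : X → ℝ}
    (hf : Measurable f) {c : ℝ} (hc : ∀ x, |f x| ≤ c) : ν.Integrable f :=
  Integrable.of_bound (C := c) hf.aestronglyMeasurable (Eventually.of_forall hc)

variable {S A : Type*} [MeasurableSpace S] [MeasurableSpace A]

/-- A π-λ argument: rectangles reduce to `measurable_toFun`, complements to subtraction from the
total mass, which is finite, and disjoint unions to pointwise convergent sums. -/
theorem measurable_section {Ω : Type*} [MeasurableSpace Ω] (P : SignedKernel S A) {s : Ω → S}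
    {a : Ω → A} (hs : Measurable s) (ha : Measurable a) {B : Set (Ω × S)} (hB : MeasurableSet B) :
    Measurable fun ω => P.toFun (s ω) (a ω) (Prod.mk ω ⁻¹' B) := by
  induction B, hB
    using MeasurableSpace.induction_on_inter generateFrom_prod.symm isPiSystem_prod with
  | empty => simp
  | basic B hB =>
    obtain ⟨s', hs', t, ht, rfl⟩ := hB
    classical
    have h1 : Measurable fun ω => P.toFun (s ω) (a ω) t :=
      (P.measurable_toFun t ht).comp (hs.prodMk ha)
    have h2 : (fun ω => P.toFun (s ω) (a ω) (Prod.mk ω ⁻¹' s' ×ˢ t))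
        = s'.indicator fun ω => P.toFun (s ω) (a ω) t := by
      ext ω
      by_cases hx : ω ∈ s' <;> simp [hx]
    rw [h2]
    exact h1.indicator hs'
  | compl B hB ih =>
    simp_rw [Set.preimage_compl, VectorMeasure.of_compl (measurable_prodMk_left hB)]
    exact ((P.measurable_toFun _ MeasurableSet.univ).comp (hs.prodMk ha)).sub ih
  | iUnion f hfd hfm ih =>
    have h (ω : Ω) : HasSum (fun i => P.toFun (s ω) (a ω) (Prod.mk ω ⁻¹' f i))
        (P.toFun (s ω) (a ω) (Prod.mk ω ⁻¹' ⋃ i, f i)) := by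
      rw [Set.preimage_iUnion]
      apply VectorMeasure.hasSum_of_disjoint_iUnion
      exacts [fun i => measurable_prodMk_left (hfm i), hfd.mono fun _ _ => .preimage _]
    exact (StronglyMeasurable.hasSum (fun i => (ih i).stronglyMeasurable) h).measurable

/-- The points of the datasets contain random value functions, so evaluating a model at them means
integrating a jointly measurable function. Indicators are `measurable_section`; limits pass by
dominated convergence against the variation. -/
theorem measurable_modelFun {Ω : Type*} [MeasurableSpace Ω] (P : SignedKernel S A) {s : Ω → S}
    {a : Ω → A} (hs : Measurable s) (ha : Measurable a) {V : Ω → S → ℝ}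
    (hV : Measurable fun q : Ω × S => V q.1 q.2) {c : ℝ} (hc : ∀ ω x, |V ω x| ≤ c) :
    Measurable fun ω => modelFun P (s ω, a ω, V ω) := by
  suffices h : ∀ f : Ω × S → ℝ, Measurable f → ∀ c, (∀ q, |f q| ≤ c) →
      Measurable fun ω => ∫ᵛ x, f (ω, x) ∂<•(P.toFun (s ω) (a ω)) from
    h (fun q => V q.1 q.2) hV c fun q => hc q.1 q.2
  clear hV hc
  intro f hf c hc
  apply bounded_measurable_induction
    (C := fun f : Ω × S → ℝ => Measurable fun ω => ∫ᵛ x, f (ω, x) ∂<•(P.toFun (s ω) (a ω)))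
    _ _ _ _ hf hc
  · intro B hB
    convert measurable_section P hs ha hB using 2 with ω
    have : (fun x => B.indicator (fun _ => (1 : ℝ)) (ω, x))
        = (Prod.mk ω ⁻¹' B).indicator fun _ => 1 := by
      ext x; simp only [Set.indicator]; rfl
    rw [this, VectorMeasure.integral_indicator (measurable_prodMk_left hB),
      VectorMeasure.integral_const]
    simp [VectorMeasure.restrict_apply, measurable_prodMk_left hB]
  · rintro f g hf hg ⟨c, hc⟩ ⟨c', hc'⟩ h1 h2
    have h : ∀ ω, ∫ᵛ x, (f + g) (ω, x) ∂<•(P.toFun (s ω) (a ω))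
        = ∫ᵛ x, f (ω, x) ∂<•(P.toFun (s ω) (a ω)) + ∫ᵛ x, g (ω, x) ∂<•(P.toFun (s ω) (a ω)) :=
      fun ω => VectorMeasure.integral_fun_add
        (integrable_variation _ (hf.comp measurable_prodMk_left) fun x => hc _)
        (integrable_variation _ (hg.comp measurable_prodMk_left) fun x => hc' _)
    simp_rw [h]
    exact h1.add h2
  · intro b f h
    have h' : ∀ ω, ∫ᵛ x, (b • f) (ω, x) ∂<•(P.toFun (s ω) (a ω))
        = b • ∫ᵛ x, f (ω, x) ∂<•(P.toFun (s ω) (a ω)) :=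
      fun ω => VectorMeasure.integral_fun_smul _ _ b _
    simp_rw [h']
    exact h.const_smul b
  · intro F f c hF hFc hlim h
    refine measurable_of_tendsto_metrizable h ?_
    rw [tendsto_pi_nhds]
    intro ω
    exact tendsto_setToFun_of_dominated_convergence _ (fun _ => c)
      (fun n => ((hF n).comp measurable_prodMk_left).aestronglyMeasurable)
      (integrable_const c) (fun n => Eventually.of_forall fun x => hFc n _)
      (Eventually.of_forall fun x => hlim _)

theorem modelFun_eq_integral (P : SignedKernel S A) (s : S) (a : A) (ν : Measure S)
    [IsFiniteMeasure ν] (h : ∀ B, MeasurableSet B → P.toFun s a B = ν.real B) (V : S → ℝ) :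
    modelFun P (s, a, V) = ∫ x, V x ∂ν := by
  have : P.toFun s a = ν.toSignedMeasure := by
    ext B hB
    rw [h B hB, Measure.toSignedMeasure_apply_measurable hB]
  simp only [modelFun, this]
  exact VectorMeasure.integral_toSignedMeasure

end ModelFun

/-! ### Exponential supermartingales and conditional laws. -/

section Steps

variable {Ω : Type*}

/-- `exp X` has conditional expectation at most `1` given `m`. -/
def IsStep {mΩ : MeasurableSpace Ω} (μ : Measure Ω) (m : MeasurableSpace Ω) (X : Ω → ℝ) : Prop :=
  ∀ G : Ω → ℝ≥0∞, Measurable[m] G →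
    ∫⁻ ω, G ω * ENNReal.ofReal (Real.exp (X ω)) ∂μ ≤ ∫⁻ ω, G ω ∂μ

theorem lex_le_of_lt {k k' a b : ℕ} (h : k < k') : toLex (k, a) ≤ toLex (k', b) :=
  Prod.Lex.toLex_le_toLex.2 (Or.inl h)

theorem lex_le_of_le {k a b : ℕ} (h : a ≤ b) : toLex (k, a) ≤ toLex (k, b) :=
  Prod.Lex.toLex_le_toLex.2 (Or.inr ⟨rfl, h⟩)

/-- The factors are removed one at a time, the latest first; everything accumulated before is
measurable at the current time and serves as the weight `G`. The offset `off` is `0` for state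
transitions and `H` for the sampling coins. -/
theorem lintegral_exp_sum_le_one {mΩ : MeasurableSpace Ω} {μ : Measure Ω} [IsProbabilityMeasure μ]
    (filt : Filtration (ℕ ×ₗ ℕ) mΩ) (n H off : ℕ) (X : ℕ → ℕ → Ω → ℝ)
    (hm : ∀ k < n, ∀ h < H, Measurable[filt (toLex (k, off + h + 1))] (X k h))
    (hs : ∀ k < n, ∀ h < H, IsStep μ (filt (toLex (k, off + h))) (X k h)) :
    ∫⁻ ω, ENNReal.ofReal
      (Real.exp (∑ k ∈ Finset.range n, ∑ h ∈ Finset.range H, X k h ω)) ∂μ ≤ 1 := by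
  have hmS : ∀ k < n, ∀ h ≤ H, Measurable[filt (toLex (k, off + h))] fun ω =>
      ∑ h' ∈ Finset.range h, X k h' ω := by
    intro k hk h hh
    refine Finset.measurable_fun_sum _ fun h' hh' => ?_
    have h1 := Finset.mem_range.1 hh'
    exact (hm k hk h' (by omega)).mono (filt.mono (lex_le_of_le (by omega))) le_rfl
  have key : ∀ k ≤ n, ∫⁻ ω, ENNReal.ofReal
      (Real.exp (∑ j ∈ Finset.range k, ∑ h ∈ Finset.range H, X j h ω)) ∂μ ≤ 1 := by
    intro k
    induction k with
    | zero => intro _; simp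
    | succ k ih =>
      intro hk
      have inner : ∀ h ≤ H, ∫⁻ ω, ENNReal.ofReal
          (Real.exp (∑ j ∈ Finset.range k, ∑ h ∈ Finset.range H, X j h ω
            + ∑ h' ∈ Finset.range h, X k h' ω)) ∂μ ≤ 1 := by
        intro h
        induction h with
        | zero => intro _; simpa using ih (by omega)
        | succ h ih' =>
          intro hh
          refine le_trans ?_ (ih' (by omega))
          have hG : Measurable[filt (toLex (k, off + h))] fun ω => ENNReal.ofReal
              (Real.exp (∑ j ∈ Finset.range k, ∑ h ∈ Finset.range H, X j h ω
            + ∑ h' ∈ Finset.range h, X k h' ω)) := by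
            have h1 : Measurable[filt (toLex (k, off + h))] fun ω =>
                ∑ j ∈ Finset.range k, ∑ h ∈ Finset.range H, X j h ω := by
              refine Finset.measurable_fun_sum _ fun j hj => ?_
              have h1 := Finset.mem_range.1 hj
              exact (hmS j (by omega) H le_rfl).mono (filt.mono (lex_le_of_lt h1)) le_rfl
            exact (Real.measurable_exp.comp (h1.add (hmS k (by omega) h (by omega)))).ennreal_ofReal
          refine le_trans (le_of_eq ?_) (hs k (by omega) h (by omega) _ hG)
          refine lintegral_congr fun ω => ?_
          rw [Finset.sum_range_succ, ← add_assoc, Real.exp_add, ENNReal.ofReal_mul (Real.exp_nonneg _)]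
      simpa [Finset.sum_range_succ] using inner H le_rfl
  exact key n le_rfl

/-- Markov's inequality for the exponential. All tail bounds of the proof come from here, except the
one for the number of copies. -/
theorem measure_sum_ge_le {mΩ : MeasurableSpace Ω} {μ : Measure Ω} [IsProbabilityMeasure μ]
    (filt : Filtration (ℕ ×ₗ ℕ) mΩ) (n H off : ℕ) (X : ℕ → ℕ → Ω → ℝ)
    (hm : ∀ k < n, ∀ h < H, Measurable[filt (toLex (k, off + h + 1))] (X k h))
    (hs : ∀ k < n, ∀ h < H, IsStep μ (filt (toLex (k, off + h))) (X k h)) (L : ℝ) :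
    μ {ω | L ≤ ∑ k ∈ Finset.range n, ∑ h ∈ Finset.range H, X k h ω}
      ≤ ENNReal.ofReal (Real.exp (-L)) := by
  have h1 := lintegral_exp_sum_le_one filt n H off X hm hs
  have hmeas : Measurable fun ω => ENNReal.ofReal
      (Real.exp (∑ k ∈ Finset.range n, ∑ h ∈ Finset.range H, X k h ω)) := by
    refine (Real.measurable_exp.comp (Finset.measurable_fun_sum _ fun j hj =>
      Finset.measurable_fun_sum _ fun h hh => ?_)).ennreal_ofReal
    exact (hm j (Finset.mem_range.1 hj) h (Finset.mem_range.1 hh)).mono (filt.le _) le_rfl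
  have h2 := mul_meas_ge_le_lintegral (μ := μ) hmeas (ENNReal.ofReal (Real.exp L))
  have h3 : {ω | L ≤ ∑ k ∈ Finset.range n, ∑ h ∈ Finset.range H, X k h ω}
      ⊆ {ω | ENNReal.ofReal (Real.exp L) ≤ ENNReal.ofReal
      (Real.exp (∑ k ∈ Finset.range n, ∑ h ∈ Finset.range H, X k h ω))} := by
    intro ω hω
    exact ENNReal.ofReal_le_ofReal (Real.exp_le_exp.2 hω)
  have h4 := h2.trans h1
  have hpos : 0 < Real.exp L := Real.exp_pos L
  calc _ ≤ _ := measure_mono h3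
    _ ≤ (ENNReal.ofReal (Real.exp L))⁻¹ := by
      rw [ENNReal.le_inv_iff_mul_le, mul_comm]
      exact h4
    _ = _ := by rw [← ENNReal.ofReal_inv_of_pos hpos, Real.exp_neg]

theorem lintegral_disintegration {Ω' S : Type*} [MeasurableSpace Ω] [MeasurableSpace Ω']
    [MeasurableSpace S] (μ : Measure Ω) [IsFiniteMeasure μ] {g : Ω → Ω'} (hg : Measurable g)
    {Y : Ω → S} (hY : Measurable Y) (κ : Kernel Ω' S) [IsMarkovKernel κ]
    (h : ∀ E B, MeasurableSet E → MeasurableSet B →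
      μ (g ⁻¹' E ∩ Y ⁻¹' B) = ∫⁻ ω in g ⁻¹' E, κ (g ω) B ∂μ)
    {φ : Ω' × S → ℝ≥0∞} (hφ : Measurable φ) :
    ∫⁻ ω, φ (g ω, Y ω) ∂μ = ∫⁻ ω, ∫⁻ s, φ (g ω, s) ∂κ (g ω) ∂μ := by
  have heq : μ.map (fun ω => (g ω, Y ω)) = (μ.map g) ⊗ₘ κ := by
    refine Measure.ext_prod fun {E B} hE hB => ?_
    rw [Measure.map_apply (hg.prodMk hY) (hE.prod hB), Measure.compProd_apply_prod hE hB,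
      setLIntegral_map hE (κ.measurable_coe hB) hg, ← h E B hE hB]
    rfl
  have h1 : ∫⁻ ω, φ (g ω, Y ω) ∂μ = ∫⁻ q, φ q ∂(μ.map fun ω => (g ω, Y ω)) :=
    (lintegral_map hφ (hg.prodMk hY)).symm
  rw [h1, heq, Measure.lintegral_compProd hφ, lintegral_map _ hg]
  exact hφ.lintegral_kernel_prod_right'

/-- Since the kernel is given, the almost sure identities for the single sets `B` already determine
the joint law on rectangles, so no regular conditional distribution has to be constructed. The map
`g` is the identity from `Ω` to `Ω` with the smaller σ-algebra. -/
theorem lintegral_of_condExp_eq_kernel {S : Type*} {m mΩ : MeasurableSpace Ω} (hm : m ≤ mΩ)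
    [MeasurableSpace S] (μ : Measure Ω) [IsFiniteMeasure μ] {Y : Ω → S} (hY : Measurable Y)
    (κ : @Kernel Ω S m _) (hκ : @IsMarkovKernel _ _ m _ κ)
    (h : ∀ B, MeasurableSet B →
      μ[(Y ⁻¹' B).indicator (fun _ => (1 : ℝ)) | m] =ᵐ[μ] fun ω => (κ ω).real B)
    {φ : Ω × S → ℝ≥0∞} (hφ : @Measurable _ _ (m.prod inferInstance) _ φ) :
    ∫⁻ ω, φ (ω, Y ω) ∂μ = ∫⁻ ω, ∫⁻ s, φ (ω, s) ∂κ ω ∂μ := by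
  refine @lintegral_disintegration Ω Ω S mΩ m _ μ _ id (measurable_id'' hm) Y hY κ hκ ?_ φ hφ
  intro E B hE hB
  have hκB : Measurable[m] fun ω => κ ω B := @Kernel.measurable_coe Ω S m _ κ B hB
  have h1 : ∀ ω, κ ω B ≠ ∞ := fun ω => measure_ne_top _ _
  have h2 : ∫ ω in E, (κ ω).real B ∂μ = ∫ ω in E, (Y ⁻¹' B).indicator (fun _ => (1 : ℝ)) ω ∂μ := by
    rw [← setIntegral_condExp hm ((integrable_const (1 : ℝ)).indicator (hY hB)) hE]
    exact setIntegral_congr_ae (hm _ hE) ((h B hB).mono fun ω hω _ => hω.symm)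
  rw [integral_indicator (hY hB), Measure.restrict_restrict (hY hB)] at h2
  simp only [integral_const, smul_eq_mul, mul_one] at h2
  have h3 := integral_toReal (μ := μ.restrict E) (f := fun ω => κ ω B)
    ((hκB.mono hm le_rfl).aemeasurable) (Filter.Eventually.of_forall fun ω => (h1 ω).lt_top)
  have h4 : ∫⁻ ω in E, κ ω B ∂μ ≠ ∞ := by
    refine ne_top_of_le_ne_top (measure_ne_top μ E) ?_
    calc _ ≤ ∫⁻ ω in E, 1 ∂μ := lintegral_mono fun ω => prob_le_one
      _ = _ := by simp
  simp only [Set.preimage_id, id]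
  rw [← ENNReal.toReal_eq_toReal_iff' (measure_ne_top _ _) h4, ← h3]
  have h5 : ∫ ω in E, (κ ω B).toReal ∂μ = ∫ ω in E, (κ ω).real B ∂μ := rfl
  rw [h5, h2, Measure.real, Measure.restrict_apply_univ, Set.inter_comm]

/-- Restriction to `D` and the density `p` define the same measure on `m`. Comparing measures allows
arbitrary `G` with values in `[0, ∞]`, without integrability. -/
theorem setLIntegral_of_condExp_indicator {m mΩ : MeasurableSpace Ω} (hm : m ≤ mΩ)
    (μ : Measure Ω) [IsFiniteMeasure μ] {D : Set Ω} (hD : MeasurableSet D) {p : Ω → ℝ}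
    (hp : Measurable[m] p) (h : μ[D.indicator (fun _ => (1 : ℝ)) | m] =ᵐ[μ] p)
    {G : Ω → ℝ≥0∞} (hG : Measurable[m] G) :
    ∫⁻ ω in D, G ω ∂μ = ∫⁻ ω, G ω * ENNReal.ofReal (p ω) ∂μ := by
  have hpm : Measurable p := hp.mono hm le_rfl
  have hp0 : 0 ≤ᵐ[μ] p := by
    have : 0 ≤ᵐ[μ] μ[D.indicator (fun _ => (1 : ℝ)) | m] :=
      condExp_nonneg (Filter.Eventually.of_forall fun ω =>
        Set.indicator_nonneg (fun _ _ => zero_le_one) ω)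
    filter_upwards [this, h] with ω h1 h2
    rw [← h2]; exact h1
  have hint : Integrable p μ := integrable_condExp.congr h
  have heq : (μ.restrict D).trim hm = (μ.withDensity fun ω => ENNReal.ofReal (p ω)).trim hm := by
    refine @Measure.ext _ m _ _ fun E hE => ?_
    rw [trim_measurableSet_eq hm hE, trim_measurableSet_eq hm hE, withDensity_apply _ (hm _ hE),
      Measure.restrict_apply (hm _ hE),
      ← ofReal_integral_eq_lintegral_ofReal hint.integrableOn (ae_restrict_of_ae hp0)]
    have h2 : ∫ ω in E, p ω ∂μ = ∫ ω in E, D.indicator (fun _ => (1 : ℝ)) ω ∂μ := by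
      rw [← setIntegral_condExp hm ((integrable_const (1 : ℝ)).indicator hD) hE]
      exact setIntegral_congr_ae (hm _ hE) (h.mono fun ω hω _ => hω.symm)
    rw [h2, integral_indicator hD, Measure.restrict_restrict hD]
    simp only [integral_const, smul_eq_mul, mul_one]
    rw [Measure.real, Measure.restrict_apply_univ, Set.inter_comm,
      ENNReal.ofReal_toReal (measure_ne_top _ _)]
  rw [← lintegral_trim hm hG, heq, lintegral_trim hm hG,
    lintegral_withDensity_eq_lintegral_mul _ hpm.ennreal_ofReal (hG.mono hm le_rfl)]
  exact lintegral_congr fun ω => by simp [mul_comm]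

/-- Splitting over `D` and its complement leaves the two-point inequality `huv`. Here `v` is the
predictable compensator of the jump `u`. -/
theorem isStep_of_condExp_indicator {m mΩ : MeasurableSpace Ω} (hm : m ≤ mΩ)
    (μ : Measure Ω) [IsFiniteMeasure μ] {D : Set Ω} (hD : MeasurableSet D) {p u v : Ω → ℝ}
    (hp : Measurable[m] p) (h : μ[D.indicator (fun _ => (1 : ℝ)) | m] =ᵐ[μ] p)
    (hu : Measurable[m] u) (hv : Measurable[m] v)
    (huv : ∀ᵐ ω ∂μ, 0 ≤ p ω → p ω ≤ 1 →
      p ω * Real.exp (u ω + v ω) + (1 - p ω) * Real.exp (v ω) ≤ 1) :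
    IsStep μ m fun ω => D.indicator (fun _ => (1 : ℝ)) ω * u ω + v ω := by
  intro G hG
  have hDc : μ[Dᶜ.indicator (fun _ => (1 : ℝ)) | m] =ᵐ[μ] fun ω => 1 - p ω := by
    have h1 : Dᶜ.indicator (fun _ => (1 : ℝ)) = (fun _ => (1 : ℝ)) - D.indicator fun _ => 1 := by
      ext ω
      by_cases hω : ω ∈ D <;> simp [hω]
    rw [h1]
    refine (condExp_sub (integrable_const _) ((integrable_const _).indicator hD) m).trans ?_
    rw [condExp_const hm]
    filter_upwards [h] with ω hω
    simp [hω]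
  have hp0 : 0 ≤ᵐ[μ] p := by
    have : 0 ≤ᵐ[μ] μ[D.indicator (fun _ => (1 : ℝ)) | m] :=
      condExp_nonneg (Filter.Eventually.of_forall fun ω =>
        Set.indicator_nonneg (fun _ _ => zero_le_one) ω)
    filter_upwards [this, h] with ω h1 h2
    rw [← h2]; exact h1
  have hp1 : 0 ≤ᵐ[μ] fun ω => 1 - p ω := by
    have : 0 ≤ᵐ[μ] μ[Dᶜ.indicator (fun _ => (1 : ℝ)) | m] :=
      condExp_nonneg (Filter.Eventually.of_forall fun ω =>
        Set.indicator_nonneg (fun _ _ => zero_le_one) ω)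
    filter_upwards [this, hDc] with ω h1 h2
    rw [← h2]; exact h1
  have hG1 : Measurable[m] fun ω => G ω * ENNReal.ofReal (Real.exp (u ω + v ω)) :=
    hG.mul (Real.measurable_exp.comp (hu.add hv)).ennreal_ofReal
  have hG2 : Measurable[m] fun ω => G ω * ENNReal.ofReal (Real.exp (v ω)) :=
    hG.mul (Real.measurable_exp.comp hv).ennreal_ofReal
  rw [← lintegral_add_compl _ hD]
  have e1 : ∫⁻ ω in D, G ω * ENNReal.ofReal
      (Real.exp (D.indicator (fun _ => (1 : ℝ)) ω * u ω + v ω)) ∂μ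
      = ∫⁻ ω in D, G ω * ENNReal.ofReal (Real.exp (u ω + v ω)) ∂μ :=
    setLIntegral_congr_fun hD fun ω hω => by simp [hω]
  have e2 : ∫⁻ ω in Dᶜ, G ω * ENNReal.ofReal
      (Real.exp (D.indicator (fun _ => (1 : ℝ)) ω * u ω + v ω)) ∂μ
      = ∫⁻ ω in Dᶜ, G ω * ENNReal.ofReal (Real.exp (v ω)) ∂μ :=
    setLIntegral_congr_fun hD.compl fun ω hω => by
      have : ω ∉ D := hω
      simp [this]
  rw [e1, e2, setLIntegral_of_condExp_indicator hm μ hD hp h hG1,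
    setLIntegral_of_condExp_indicator hm μ hD.compl (measurable_const.sub hp) hDc hG2,
    ← lintegral_add_left]
  · refine lintegral_mono_ae ?_
    filter_upwards [huv, hp0, hp1] with ω h1 h2 h3
    have h2' : 0 ≤ p ω := h2
    have h3' : 0 ≤ 1 - p ω := h3
    rw [mul_assoc, mul_assoc, ← mul_add, ← ENNReal.ofReal_mul (Real.exp_nonneg _),
      ← ENNReal.ofReal_mul (Real.exp_nonneg _), ← ENNReal.ofReal_add (by positivity) (by positivity)]
    calc _ ≤ G ω * 1 := by
          gcongr
          rw [ENNReal.ofReal_le_one]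
          change Real.exp (u ω + v ω) * p ω + Real.exp (v ω) * (1 - p ω) ≤ 1
          linarith [h1 h2' (by linarith), mul_comm (p ω) (Real.exp (u ω + v ω)),
            mul_comm (1 - p ω) (Real.exp (v ω))]
      _ = G ω := mul_one _
  · exact (hG1.mono hm le_rfl).mul (hp.mono hm le_rfl).ennreal_ofReal

end Steps

/-! ### Bellman equations, gaps and sub-optimality. -/

section Values

variable {S A : Type*} [MeasurableSpace S] [MeasurableSpace A] (M : MDP S A)

instance (h : ℕ) : IsMarkovKernel (M.P h) := M.markov h

theorem integrable_of_bounds {X : Type*} [MeasurableSpace X] {ν : Measure X} [IsFiniteMeasure ν]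
    {f : X → ℝ} (hf : Measurable f) {a b : ℝ} (hb : ∀ x, f x ∈ Set.Icc a b) : Integrable f ν :=
  Integrable.of_mem_Icc a b hf.aemeasurable (Filter.Eventually.of_forall hb)

theorem integral_mem_Icc {X : Type*} [MeasurableSpace X] {ν : Measure X} [IsProbabilityMeasure ν]
    {f : X → ℝ} (hf : Measurable f) {a b : ℝ} (hb : ∀ x, f x ∈ Set.Icc a b) :
    ∫ x, f x ∂ν ∈ Set.Icc a b := by
  have hi := integrable_of_bounds (ν := ν) hf hb
  constructor
  · have := integral_mono (integrable_const a) hi fun x => (hb x).1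
    simpa using this
  · have := integral_mono hi (integrable_const b) fun x => (hb x).2
    simpa using this

theorem integral_bind_kernel {X Y : Type*} [MeasurableSpace X] [MeasurableSpace Y] (ν : Measure X)
    [IsProbabilityMeasure ν] (κ : Kernel X Y) [IsMarkovKernel κ] {f : Y → ℝ} (hf : Measurable f)
    {a b : ℝ} (hb : ∀ x, f x ∈ Set.Icc a b) :
    ∫ y, f y ∂(ν.bind κ) = ∫ x, ∫ y, f y ∂κ x ∂ν := by
  have h1 : ν.bind κ = (ν ⊗ₘ κ).map Prod.snd := (Measure.snd_compProd ν κ).symm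
  rw [h1, integral_map measurable_snd.aemeasurable hf.aestronglyMeasurable]
  exact Measure.integral_compProd (integrable_of_bounds (hf.comp measurable_snd) fun q => hb q.2)

theorem measurable_integral_kernel {X S' : Type*} [MeasurableSpace X] [MeasurableSpace S']
    (κ : Kernel X S') [IsMarkovKernel κ] {f : X → S' → ℝ}
    (hf : Measurable fun q : X × S' => f q.1 q.2) : Measurable fun x => ∫ s, f x s ∂κ x :=
  (hf.stronglyMeasurable.integral_kernel_prod_right' (κ := κ)).measurable

/-- The transition kernel of the state process when the action at `x` is `a x`. -/
def stepKernel (h : ℕ) {X : Type*} [MeasurableSpace X] {s : X → S} {a : X → A} (hs : Measurable s)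
    (ha : Measurable a) : Kernel X S :=
  (M.P h).comap (fun x => (s x, a x)) (hs.prodMk ha)

instance (h : ℕ) {X : Type*} [MeasurableSpace X] {s : X → S} {a : X → A} (hs : Measurable s)
    (ha : Measurable a) : IsMarkovKernel (stepKernel M h hs ha) := by
  unfold stepKernel; infer_instance

theorem visitLaw_succ (π : ℕ → S → A) (h : ℕ) (ν : Measure S) (n : ℕ) :
    M.visitLaw π h ν (n + 1)
      = M.visitLaw π (h + 1) (ν.bind fun x => M.P h (x, π h x)) n := by
  induction n with
  | zero => rfl
  | succ n ih =>
    rw [MDP.visitLaw, ih, MDP.visitLaw]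
    have : h + (n + 1) = h + 1 + n := by omega
    rw [this]

theorem expReturn_succ (π : ℕ → S → A) {h : ℕ} (hh : h < M.H) (ν : Measure S) :
    M.expReturn π h ν = ∫ x, M.r h x (π h x) ∂ν
      + M.expReturn π (h + 1) (ν.bind fun x => M.P h (x, π h x)) := by
  unfold MDP.expReturn
  have h1 : M.H - h = (M.H - (h + 1)) + 1 := by omega
  rw [h1, Finset.sum_range_succ', add_comm]
  congr 1
  refine Finset.sum_congr rfl fun n _ => ?_
  rw [visitLaw_succ]
  have : h + (n + 1) = h + 1 + n := by omega
  rw [this]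

theorem expReturn_last (π : ℕ → S → A) (ν : Measure S) : M.expReturn π M.H ν = 0 := by
  simp [MDP.expReturn]

theorem V_last (π : ℕ → S → A) (s : S) : M.V π M.H s = 0 := expReturn_last M π _

theorem measurable_reward {π : ℕ → S → A} {h : ℕ} (hπ : Measurable (π h)) :
    Measurable fun x => M.r h x (π h x) :=
  (M.r_measurable h).comp (measurable_id.prodMk hπ)

theorem V_eq_reward_add_expReturn {π : ℕ → S → A} {h : ℕ} (hh : h < M.H) (hπ : Measurable (π h))
    (s : S) :
    M.V π h s = M.r h s (π h s) + M.expReturn π (h + 1) (M.P h (s, π h s)) := by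
  unfold MDP.V
  rw [expReturn_succ M π hh, integral_dirac' _ _ (measurable_reward M hπ).stronglyMeasurable]
  congr 2
  exact Measure.dirac_bind (stepKernel M h measurable_id hπ).measurable s

/-- One backward induction for all three facts: the Bellman step at `h` needs measurability, bounds
and the integral representation at `h + 1`. -/
theorem value_facts {π : ℕ → S → A} (hπ : ∀ h < M.H, Measurable (π h)) (n : ℕ) :
    ∀ h, h + n = M.H → Measurable (M.V π h) ∧ (∀ s, M.V π h s ∈ Set.Icc (0 : ℝ) n) ∧
      ∀ ν : Measure S, IsProbabilityMeasure ν → M.expReturn π h ν = ∫ x, M.V π h x ∂ν := by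
  induction n with
  | zero =>
    intro h hh
    obtain rfl : h = M.H := by omega
    have h0 : M.V π M.H = fun _ => 0 := funext fun s => V_last M π s
    rw [h0]
    refine ⟨measurable_const, fun s => by simp, fun ν _ => ?_⟩
    rw [expReturn_last]; simp
  | succ n ih =>
    intro h hh
    have hlt : h < M.H := by omega
    obtain ⟨h1, h2, h3⟩ := ih (h + 1) (by omega)
    have hV : M.V π h = fun s => M.r h s (π h s) + ∫ x, M.V π (h + 1) x ∂(M.P h (s, π h s)) := by
      ext s
      rw [V_eq_reward_add_expReturn M hlt (hπ h hlt), h3 _ inferInstance]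
    have hm1 := measurable_reward M (hπ h hlt)
    have hm2 : Measurable fun s => ∫ x, M.V π (h + 1) x ∂(M.P h (s, π h s)) :=
      measurable_integral_kernel (stepKernel M h measurable_id (hπ h hlt)) (h1.comp measurable_snd)
    have hb : ∀ s, ∫ x, M.V π (h + 1) x ∂(M.P h (s, π h s)) ∈ Set.Icc (0 : ℝ) n :=
      fun s => integral_mem_Icc h1 h2
    refine ⟨by rw [hV]; exact hm1.add hm2, fun s => ?_, fun ν _ => ?_⟩
    · rw [hV]
      have := M.r_mem h s (π h s)
      have h4 := hb s
      constructor
      · exact add_nonneg this.1 h4.1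
      · push_cast
        linarith [this.2, h4.2]
    · rw [expReturn_succ M π hlt, hV]
      have hbind : ν.bind (fun x => M.P h (x, π h x))
          = ν.bind (stepKernel M h measurable_id (hπ h hlt)) := rfl
      have : IsProbabilityMeasure (ν.bind (stepKernel M h measurable_id (hπ h hlt))) := by
        infer_instance
      rw [hbind, h3 _ this, integral_bind_kernel ν _ h1 h2,
        integral_add (integrable_of_bounds hm1 fun s => M.r_mem h s (π h s))
          (integrable_of_bounds hm2 hb)]
      rfl

theorem measurable_V {π : ℕ → S → A} (hπ : ∀ h < M.H, Measurable (π h)) {h : ℕ} (hh : h ≤ M.H) :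
    Measurable (M.V π h) := (value_facts M hπ (M.H - h) h (by omega)).1

theorem V_mem_Icc {π : ℕ → S → A} (hπ : ∀ h < M.H, Measurable (π h)) {h : ℕ} (hh : h ≤ M.H)
    (s : S) : M.V π h s ∈ Set.Icc (0 : ℝ) M.H := by
  have h1 := (value_facts M hπ (M.H - h) h (by omega)).2.1 s
  refine ⟨h1.1, h1.2.trans ?_⟩
  exact_mod_cast Nat.sub_le _ _

theorem expReturn_eq_integral {π : ℕ → S → A} (hπ : ∀ h < M.H, Measurable (π h)) {h : ℕ}
    (hh : h ≤ M.H) (ν : Measure S) [IsProbabilityMeasure ν] :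
    M.expReturn π h ν = ∫ x, M.V π h x ∂ν :=
  (value_facts M hπ (M.H - h) h (by omega)).2.2 ν inferInstance

theorem V_bellman {π : ℕ → S → A} (hπ : ∀ h < M.H, Measurable (π h)) {h : ℕ} (hh : h < M.H)
    (s : S) :
    M.V π h s = M.r h s (π h s) + ∫ x, M.V π (h + 1) x ∂(M.P h (s, π h s)) := by
  rw [V_eq_reward_add_expReturn M hh (hπ h hh), expReturn_eq_integral M hπ hh]

theorem Q_eq {π : ℕ → S → A} (hπ : ∀ h < M.H, Measurable (π h)) {h : ℕ} (hh : h < M.H)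
    (s : S) (a : A) :
    M.Q π h s a = M.r h s a + ∫ x, M.V π (h + 1) x ∂(M.P h (s, a)) := by
  rw [MDP.Q, expReturn_eq_integral M hπ hh]

/-- The policies played are random, so their values must be measurable jointly in the outcome and
the state. -/
theorem measurable_V_joint {Ω : Type*} [MeasurableSpace Ω] {π : Ω → ℕ → S → A}
    (hπ : ∀ h < M.H, Measurable fun q : Ω × S => π q.1 h q.2) (n : ℕ) :
    ∀ h, h + n = M.H → Measurable fun q : Ω × S => M.V (π q.1) h q.2 := by
  have hπ' : ∀ ω, ∀ h < M.H, Measurable (π ω h) := fun ω h hh =>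
    (hπ h hh).comp measurable_prodMk_left
  induction n with
  | zero =>
    intro h hh
    obtain rfl : h = M.H := by omega
    simp_rw [V_last]
    exact measurable_const
  | succ n ih =>
    intro h hh
    have hlt : h < M.H := by omega
    have h1 := ih (h + 1) (by omega)
    have hV : (fun q : Ω × S => M.V (π q.1) h q.2) = fun q => M.r h q.2 (π q.1 h q.2)
        + ∫ x, M.V (π q.1) (h + 1) x ∂(M.P h (q.2, π q.1 h q.2)) := by
      ext q
      rw [V_bellman M (hπ' q.1) hlt]
    rw [hV]
    refine ((M.r_measurable h).comp (measurable_snd.prodMk (hπ h hlt))).add ?_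
    exact measurable_integral_kernel (stepKernel M h measurable_snd (hπ h hlt))
      (f := fun q x => M.V (π q.1) (h + 1) x)
      (h1.comp ((measurable_fst.comp measurable_fst).prodMk measurable_snd))

variable {M} {πs : ℕ → S → A}

/-- Optimality is compared with the policy that plays `a` in every state at step `h` and follows
`πs` otherwise: it is measurable, and its values after step `h` are those of `πs`. -/
theorem gap_nonneg (hs : M.IsOptimal πs) {h : ℕ} (hh : h < M.H) (s : S) (a : A) :
    0 ≤ M.gap πs h s a := by
  classical
  set π' : ℕ → S → A := Function.update πs h fun _ => a with hπ'
  have hm : ∀ h', Measurable (π' h') := by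
    intro h'
    by_cases he : h' = h
    · subst he; simp [hπ']
    · simp only [hπ', Function.update_of_ne he]; exact hs.1 h'
  have h1 := hs.2 π' hm h hh s
  have h2 : ∀ n, ∀ j, h < j → ∀ s, j + n = M.H → M.V π' j s = M.V πs j s := by
    intro n
    induction n with
    | zero => intro j _ s hj; obtain rfl : j = M.H := by omega
              rw [V_last, V_last]
    | succ n ih =>
      intro j hj s hjn
      rw [V_bellman M (fun h _ => hm h) (by omega), V_bellman M (fun h _ => hs.1 h) (by omega)]
      have h3 : π' j = πs j := Function.update_of_ne (by omega) _ _
      rw [h3]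
      congr 1
      exact integral_congr_ae (Filter.Eventually.of_forall fun x => ih (j + 1) (by omega) x (by omega))
  rw [V_bellman M (fun h _ => hm h) hh] at h1
  have h4 : π' h = fun _ => a := Function.update_self _ _ _
  have h5 : M.V π' (h + 1) = M.V πs (h + 1) :=
    funext fun x => h2 (M.H - (h + 1)) (h + 1) (by omega) x (by omega)
  rw [h4, h5] at h1
  rw [MDP.gap, Q_eq M (fun h _ => hs.1 h) hh]
  linarith

theorem gap_le (hs : M.IsOptimal πs) {h : ℕ} (hh : h < M.H) (s : S) (a : A) :
    M.gap πs h s a ≤ M.H := by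
  have hm : ∀ h < M.H, Measurable (πs h) := fun h _ => hs.1 h
  rw [MDP.gap, Q_eq M hm hh]
  have h1 := V_mem_Icc M hm hh.le s
  have h2 : ∫ x, M.V πs (h + 1) x ∂(M.P h (s, a)) ∈ Set.Icc (0 : ℝ) M.H :=
    integral_mem_Icc (measurable_V M hm hh) fun x => V_mem_Icc M hm hh x
  have h3 := M.r_mem h s a
  linarith [h1.2, h2.1, h3.1]

theorem measurable_gap (hs : M.IsOptimal πs) {h : ℕ} (hh : h < M.H) :
    Measurable fun z : S × A => M.gap πs h z.1 z.2 := by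
  have hm : ∀ h < M.H, Measurable (πs h) := fun h _ => hs.1 h
  unfold MDP.gap
  simp_rw [Q_eq M hm hh]
  refine ((measurable_V M hm hh.le).comp measurable_fst).sub ((M.r_measurable h).add ?_)
  exact measurable_integral_kernel (M.P h) ((measurable_V M hm hh).comp measurable_snd)

theorem gapMin_le (hs : M.IsOptimal πs) {h : ℕ} (hh : h < M.H) (s : S) (a : A)
    (hg : M.gap πs h s a ≠ 0) : M.gapMin πs ≤ M.gap πs h s a := by
  refine csInf_le ⟨0, ?_⟩ ⟨hg, h, hh, s, a, rfl⟩
  rintro _ ⟨_, h', hh', s', a', rfl⟩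
  exact gap_nonneg hs hh' s' a'

/-- The sub-optimality of the policy `π`. -/
noncomputable def subopt (M : MDP S A) (πs π : ℕ → S → A) (h : ℕ) (s : S) : ℝ := M.V πs h s - M.V π h s

theorem V_le_opt (hs : M.IsOptimal πs) {π : ℕ → S → A} (hπ : ∀ h < M.H, Measurable (π h)) {h : ℕ}
    (hh : h ≤ M.H) (s : S) : M.V π h s ≤ M.V πs h s := by
  have hm : ∀ h < M.H, Measurable (πs h) := fun h _ => hs.1 h
  obtain ⟨n, hn⟩ : ∃ n, h + n = M.H := ⟨M.H - h, by omega⟩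
  clear hh
  induction n generalizing h s with
  | zero => obtain rfl : h = M.H := by omega
            rw [V_last, V_last]
  | succ n ih =>
    have hh : h < M.H := by omega
    have h1 := gap_nonneg hs hh s (π h s)
    rw [MDP.gap, Q_eq M hm hh] at h1
    rw [V_bellman M hπ hh]
    have h2 : ∫ x, M.V π (h + 1) x ∂(M.P h (s, π h s))
        ≤ ∫ x, M.V πs (h + 1) x ∂(M.P h (s, π h s)) :=
      integral_mono (integrable_of_bounds (measurable_V M hπ hh) fun x => V_mem_Icc M hπ hh x)
        (integrable_of_bounds (measurable_V M hm hh) fun x => V_mem_Icc M hm hh x)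
        fun x => ih x (by omega)
    linarith

theorem subopt_mem_Icc (hs : M.IsOptimal πs) {π : ℕ → S → A} (hπ : ∀ h < M.H, Measurable (π h))
    {h : ℕ} (hh : h ≤ M.H) (s : S) : subopt M πs π h s ∈ Set.Icc (0 : ℝ) M.H := by
  have hm : ∀ h < M.H, Measurable (πs h) := fun h _ => hs.1 h
  have h1 := V_le_opt hs hπ hh s
  have h2 := V_mem_Icc M hπ hh s
  have h3 := V_mem_Icc M hm hh s
  unfold subopt
  constructor <;> linarith [h2.1, h3.2]

/-- One step of the performance difference identity: unrolled, it expresses the sub-optimality as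
the expected sum of the gaps met by `π`. -/
theorem subopt_eq (hs : M.IsOptimal πs) {π : ℕ → S → A} (hπ : ∀ h < M.H, Measurable (π h)) {h : ℕ}
    (hh : h < M.H) (s : S) :
    subopt M πs π h s = M.gap πs h s (π h s)
      + ∫ x, subopt M πs π (h + 1) x ∂(M.P h (s, π h s)) := by
  have hm : ∀ h < M.H, Measurable (πs h) := fun h _ => hs.1 h
  unfold subopt
  rw [integral_sub (integrable_of_bounds (measurable_V M hm hh) fun x => V_mem_Icc M hm hh x)
    (integrable_of_bounds (measurable_V M hπ hh) fun x => V_mem_Icc M hπ hh x),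
    MDP.gap, Q_eq M hm hh, V_bellman M hπ hh]
  ring

end Values

/-! ### Counting separated points by the eluder dimension. -/

section Eluder

variable {X : Type*}

theorem dataNorm_sq (Z : Multiset X) (f : X → ℝ) :
    dataNorm Z f ^ 2 = (Z.map fun z => f z ^ 2).sum := by
  refine Real.sq_sqrt (Multiset.sum_nonneg fun x hx => ?_)
  obtain ⟨z, _, rfl⟩ := Multiset.mem_map.1 hx
  positivity

/-- Every element of `l` is `u`-independent of its predecessors. -/
def IsIndepList (F : Set (X → ℝ)) (D : Set X) (u : ℝ) (l : List X) : Prop :=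
  (∀ x ∈ l, x ∈ D) ∧
    ∀ (i : ℕ) (hi : i < l.length), ¬ IsDependent F u (l.take i : Multiset X) l[i]

theorem IsIndepList.nil (F : Set (X → ℝ)) (D : Set X) (u : ℝ) : IsIndepList F D u [] :=
  ⟨by simp, fun i hi => by simp at hi⟩

theorem IsIndepList.append {F : Set (X → ℝ)} {D : Set X} {u : ℝ} {l : List X}
    (hl : IsIndepList F D u l) {x : X} (hx : x ∈ D)
    (h : ¬ IsDependent F u (l : Multiset X) x) : IsIndepList F D u (l ++ [x]) := by
  refine ⟨fun y hy => ?_, fun i hi => ?_⟩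
  · rcases List.mem_append.1 hy with hy | hy
    · exact hl.1 y hy
    · rw [List.mem_singleton.1 hy]; exact hx
  · rcases Nat.lt_or_ge i l.length with hi' | hi'
    · rw [List.take_append_of_le_length hi'.le, List.getElem_append_left hi']
      exact hl.2 i hi'
    · have h1 : i = l.length := by
        simp at hi; omega
      subst h1
      simpa using h

theorem IsIndepList.length_le {F : Set (X → ℝ)} {D : Set X} {ε u : ℝ} {d : ℕ} {l : List X}
    (hd : eluderDim F D ε ≤ d) (hu : ε ≤ u) (hl : IsIndepList F D u l) : l.length ≤ d := by
  have : (l.length : ℕ∞) ≤ eluderDim F D ε := by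
    unfold eluderDim
    exact le_iSup₂_of_le (f := fun (l : List X) (_ : l ∈ {l : List X | (∀ x ∈ l, x ∈ D) ∧
      ∃ ε' : ℝ, ε ≤ ε' ∧ ∀ (i : ℕ) (hi : i < l.length),
        ¬ IsDependent F ε' (l.take i : Multiset X) l[i]}) => (l.length : ℕ∞)) l
      ⟨hl.1, u, hu, hl.2⟩ le_rfl
  exact_mod_cast this.trans hd

theorem not_isDependent_of {F : Set (X → ℝ)} {u : ℝ} {Z : Multiset X} {x : X} {f g : X → ℝ}
    (hf : f ∈ F) (hg : g ∈ F) (h1 : dataNorm Z (f - g) ≤ u) (h2 : u < |f x - g x|) :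
    ¬ IsDependent F u Z x := fun h => absurd (h f hf g hg h1) (not_le.2 h2)

/-- If the elements of `J` are separated by pairs of functions of `F` at scale `u`, then they can be
distributed to buckets of size at most `d` such that `k` in the bucket `m` has data norm at least
`m u²`. -/
theorem exists_bucket {F : Set (X → ℝ)} {D : Set X} {ε u : ℝ} {d : ℕ}
    (hd : eluderDim F D ε ≤ d) (hε : ε ≤ u) (hu : 0 < u) (J : Finset ℕ) (z : ℕ → X)
    (f g : ℕ → X → ℝ) (hz : ∀ k ∈ J, z k ∈ D) (hf : ∀ k ∈ J, f k ∈ F) (hg : ∀ k ∈ J, g k ∈ F)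
    (hfg : ∀ k ∈ J, u < |f k (z k) - g k (z k)|) :
    ∃ m : ℕ → ℕ, (∀ i, (J.filter fun k => m k = i).card ≤ d) ∧
      ∀ k ∈ J, (m k : ℝ) * u ^ 2 ≤ ∑ j ∈ J.filter (· < k), (f k (z j) - g k (z j)) ^ 2 := by
  classical
  -- `L i` is the content of bucket `i` after the indices below `n` have been placed. The link
  -- between `L` and `m` is stated through sums of an arbitrary `w`, which serves both for
  -- cardinalities (`w = 1`) and for squared norms.
  have key : ∀ n : ℕ, ∃ (L : ℕ → List X) (m : ℕ → ℕ), (∀ i, IsIndepList F D u (L i)) ∧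
      (∀ i, ∀ w : X → ℝ, ∑ j ∈ J.filter (fun j => j < n ∧ m j = i), w (z j) = ((L i).map w).sum) ∧
      (∃ i₀, ∀ i, i₀ ≤ i → L i = []) ∧
      ∀ k ∈ J, k < n →
        (m k : ℝ) * u ^ 2 ≤ ∑ j ∈ J.filter (· < k), (f k (z j) - g k (z j)) ^ 2 := by
    intro n
    induction n with
    | zero =>
      exact ⟨fun _ => [], fun _ => 0, fun i => IsIndepList.nil F D u, fun i w => by simp,
        ⟨0, fun _ _ => rfl⟩, fun k _ hk => by omega⟩
    | succ n ih =>
      obtain ⟨L, m, h1, h2, ⟨i₀, h3⟩, h4⟩ := ih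
      by_cases hn : n ∈ J
      swap
      · refine ⟨L, m, h1, fun i w => ?_, ⟨i₀, h3⟩, fun k hk hkn => ?_⟩
        · rw [← h2 i w]
          congr 1
          ext j
          simp only [Finset.mem_filter]
          constructor
          · rintro ⟨a, b, c⟩
            have : j ≠ n := by rintro rfl; exact hn a
            exact ⟨a, by omega, c⟩
          · rintro ⟨a, b, c⟩
            exact ⟨a, by omega, c⟩
        · have : k ≠ n := by rintro rfl; exact hn hk
          exact h4 k hk (by omega)
      -- An empty bucket always accepts the point, since the data norm over it is zero.
      · have hex : ∃ i, ¬ IsDependent F u (L i : Multiset X) (z n) := by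
          refine ⟨i₀, not_isDependent_of (hf n hn) (hg n hn) ?_ (hfg n hn)⟩
          rw [h3 i₀ le_rfl]
          simp [dataNorm, hu.le]
        -- The point goes into the first bucket on which it is independent. Every earlier bucket
        -- refuses it, so the pair `f n, g n`, separated at `z n`, has squared norm at least `u²` on
        -- each of them; the buckets being disjoint, these contributions add up.
        set i₁ := Nat.find hex with hi₁
        have hi₁s : ¬ IsDependent F u (L i₁ : Multiset X) (z n) := Nat.find_spec hex
        have hi₁m : ∀ i < i₁, IsDependent F u (L i : Multiset X) (z n) := fun i hi =>
          not_not.1 (Nat.find_min hex hi)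
        have hupd : ∀ k, k ≠ n → Function.update m n i₁ k = m k := fun k hk =>
          Function.update_of_ne hk _ _
        refine ⟨Function.update L i₁ (L i₁ ++ [z n]), Function.update m n i₁, fun i => ?_,
          fun i w => ?_, ⟨max i₀ (i₁ + 1), fun i hi => ?_⟩, fun k hk hkn => ?_⟩
        · by_cases hi : i = i₁
          · subst hi
            rw [Function.update_self]
            exact (h1 _).append (hz n hn) hi₁s
          · rw [Function.update_of_ne hi]; exact h1 i
        · by_cases hi : i = i₁
          · have hs : J.filter (fun j => j < n + 1 ∧ Function.update m n i₁ j = i)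
                = insert n (J.filter fun j => j < n ∧ m j = i) := by
              ext j
              simp only [Finset.mem_filter, Finset.mem_insert]
              by_cases hj : j = n
              · subst hj; simp [hn, hi]
              · rw [hupd j hj]
                constructor
                · rintro ⟨a, b, c⟩; exact Or.inr ⟨a, by omega, c⟩
                · rintro (a | ⟨a, b, c⟩)
                  · exact absurd a hj
                  · exact ⟨a, by omega, c⟩
            rw [hs, Finset.sum_insert (by simp), h2, hi, Function.update_self]
            simp [add_comm]
          · rw [Function.update_of_ne hi, ← h2 i w]
            congr 1
            ext j
            simp only [Finset.mem_filter]
            by_cases hj : j = n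
            · subst hj
              have : i₁ ≠ i := fun h => hi h.symm
              simp [this]
            · rw [hupd j hj]
              constructor
              · rintro ⟨a, b, c⟩; exact ⟨a, by omega, c⟩
              · rintro ⟨a, b, c⟩; exact ⟨a, by omega, c⟩
        · rw [Function.update_of_ne (by omega)]
          exact h3 i (by omega)
        · by_cases hkn' : k = n
          · subst hkn'
            rw [Function.update_self]
            have hlow : ∀ i < i₁, u ^ 2 ≤ ∑ j ∈ J.filter (fun j => j < k ∧ m j = i),
                (f k (z j) - g k (z j)) ^ 2 := by
              intro i hi
              rw [h2 i fun x => (f k x - g k x) ^ 2]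
              by_contra hcon
              push Not at hcon
              refine not_isDependent_of (hf k hk) (hg k hk) ?_ (hfg k hk) (hi₁m i hi)
              refine Real.sqrt_le_iff.2 ⟨hu.le, ?_⟩
              refine le_of_eq_of_le ?_ hcon.le
              simp
            calc (i₁ : ℝ) * u ^ 2 = ∑ i ∈ Finset.range i₁, u ^ 2 := by simp
              _ ≤ ∑ i ∈ Finset.range i₁, ∑ j ∈ J.filter (fun j => j < k ∧ m j = i),
                (f k (z j) - g k (z j)) ^ 2 :=
                  Finset.sum_le_sum fun i hi => hlow i (Finset.mem_range.1 hi)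
              _ = ∑ i ∈ Finset.range i₁, ∑ j ∈ (J.filter (· < k)).filter (fun j => m j = i),
                (f k (z j) - g k (z j)) ^ 2 := by simp_rw [Finset.filter_filter]
              _ = ∑ j ∈ (J.filter (· < k)).filter (fun j => m j ∈ Finset.range i₁),
                (f k (z j) - g k (z j)) ^ 2 := by
                  rw [Finset.sum_fiberwise_eq_sum_filter]
              _ ≤ _ := Finset.sum_le_sum_of_subset_of_nonneg (Finset.filter_subset _ _)
                  fun _ _ _ => sq_nonneg _
          · rw [hupd k hkn']
            exact h4 k hk (by omega)
  obtain ⟨L, m, h1, h2, -, h4⟩ := key (J.sup id + 1)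
  have hJ : ∀ k ∈ J, k < J.sup id + 1 := fun k hk =>
    Nat.lt_succ_of_le (Finset.le_sup (f := id) hk)
  refine ⟨m, fun i => ?_, fun k hk => h4 k hk (hJ k hk)⟩
  have h5 := h2 i fun _ => 1
  have h6 : J.filter (fun j => j < J.sup id + 1 ∧ m j = i) = J.filter fun j => m j = i := by
    refine Finset.filter_congr fun j hj => ?_
    simp [hJ j hj]
  rw [h6] at h5
  simp only [Finset.sum_const, nsmul_eq_mul, mul_one, List.map_const', List.sum_replicate] at h5
  have h7 : (J.filter fun k => m k = i).card = (L i).length := by exact_mod_cast h5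
  rw [h7]
  exact (h1 i).length_le hd hε

/-- The bound `B` on past distances allows bucket numbers up to `B / u²` only, and each bucket holds
at most `d` points. -/
theorem card_le_of_separated {F : Set (X → ℝ)} {D : Set X} {ε u B : ℝ} {d : ℕ}
    (hd : eluderDim F D ε ≤ d) (hε : ε ≤ u) (hu : 0 < u) (hB : 0 ≤ B) (J : Finset ℕ) (z : ℕ → X)
    (hz : ∀ k ∈ J, z k ∈ D)
    (h : ∀ k ∈ J, ∃ f ∈ F, ∃ g ∈ F, u < |f (z k) - g (z k)| ∧
      ∑ j ∈ Finset.range k, (f (z j) - g (z j)) ^ 2 ≤ B) :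
    (J.card : ℝ) ≤ (B / u ^ 2 + 1) * d := by
  classical
  choose! f hf g hg hfg hB' using h
  obtain ⟨m, hm1, hm2⟩ := exists_bucket hd hε hu J z f g hz hf hg hfg
  have h1 : ∀ k ∈ J, m k ∈ Finset.range (⌊B / u ^ 2⌋₊ + 1) := by
    intro k hk
    rw [Finset.mem_range, Nat.lt_succ_iff]
    refine Nat.le_floor ?_
    rw [le_div_iff₀ (by positivity)]
    refine (hm2 k hk).trans (le_trans ?_ (hB' k hk))
    refine Finset.sum_le_sum_of_subset_of_nonneg (fun j hj => ?_) fun _ _ _ => sq_nonneg _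
    exact Finset.mem_range.2 (Finset.mem_filter.1 hj).2
  have h2 := Finset.card_le_mul_card_image_of_maps_to h1 d fun i _ => hm1 i
  rw [Finset.card_range] at h2
  calc (J.card : ℝ) ≤ ((d * (⌊B / u ^ 2⌋₊ + 1) : ℕ) : ℝ) := by exact_mod_cast h2
    _ = (⌊B / u ^ 2⌋₊ + 1) * d := by push_cast; ring
    _ ≤ _ := by
      gcongr
      exact Nat.floor_le (by positivity)

/-- Each bucket below `n` contributes at most `d` terms; the at most `n` remaining terms are bounded
by `φ n`, which is harmless for `φ` of order `1 / (i + 1)`. -/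
theorem sum_le_of_buckets {d n : ℕ} (J : Finset ℕ) (hJ : J.card ≤ n) (m : ℕ → ℕ)
    (hm : ∀ i, (J.filter fun k => m k = i).card ≤ d) (φ : ℕ → ℝ) (hφ : Antitone φ)
    (h0 : ∀ i, 0 ≤ φ i) :
    ∑ k ∈ J, φ (m k) ≤ d * ∑ i ∈ Finset.range n, φ i + n * φ n := by
  classical
  rw [← Finset.sum_filter_add_sum_filter_not J fun k => m k ∈ Finset.range n]
  refine add_le_add ?_ ?_
  · rw [← Finset.sum_fiberwise_eq_sum_filter, Finset.mul_sum]
    refine Finset.sum_le_sum fun i _ => ?_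
    have : ∀ k ∈ J.filter (fun k => m k = i), φ (m k) = φ i := fun k hk => by
      rw [(Finset.mem_filter.1 hk).2]
    rw [Finset.sum_congr rfl this, Finset.sum_const, nsmul_eq_mul]
    exact mul_le_mul_of_nonneg_right (by exact_mod_cast hm i) (h0 i)
  · calc _ ≤ ∑ k ∈ J.filter (fun k => m k ∉ Finset.range n), φ n := by
          refine Finset.sum_le_sum fun k hk => hφ ?_
          have := (Finset.mem_filter.1 hk).2
          simpa using this
      _ ≤ _ := by
          rw [Finset.sum_const, nsmul_eq_mul]
          refine mul_le_mul_of_nonneg_right ?_ (h0 n)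
          exact_mod_cast (Finset.card_filter_le _ _).trans hJ

/-- The largest level below `b` alone contributes at least `b`. -/
theorem dyadic_le {x₀ b : ℝ} (hx : 0 < x₀) (n : ℕ) (hb : b ≤ 2 ^ n * x₀) (hb' : x₀ < b) :
    b ≤ ∑ i ∈ Finset.range n, 2 * (2 ^ i * x₀) * (if 2 ^ i * x₀ < b then 1 else 0) := by
  induction n with
  | zero => simp at hb; linarith
  | succ n ih =>
    rw [Finset.sum_range_succ]
    by_cases h : b ≤ 2 ^ n * x₀
    · have := ih h
      have h2 : 0 ≤ 2 * (2 ^ n * x₀) * (if 2 ^ n * x₀ < b then (1 : ℝ) else 0) := by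
        split_ifs <;> positivity
      linarith
    · push Not at h
      rw [if_pos h]
      have h2 : 0 ≤ ∑ i ∈ Finset.range n, 2 * (2 ^ i * x₀) * (if 2 ^ i * x₀ < b then (1 : ℝ) else 0) :=
        Finset.sum_nonneg fun i _ => by split_ifs <;> positivity
      rw [pow_succ] at hb
      linarith

theorem sum_half_pow_le (n : ℕ) : ∑ i ∈ Finset.range n, ((2 : ℝ) ^ i)⁻¹ ≤ 2 := by
  have h : ∀ n, ∑ i ∈ Finset.range n, ((2 : ℝ) ^ i)⁻¹ = 2 - 2 * ((2 : ℝ) ^ n)⁻¹ := by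
    intro n
    induction n with
    | zero => norm_num
    | succ n ih => rw [Finset.sum_range_succ, ih, pow_succ]; field_simp; ring
  rw [h]
  have : 0 < ((2 : ℝ) ^ n)⁻¹ := by positivity
  linarith

theorem sum_two_pow_lt (n : ℕ) : ∑ i ∈ Finset.range n, (2 : ℝ) ^ i < 2 ^ n := by
  induction n with
  | zero => norm_num
  | succ n ih => rw [Finset.sum_range_succ, pow_succ]; linarith

/-- Layer-cake bound for values whose level sets are bounded by `(B / x² + 1) d`. -/
theorem sum_large_le {J : Finset ℕ} {b : ℕ → ℝ} {x₀ M B d : ℝ} (hx : 0 < x₀) (hxM : x₀ ≤ M)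
    (hd : 0 ≤ d) (hB : 0 ≤ B) (hbM : ∀ k ∈ J, b k ≤ M)
    (hcard : ∀ x, x₀ ≤ x → ((J.filter fun k => x < b k).card : ℝ) ≤ (B / x ^ 2 + 1) * d) :
    ∑ k ∈ J.filter (fun k => x₀ < b k), b k ≤ 4 * B * d / x₀ + 4 * M * d := by
  classical
  have hex : ∃ n : ℕ, M ≤ 2 ^ n * x₀ := by
    obtain ⟨n, hn⟩ := pow_unbounded_of_one_lt (M / x₀) (one_lt_two)
    exact ⟨n, by rw [div_lt_iff₀ hx] at hn; exact hn.le⟩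
  set n := Nat.find hex with hn
  have hn1 : M ≤ 2 ^ n * x₀ := Nat.find_spec hex
  -- Minimality of `n` keeps the increasing geometric sum, which comes from the `+ 1` in `hcard`, of
  -- order `M`.
  have hn2 : (2 : ℝ) ^ n * x₀ ≤ 2 * M := by
    rcases Nat.eq_zero_or_pos n with h0 | hpos
    · rw [h0]; linarith
    · have h := Nat.find_min hex (m := n - 1) (by omega)
      push Not at h
      have : (2 : ℝ) ^ n = 2 * 2 ^ (n - 1) := by
        rw [← pow_succ']; congr 1; omega
      rw [this]; linarith
  calc ∑ k ∈ J.filter (fun k => x₀ < b k), b k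
      ≤ ∑ k ∈ J.filter (fun k => x₀ < b k), ∑ i ∈ Finset.range n,
        2 * (2 ^ i * x₀) * (if 2 ^ i * x₀ < b k then 1 else 0) := by
        refine Finset.sum_le_sum fun k hk => ?_
        obtain ⟨hk1, hk2⟩ := Finset.mem_filter.1 hk
        exact dyadic_le hx n ((hbM k hk1).trans hn1) hk2
    _ = ∑ i ∈ Finset.range n, 2 * (2 ^ i * x₀) * ∑ k ∈ J.filter (fun k => x₀ < b k),
        (if 2 ^ i * x₀ < b k then 1 else 0) := by
        rw [Finset.sum_comm]
        simp_rw [Finset.mul_sum]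
    _ ≤ ∑ i ∈ Finset.range n, 2 * (2 ^ i * x₀) * ((B / (2 ^ i * x₀) ^ 2 + 1) * d) := by
        refine Finset.sum_le_sum fun i _ => ?_
        refine mul_le_mul_of_nonneg_left ?_ (by positivity)
        have h1 : x₀ ≤ 2 ^ i * x₀ := le_mul_of_one_le_left hx.le (one_le_pow₀ one_le_two)
        refine le_trans ?_ (hcard _ h1)
        rw [Finset.sum_boole]
        gcongr
        exact Finset.filter_subset _ _
    _ = 2 * B * d / x₀ * ∑ i ∈ Finset.range n, ((2 : ℝ) ^ i)⁻¹
        + 2 * x₀ * d * ∑ i ∈ Finset.range n, (2 : ℝ) ^ i := by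
        rw [Finset.mul_sum, Finset.mul_sum, ← Finset.sum_add_distrib]
        refine Finset.sum_congr rfl fun i _ => ?_
        field_simp
    _ ≤ 2 * B * d / x₀ * 2 + 2 * x₀ * d * 2 ^ n := by
        gcongr
        · exact sum_half_pow_le n
        · exact (sum_two_pow_lt n).le
    _ ≤ _ := by
        have : 2 * x₀ * d * 2 ^ n = 2 * d * (2 ^ n * x₀) := by ring
        rw [this]
        have h3 : 2 * d * (2 ^ n * x₀) ≤ 2 * d * (2 * M) := by gcongr
        have h4 : 2 * B * d / x₀ * 2 = 4 * B * d / x₀ := by ring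
        linarith

end Eluder

/-! ### The sum of the sensitivities. -/

section SensitivitySum

variable {X : Type*}

theorem sum_inv_le_log (n : ℕ) : ∑ i ∈ Finset.range n, ((i : ℝ) + 1)⁻¹ ≤ 1 + Real.log n := by
  have h := harmonic_le_one_add_log n
  have h2 : ((harmonic n : ℚ) : ℝ) = ∑ i ∈ Finset.range n, ((i : ℝ) + 1)⁻¹ := by
    simp [harmonic]
  rwa [h2] at h

theorem half_lt_log {T : ℝ} (hT : 2 ≤ T) : (0.69 : ℝ) < Real.log T := by
  have h1 := Real.log_two_gt_d9
  have h2 := Real.log_le_log (by norm_num) hT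
  linarith

/-- Inside a dyadic band the numerator is at most `4 u²`, while bucket `m` forces the denominator to
be at least `m u²`. So `a k` is at most `104 / m`, hence `208 / (m + 1)`, where bucket `0` uses `a k
≤ 1`; the harmonic sum gives one logarithm. -/
theorem sum_bucket_sens_le {F : Set (X → ℝ)} {D : Set X} {ε u T β : ℝ} {d K : ℕ}
    (hd : eluderDim F D ε ≤ d) (hε : ε ≤ u) (hu : 0 < u) (hT : 2 ≤ T) (hK : 1 ≤ K)
    (hKT : (K : ℝ) ≤ T) (hβ : 0 < β) (J : Finset ℕ) (hJ : J ⊆ Finset.range K) (z : ℕ → X)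
    (a : ℕ → ℝ) (f g : ℕ → X → ℝ) (hz : ∀ k ∈ J, z k ∈ D) (hf : ∀ k ∈ J, f k ∈ F)
    (hg : ∀ k ∈ J, g k ∈ F) (ha : ∀ k ∈ J, a k ≤ 1)
    (hlow : ∀ k ∈ J, u < |f k (z k) - g k (z k)|)
    (hup : ∀ k ∈ J, |f k (z k) - g k (z k)| ≤ 2 * u)
    (hs : ∀ k ∈ J, a k ≤ 26 * (f k (z k) - g k (z k)) ^ 2
      / (∑ j ∈ Finset.range k, (f k (z j) - g k (z j)) ^ 2 + β)) :
    ∑ k ∈ J, a k ≤ 820 * (max 1 (d : ℝ) * Real.log T) := by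
  classical
  obtain ⟨m, hm1, hm2⟩ := exists_bucket hd hε hu J z f g hz hf hg hlow
  have hlog := half_lt_log hT
  have hφ : ∀ k ∈ J, a k ≤ 208 * ((m k : ℝ) + 1)⁻¹ := by
    intro k hk
    rcases Nat.eq_zero_or_pos (m k) with h0 | hpos
    · rw [h0]; have := ha k hk; norm_num; linarith
    · have hm : (1 : ℝ) ≤ m k := by exact_mod_cast hpos
      have h1 : (m k : ℝ) * u ^ 2 ≤ ∑ j ∈ Finset.range k, (f k (z j) - g k (z j)) ^ 2 := by
        refine (hm2 k hk).trans ?_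
        refine Finset.sum_le_sum_of_subset_of_nonneg (fun j hj => ?_) fun _ _ _ => sq_nonneg _
        exact Finset.mem_range.2 (Finset.mem_filter.1 hj).2
      have h2 : (f k (z k) - g k (z k)) ^ 2 ≤ 4 * u ^ 2 := by
        rw [← sq_abs]
        have := pow_le_pow_left₀ (abs_nonneg _) (hup k hk) 2
        linarith
      refine (hs k hk).trans ?_
      calc _ ≤ 26 * (4 * u ^ 2) / (m k * u ^ 2) := by
            gcongr
            linarith
        _ = 104 / m k := by field_simp; ring
        _ ≤ 208 * ((m k : ℝ) + 1)⁻¹ := by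
          rw [← div_eq_mul_inv, div_le_div_iff₀ (by linarith) (by linarith)]
          linarith
  have hanti : Antitone fun i : ℕ => 208 * ((i : ℝ) + 1)⁻¹ := by
    intro i j hij
    have : (i : ℝ) ≤ j := by exact_mod_cast hij
    simp only
    gcongr
  have hcard : J.card ≤ K := by simpa using Finset.card_le_card hJ
  have h1 := sum_le_of_buckets J hcard m hm1 _ hanti fun i => by positivity
  have h2 : ∑ i ∈ Finset.range K, 208 * ((i : ℝ) + 1)⁻¹ ≤ 208 * (1 + Real.log T) := by
    rw [← Finset.mul_sum]
    have h3 := sum_inv_le_log K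
    have h4 : Real.log K ≤ Real.log T := Real.log_le_log (by exact_mod_cast hK) hKT
    linarith
  have h5 : (K : ℝ) * (208 * ((K : ℝ) + 1)⁻¹) ≤ 208 := by
    rw [← div_eq_mul_inv, mul_div_assoc', div_le_iff₀ (by positivity)]
    linarith
  have hM1 : (1 : ℝ) ≤ max 1 (d : ℝ) := le_max_left _ _
  have hM2 : (d : ℝ) ≤ max 1 (d : ℝ) := le_max_right _ _
  set Mx := max 1 (d : ℝ)
  calc ∑ k ∈ J, a k ≤ ∑ k ∈ J, 208 * ((m k : ℝ) + 1)⁻¹ := Finset.sum_le_sum hφ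
    _ ≤ d * (208 * (1 + Real.log T)) + 208 := by
        refine h1.trans (add_le_add ?_ h5)
        gcongr
    _ ≤ Mx * (208 * (1 + Real.log T)) + 208 * Mx := by
        refine add_le_add ?_ (by linarith)
        exact mul_le_mul_of_nonneg_right hM2 (by linarith)
    _ = Mx * (416 + 208 * Real.log T) := by ring
    _ ≤ Mx * (820 * Real.log T) := by
        gcongr
        linarith
    _ = _ := by ring

/-- At most `6 log T` dyadic bands cover the range from `1 / T` to `T²`, and each costs `O(max 1 d *
log T)`. Differences below `1 / T` contribute at most `26 / T²` each, because `β ≥ 1`. The factor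
`26` in `hs` accounts for an almost maximising pair and for the passage from sub-sampled to full
data. -/
theorem sum_sens_le {F : Set (X → ℝ)} {D : Set X} {T β : ℝ} {d K : ℕ}
    (hd : eluderDim F D (1 / T) ≤ d) (hT : 2 ≤ T) (hK : 1 ≤ K)
    (hKT : (K : ℝ) ≤ T) (hβ : 1 ≤ β) (z : ℕ → X) (a : ℕ → ℝ) (hz : ∀ k < K, z k ∈ D)
    (ha : ∀ k < K, a k ≤ 1) (hF : ∀ f ∈ F, ∀ g ∈ F, ∀ x ∈ D, |f x - g x| ≤ T ^ 2)
    (hs : ∀ k < K, 0 < a k → ∃ f ∈ F, ∃ g ∈ F, a k ≤ 26 * (f (z k) - g (z k)) ^ 2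
      / (∑ j ∈ Finset.range k, (f (z j) - g (z j)) ^ 2 + β)) :
    ∑ k ∈ Finset.range K, a k ≤ 5000 * (max 1 (d : ℝ) * Real.log T ^ 2) := by
  classical
  have hT0 : 0 < T := by linarith
  choose! f hf g hg hfg using hs
  have hlog := half_lt_log hT
  have hM1 : (1 : ℝ) ≤ max 1 (d : ℝ) := le_max_left _ _
  set nb := ⌈Real.log (T ^ 3) / Real.log 2⌉₊ with hnb
  have hnb1 : T ^ 2 ≤ 2 ^ nb * (1 / T) := by
    have h1 : Real.log (T ^ 3) / Real.log 2 ≤ nb := Nat.le_ceil _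
    rw [div_le_iff₀ (Real.log_pos one_lt_two)] at h1
    have h2 : T ^ 3 ≤ 2 ^ nb := by
      rw [← Real.log_le_log_iff (by positivity) (by positivity), Real.log_pow 2 nb]
      exact h1
    rw [mul_one_div, le_div_iff₀ hT0]
    linarith [h2, pow_succ T 2]
  have hnb2 : (nb : ℝ) ≤ 6 * Real.log T := by
    have h1 : (nb : ℝ) < Real.log (T ^ 3) / Real.log 2 + 1 :=
      Nat.ceil_lt_add_one (div_nonneg (Real.log_nonneg (one_le_pow₀ (by linarith)))
        (Real.log_nonneg one_le_two))
    have h2 : Real.log (T ^ 3) / Real.log 2 ≤ 4.5 * Real.log T := by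
      rw [Real.log_pow, div_le_iff₀ (Real.log_pos one_lt_two)]
      have := Real.log_two_gt_d9
      push_cast
      nlinarith
    linarith
  set u : ℕ → ℝ := fun i => 2 ^ i * (1 / T) with hu
  set J : ℕ → Finset ℕ := fun i => (Finset.range K).filter fun k => 0 < a k ∧
    u i < |f k (z k) - g k (z k)| ∧ |f k (z k) - g k (z k)| ≤ 2 * u i with hJ
  have hu0 : ∀ i, 0 < u i := fun i => by positivity
  have hbin : ∀ i, ∑ k ∈ J i, a k ≤ 820 * (max 1 (d : ℝ) * Real.log T) := by
    intro i
    have hJi : ∀ k ∈ J i, k < K ∧ 0 < a k ∧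
        u i < |f k (z k) - g k (z k)| ∧ |f k (z k) - g k (z k)| ≤ 2 * u i := fun k hk => by
      have := Finset.mem_filter.1 hk
      exact ⟨Finset.mem_range.1 this.1, this.2⟩
    refine sum_bucket_sens_le hd ?_ (hu0 i) hT hK hKT (by linarith) (J i)
      (Finset.filter_subset _ _) z a f g (fun k hk => hz k (hJi k hk).1)
      (fun k hk => hf k (hJi k hk).1 (hJi k hk).2.1) (fun k hk => hg k (hJi k hk).1 (hJi k hk).2.1)
      (fun k hk => ha k (hJi k hk).1) (fun k hk => (hJi k hk).2.2.1)
      (fun k hk => (hJi k hk).2.2.2) fun k hk => hfg k (hJi k hk).1 (hJi k hk).2.1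
    exact le_mul_of_one_le_left (by positivity) (one_le_pow₀ one_le_two)
  have hpt : ∀ k ∈ Finset.range K, a k ≤ 26 / T ^ 2
      + ∑ i ∈ Finset.range nb, if k ∈ J i then a k else 0 := by
    intro k hk
    have hkK := Finset.mem_range.1 hk
    have hsum0 : 0 < a k → 0 ≤ ∑ i ∈ Finset.range nb, if k ∈ J i then a k else 0 :=
      fun h => Finset.sum_nonneg fun i _ => by split_ifs <;> linarith
    by_cases hak : 0 < a k
    swap
    · have h1 : ∑ i ∈ Finset.range nb, (if k ∈ J i then a k else 0) = 0 := by
        refine Finset.sum_eq_zero fun i _ => if_neg fun h => hak (Finset.mem_filter.1 h).2.1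
      rw [h1]
      have : 0 < 26 / T ^ 2 := by positivity
      linarith
    rcases le_or_gt |f k (z k) - g k (z k)| (1 / T) with hsm | hlg
    · have h1 := hfg k hkK hak
      have h2 : (f k (z k) - g k (z k)) ^ 2 ≤ (1 / T) ^ 2 := by
        rw [← sq_abs]; exact pow_le_pow_left₀ (abs_nonneg _) hsm 2
      have h3 : 0 ≤ ∑ j ∈ Finset.range k, (f k (z j) - g k (z j)) ^ 2 :=
        Finset.sum_nonneg fun _ _ => sq_nonneg _
      have h4 : 26 * (f k (z k) - g k (z k)) ^ 2
          / (∑ j ∈ Finset.range k, (f k (z j) - g k (z j)) ^ 2 + β) ≤ 26 * (1 / T) ^ 2 / 1 := by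
        gcongr
        linarith
      have h5 : 26 * (1 / T) ^ 2 / 1 = 26 / T ^ 2 := by field_simp
      linarith [hsum0 hak]
    · have hex : ∃ n, |f k (z k) - g k (z k)| ≤ 2 ^ n * (1 / T) :=
        ⟨nb, (hF _ (hf k hkK hak) _ (hg k hkK hak) _ (hz k hkK)).trans hnb1⟩
      set n := Nat.find hex
      have hn1 : |f k (z k) - g k (z k)| ≤ 2 ^ n * (1 / T) := Nat.find_spec hex
      have hn2 : n ≤ nb :=
        Nat.find_min' hex ((hF _ (hf k hkK hak) _ (hg k hkK hak) _ (hz k hkK)).trans hnb1)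
      have hn0 : n ≠ 0 := by
        intro h; rw [h] at hn1; simp at hn1 hlg; linarith
      have hn3 := Nat.find_min hex (m := n - 1) (by omega)
      push Not at hn3
      have hmem : k ∈ J (n - 1) := by
        refine Finset.mem_filter.2 ⟨hk, hak, hn3, ?_⟩
        refine hn1.trans (le_of_eq ?_)
        have : (2 : ℝ) ^ n = 2 * 2 ^ (n - 1) := by rw [← pow_succ']; congr 1; omega
        simp only [hu, this]; ring
      have h1 : a k ≤ ∑ i ∈ Finset.range nb, if k ∈ J i then a k else 0 := by
        have := Finset.single_le_sum (f := fun i => if k ∈ J i then a k else 0)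
          (fun i _ => by split_ifs <;> linarith) (Finset.mem_range.2 (show n - 1 < nb by omega))
        simpa [hmem] using this
      have : 0 < 26 / T ^ 2 := by positivity
      linarith
  calc ∑ k ∈ Finset.range K, a k
      ≤ ∑ k ∈ Finset.range K, (26 / T ^ 2 + ∑ i ∈ Finset.range nb, if k ∈ J i then a k else 0) :=
        Finset.sum_le_sum hpt
    _ = K * (26 / T ^ 2) + ∑ i ∈ Finset.range nb, ∑ k ∈ J i, a k := by
        rw [Finset.sum_add_distrib, Finset.sum_const, Finset.card_range, nsmul_eq_mul,
          Finset.sum_comm]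
        congr 1
        refine Finset.sum_congr rfl fun i _ => ?_
        rw [← Finset.sum_filter]
        congr 1
        ext k
        simp only [hJ, Finset.mem_filter]
        tauto
    _ ≤ 13 + nb * (820 * (max 1 (d : ℝ) * Real.log T)) := by
        refine add_le_add ?_ ?_
        · have h1 : (K : ℝ) * (26 / T ^ 2) ≤ T * (26 / T ^ 2) := by gcongr
          have h2 : T * (26 / T ^ 2) = 26 / T := by field_simp
          have h3 : 26 / T ≤ 13 := by rw [div_le_iff₀ hT0]; linarith
          linarith
        · refine (Finset.sum_le_sum fun i _ => hbin i).trans ?_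
          simp
    _ ≤ _ := by
        set Mx := max 1 (d : ℝ)
        have h1 : (nb : ℝ) * (820 * (Mx * Real.log T)) ≤ 6 * Real.log T * (820 * (Mx * Real.log T)) := by
          gcongr
        have h2 : (0.69 : ℝ) ^ 2 ≤ Real.log T ^ 2 := by gcongr
        nlinarith

end SensitivitySum

/-! ### Attaining the sensitivity up to a factor. -/

section Sensitivity

variable {X : Type*} {F : Set (X → ℝ)} {B β : ℝ} {Z : Multiset X} {z : X}

theorem sensitivity_nonneg : 0 ≤ sensitivity F B β Z z := ENNReal.toReal_nonneg

theorem sensitivity_le_one : sensitivity F B β Z z ≤ 1 := by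
  unfold sensitivity
  calc _ ≤ (1 : ℝ≥0∞).toReal := ENNReal.toReal_mono ENNReal.one_ne_top (min_le_right _ _)
    _ = 1 := by simp

theorem le_sensitivity {f g : X → ℝ} (hf : f ∈ F) (hg : g ∈ F) :
    min ((f z - g z) ^ 2 / (min (dataNorm Z (f - g) ^ 2) B + β)) 1 ≤ sensitivity F B β Z z := by
  unfold sensitivity
  set q := (f z - g z) ^ 2 / (min (dataNorm Z (f - g) ^ 2) B + β)
  rw [← ENNReal.ofReal_le_iff_le_toReal (ne_top_of_le_ne_top ENNReal.one_ne_top (min_le_right _ _))]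
  refine le_min ?_ ?_
  · refine (ENNReal.ofReal_le_ofReal (min_le_left _ _)).trans ?_
    exact le_iSup₂_of_le (f := fun f₁ (_ : f₁ ∈ F) => ⨆ f₂ ∈ F, ENNReal.ofReal ((f₁ z - f₂ z) ^ 2
      / (min (dataNorm Z (f₁ - f₂) ^ 2) B + β))) f hf
      (le_iSup₂_of_le (f := fun f₂ (_ : f₂ ∈ F) => ENNReal.ofReal ((f z - f₂ z) ^ 2
      / (min (dataNorm Z (f - f₂) ^ 2) B + β))) g hg le_rfl)
  · exact ENNReal.ofReal_le_one.2 (min_le_right _ _)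

/-- The supremum need not be attained, but half of a positive value is exceeded by some pair. -/
theorem exists_of_sensitivity_pos (h : 0 < sensitivity F B β Z z) : ∃ f ∈ F, ∃ g ∈ F,
    sensitivity F B β Z z ≤ 2 * ((f z - g z) ^ 2 / (min (dataNorm Z (f - g) ^ 2) B + β)) := by
  have h1 : ENNReal.ofReal (sensitivity F B β Z z / 2) < ⨆ f₁ ∈ F, ⨆ f₂ ∈ F,
      ENNReal.ofReal ((f₁ z - f₂ z) ^ 2 / (min (dataNorm Z (f₁ - f₂) ^ 2) B + β)) := by
    have h2 : ENNReal.ofReal (sensitivity F B β Z z / 2)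
        < ENNReal.ofReal (sensitivity F B β Z z) :=
      (ENNReal.ofReal_lt_ofReal_iff h).2 (by linarith)
    refine h2.trans_le ?_
    unfold sensitivity
    rw [ENNReal.ofReal_toReal (ne_top_of_le_ne_top ENNReal.one_ne_top (min_le_right _ _))]
    exact min_le_left _ _
  simp only [lt_iSup_iff] at h1
  obtain ⟨f, hf, g, hg, h2⟩ := h1
  refine ⟨f, hf, g, hg, ?_⟩
  have := (ENNReal.ofReal_lt_ofReal_iff_of_nonneg (by linarith)).1 h2
  linarith

end Sensitivity

/-! ### Sampling probabilities and increments of the data norm. -/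

section Copies

variable {S A : Type*} [MeasurableSpace S] [MeasurableSpace A] (I : Input S A) {h : ℕ}
  {Z : Multiset (Pt S A)} {z : Pt S A}

/-- Rounding down a number that is at least `1` loses at most a factor `2`. For sensitivity zero,
division by zero makes both `copies` and `prob` vanish, as intended. -/
theorem prob_le (hlam : 0 ≤ I.lam) :
    I.prob h Z z ≤ 2 * (I.lam * sensitivity (I.F h) I.trunc I.β Z z) := by
  unfold Input.prob Input.copies
  set s := sensitivity (I.F h) I.trunc I.β Z z
  have hs : 0 ≤ s := sensitivity_nonneg
  set x := min 1 (I.lam * s) with hx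
  have hx0 : 0 ≤ x := le_min zero_le_one (by positivity)
  have hx1 : x ≤ 1 := min_le_left _ _
  have hx2 : x ≤ I.lam * s := min_le_right _ _
  rcases hx0.eq_or_lt with h0 | hpos
  · rw [← h0]; simp; positivity
  · have h1 : 1 ≤ 1 / x := by rw [le_div_iff₀ hpos]; linarith
    have h2 : 1 ≤ ⌊1 / x⌋₊ := Nat.le_floor (by simpa using h1)
    have h3 : 1 / x < ⌊1 / x⌋₊ + 1 := Nat.lt_floor_add_one _
    have h2' : (1 : ℝ) ≤ ⌊1 / x⌋₊ := by exact_mod_cast h2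
    have h4 : 1 / (⌊1 / x⌋₊ : ℝ) ≤ 2 * x := by
      rw [div_le_iff₀ (by linarith)]
      rw [div_lt_iff₀ hpos] at h3
      nlinarith
    linarith

/-- The increment of the squared data norm caused by sampling `z` is at most a fraction `1 / lam` of
the current value, unless `z` is added with probability one or has no effect. -/
theorem copies_mul_sq_le (hlam : 1 ≤ I.lam) (hβ : 0 < I.β) (hB : 0 ≤ I.trunc)
    {f g : Pt S A → ℝ} (hf : f ∈ I.F h) (hg : g ∈ I.F h) :
    f z - g z = 0 ∨ (1 ≤ I.copies h Z z ∧ (I.copies h Z z = 1 ∨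
      (I.copies h Z z : ℝ) * (f z - g z) ^ 2 ≤ (dataNorm Z (f - g) ^ 2 + I.β) / I.lam)) := by
  have hle := le_sensitivity (B := I.trunc) (β := I.β) (Z := Z) (z := z) hf hg
  unfold Input.copies
  set s := sensitivity (I.F h) I.trunc I.β Z z
  have hs : 0 ≤ s := sensitivity_nonneg
  set x := min 1 (I.lam * s) with hx
  have hx0 : 0 ≤ x := le_min zero_le_one (by positivity)
  have hx1 : x ≤ 1 := min_le_left _ _
  have hden : 0 < min (dataNorm Z (f - g) ^ 2) I.trunc + I.β :=
    add_pos_of_nonneg_of_pos (le_min (sq_nonneg _) hB) hβ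
  rcases eq_or_ne (f z - g z) 0 with h0 | hne
  · exact Or.inl h0
  right
  have hsq : 0 < (f z - g z) ^ 2 := by positivity
  have hspos : 0 < s := lt_of_lt_of_le (lt_min (div_pos hsq hden) one_pos) hle
  have hxpos : 0 < x := lt_min one_pos (by positivity)
  have h1 : 1 ≤ 1 / x := by rw [le_div_iff₀ hxpos]; linarith
  refine ⟨Nat.le_floor (by simpa using h1), ?_⟩
  by_cases hc : ⌊1 / x⌋₊ = 1
  · exact Or.inl hc
  right
  have h2 : 1 ≤ ⌊1 / x⌋₊ := Nat.le_floor (by simpa using h1)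
  have h3 : ((⌊1 / x⌋₊ : ℕ) : ℝ) ≤ 1 / x := Nat.floor_le (by positivity)
  have h4 : (2 : ℝ) ≤ ⌊1 / x⌋₊ := by exact_mod_cast (show 2 ≤ ⌊1 / x⌋₊ by omega)
  -- Two or more copies mean that neither cap is active: `x` is exactly `lam * s`, and `s ≤ 1 / 2`
  -- rules out the cap `1` in the sensitivity.
  have h5 : x ≤ 1 / 2 := by
    have := h4.trans h3
    rw [le_div_iff₀ hxpos] at this
    linarith
  have hxe : x = I.lam * s := by
    rcases min_choice 1 (I.lam * s) with h | h
    · rw [← hx] at h; linarith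
    · exact h
  have hs1 : s ≤ 1 / 2 := by nlinarith
  have h6 : (f z - g z) ^ 2 / (min (dataNorm Z (f - g) ^ 2) I.trunc + I.β) ≤ s := by
    rcases min_choice ((f z - g z) ^ 2 / (min (dataNorm Z (f - g) ^ 2) I.trunc + I.β)) 1 with h | h
    · rw [h] at hle; exact hle
    · rw [h] at hle; linarith
  rw [div_le_iff₀ hden] at h6
  have h7 : (f z - g z) ^ 2 ≤ s * (dataNorm Z (f - g) ^ 2 + I.β) :=
    h6.trans (by gcongr; exact min_le_left _ _)
  calc (⌊1 / x⌋₊ : ℝ) * (f z - g z) ^ 2 ≤ 1 / x * (s * (dataNorm Z (f - g) ^ 2 + I.β)) := by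
        gcongr
    _ = _ := by rw [hxe]; field_simp

end Copies

/-! ### Datasets, recomputations and switches. -/

section Datasets

variable {S A Ω : Type*} [MeasurableSpace S] [MeasurableSpace A]
  (R : Interaction S A Ω) (I : Input S A)

theorem lastUpdate_le (k : ℕ) (ω : Ω) : R.lastUpdate I k ω ≤ k := by
  induction k with
  | zero => exact le_rfl
  | succ k ih =>
    unfold Interaction.lastUpdate
    split_ifs
    · exact le_rfl
    · omega

theorem lastUpdate_idem (k : ℕ) (ω : Ω) :
    R.lastUpdate I (R.lastUpdate I k ω) ω = R.lastUpdate I k ω := by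
  induction k with
  | zero => rfl
  | succ k ih =>
    by_cases h : ∃ h < I.M.H, R.dataset I (k + 1) h ω ≠ R.dataset I (R.lastUpdate I k ω) h ω
    · have : R.lastUpdate I (k + 1) ω = k + 1 := by
        rw [Interaction.lastUpdate, if_pos h]
      rw [this, this]
    · have : R.lastUpdate I (k + 1) ω = R.lastUpdate I k ω := by
        rw [Interaction.lastUpdate, if_neg h]
      rw [this, ih]

/-- Recomputation is triggered precisely by a change of a dataset, so a policy that is kept was
computed from the current datasets. This makes the bonuses of an episode those of its last
recomputation. -/
theorem dataset_lastUpdate (k : ℕ) (ω : Ω) {h : ℕ} (hh : h < I.M.H) :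
    R.dataset I (R.lastUpdate I k ω) h ω = R.dataset I k h ω := by
  cases k with
  | zero => rfl
  | succ k =>
    by_cases hu : ∃ h < I.M.H, R.dataset I (k + 1) h ω ≠ R.dataset I (R.lastUpdate I k ω) h ω
    · rw [Interaction.lastUpdate, if_pos hu]
    · rw [Interaction.lastUpdate, if_neg hu]
      push Not at hu
      exact (hu h hh).symm

theorem lastUpdate_succ_of_no_coin {k : ℕ} {ω : Ω} (h : ∀ h < I.M.H, ω ∉ R.coin k h) :
    R.lastUpdate I (k + 1) ω = R.lastUpdate I k ω := by
  rw [Interaction.lastUpdate, if_neg]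
  push Not
  intro h' hh'
  rw [dataset_lastUpdate R I k ω hh', Interaction.dataset, if_neg (h h' hh'), add_zero]

/-- The number of copies that would be added when `z_h^k` is sampled. -/
noncomputable def numCopies (k h : ℕ) (ω : Ω) : ℕ := I.copies h (R.dataset I k h ω) (R.pt k h ω)

theorem dataNorm_dataset_sq (n h : ℕ) (ω : Ω) (f : Pt S A → ℝ) :
    dataNorm (R.dataset I n h ω) f ^ 2 = ∑ j ∈ Finset.range n,
      (R.coin j h).indicator (fun _ => (1 : ℝ)) ω * (numCopies R I j h ω * f (R.pt j h ω) ^ 2) := by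
  classical
  rw [dataNorm_sq]
  induction n with
  | zero => simp [Interaction.dataset]
  | succ n ih =>
    rw [Finset.sum_range_succ, ← ih, Interaction.dataset, Multiset.map_add, Multiset.sum_add]
    congr 1
    by_cases h : ω ∈ R.coin n h
    · simp [h, numCopies]
    · simp [h]

variable [mΩ : MeasurableSpace Ω] {μ : Measure Ω} {filt : Filtration (ℕ ×ₗ ℕ) mΩ} {R I}

/-- Without a successful coin no dataset changes, hence `lastUpdate` and the policy stay the same;
every switch is thus charged to a coin of its own episode. -/
theorem switches_le (hR : R.IsExecution I μ filt) (ω : Ω) :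
    (R.switches I ω : ℝ) ≤ ∑ k ∈ Finset.range I.K, ∑ h ∈ Finset.range I.M.H,
      (R.coin k h).indicator (fun _ => (1 : ℝ)) ω := by
  classical
  unfold Interaction.switches
  rw [Finset.card_filter]
  push_cast
  have hnn : ∀ k, 0 ≤ ∑ h ∈ Finset.range I.M.H, (R.coin k h).indicator (fun _ => (1 : ℝ)) ω :=
    fun k => Finset.sum_nonneg fun h _ => Set.indicator_nonneg (fun _ _ => zero_le_one) ω
  calc _ ≤ ∑ k ∈ Finset.range (I.K - 1), ∑ h ∈ Finset.range I.M.H,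
        (R.coin k h).indicator (fun _ => (1 : ℝ)) ω := by
        refine Finset.sum_le_sum fun k hk => ?_
        have hk' := Finset.mem_range.1 hk
        split_ifs with hsw
        · by_contra hcon
          push Not at hcon
          have hno : ∀ h < I.M.H, ω ∉ R.coin k h := by
            intro h hh hmem
            have h1 := Finset.single_le_sum
              (f := fun h => (R.coin k h).indicator (fun _ => (1 : ℝ)) ω)
              (fun h _ => Set.indicator_nonneg (fun _ _ => zero_le_one) ω)
              (Finset.mem_range.2 hh)
            simp only [Set.indicator_of_mem hmem] at h1
            linarith
          obtain ⟨h, hh, hne⟩ := hsw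
          apply hne
          rw [hR.policy_keep k (by omega) ω h hh, hR.policy_keep (k + 1) (by omega) ω h hh,
            lastUpdate_succ_of_no_coin R I hno]
        · exact hnn k
    _ ≤ _ := Finset.sum_le_sum_of_subset_of_nonneg
        (Finset.range_mono (Nat.sub_le _ _)) fun k _ _ => hnn k

end Datasets

/-! ### Truncated value estimates. -/

section Truncation

variable {S A Ω : Type*} [MeasurableSpace S] [MeasurableSpace A]
  {R : Interaction S A Ω} {I : Input S A}

/-- The value estimates, truncated to `[0, H]`. -/
noncomputable def cval (R : Interaction S A Ω) (I : Input S A) (k h : ℕ) (ω : Ω) (s : S) : ℝ :=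
  max 0 (min (I.M.H : ℝ) (R.val k h ω s))

/-- The range of `R.val` is known only on the good event, whereas the concentration inequalities
need bounds for every outcome. They are stated for truncated values, and `InRange.cval_eq` removes
the truncation afterwards. -/
theorem cval_mem_Icc (k h : ℕ) (ω : Ω) (s : S) : cval R I k h ω s ∈ Set.Icc (0 : ℝ) I.M.H :=
  ⟨le_max_left _ _, max_le (Nat.cast_nonneg _) (min_le_left _ _)⟩

theorem abs_cval_le (k h : ℕ) (ω : Ω) (s : S) : |cval R I k h ω s| ≤ I.M.H := by
  have := cval_mem_Icc (R := R) (I := I) k h ω s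
  rw [abs_of_nonneg this.1]; exact this.2

/-- The data points with truncated value estimates. -/
noncomputable def cpt (R : Interaction S A Ω) (I : Input S A) (k h : ℕ) (ω : Ω) : Pt S A :=
  (R.state k h ω, R.act k h ω, cval R I k (h + 1) ω)

end Truncation

/-! ### Measurability along an execution and transition noise. -/

section ExecutionSteps

variable {S A Ω : Type*} [MeasurableSpace S] [MeasurableSpace A] [mΩ : MeasurableSpace Ω]
  {R : Interaction S A Ω} {I : Input S A} {μ : Measure Ω} {filt : Filtration (ℕ ×ₗ ℕ) mΩ}

/-- Two σ-algebras are needed: policies and value estimates are fixed at the start of the episode,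
states are revealed later. -/
theorem measurable_comp_graph {Ω S β : Type*} [MeasurableSpace S] [MeasurableSpace β]
    {m₁ m₂ : MeasurableSpace Ω} (hm : m₁ ≤ m₂)
    {f : Ω × S → β} (hf : Measurable[m₁.prod inferInstance] f) {s : Ω → S}
    (hs : Measurable[m₂] s) : Measurable[m₂] fun ω => f (ω, s ω) :=
  @Measurable.comp Ω (Ω × S) β m₂ (m₁.prod inferInstance) _ f (fun ω => (ω, s ω)) hf
    (Measurable.prodMk (measurable_id'' hm) hs)

theorem measurable_prod_mono {Ω S β : Type*} [MeasurableSpace S] [MeasurableSpace β]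
    {m₁ m₂ : MeasurableSpace Ω} (hm : m₁ ≤ m₂)
    {f : Ω × S → β} (hf : Measurable[m₁.prod inferInstance] f) :
    Measurable[m₂.prod inferInstance] f :=
  hf.mono (sup_le_sup_right (MeasurableSpace.comap_mono hm) _) le_rfl

theorem measurable_state (hR : R.IsExecution I μ filt) {k h h' : ℕ} (hk : k < I.K)
    (hh : h ≤ I.M.H) (hle : h ≤ h') : Measurable[filt (toLex (k, h'))] (R.state k h) :=
  (hR.state_measurable k hk h hh).mono (filt.mono (lex_le_of_le hle)) le_rfl

theorem measurable_act (hR : R.IsExecution I μ filt) {k h h' : ℕ} (hk : k < I.K)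
    (hh : h < I.M.H) (hle : h ≤ h') : Measurable[filt (toLex (k, h'))] (R.act k h) :=
  measurable_comp_graph (filt.mono (lex_le_of_le (Nat.zero_le h')))
    (hR.policy_measurable k hk h hh) (measurable_state hR hk hh.le hle)

theorem measurable_policy (hR : R.IsExecution I μ filt) {k : ℕ} (hk : k < I.K) (ω : Ω) :
    ∀ h < I.M.H, Measurable (R.policy k h ω) := fun h hh =>
  ((hR.policy_measurable k hk h hh).mono
    (sup_le_sup_right (MeasurableSpace.comap_mono (filt.le _)) _) le_rfl).comp
    (measurable_prodMk_left (x := ω))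

theorem measurable_val (hR : R.IsExecution I μ filt) {k h : ℕ} (hk : k < I.K) (hh : h ≤ I.M.H)
    (ω : Ω) : Measurable (R.val k h ω) :=
  ((hR.val_measurable k hk h hh).mono
    (sup_le_sup_right (MeasurableSpace.comap_mono (filt.le _)) _) le_rfl).comp
    (measurable_prodMk_left (x := ω))

theorem measurable_cval (hR : R.IsExecution I μ filt) {k h h' : ℕ} (hk : k < I.K)
    (hh : h ≤ I.M.H) :
    Measurable[(filt (toLex (k, h'))).prod inferInstance] fun q : Ω × S => cval R I k h q.1 q.2 :=
  measurable_const.max (measurable_const.min (measurable_prod_mono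
    (filt.mono (lex_le_of_le (Nat.zero_le h'))) (hR.val_measurable k hk h hh)))

theorem measurable_modelFun_cpt (hR : R.IsExecution I μ filt) {k h h' : ℕ} (hk : k < I.K)
    (hh : h < I.M.H) (hle : h ≤ h') (P : SignedKernel S A) :
    Measurable[filt (toLex (k, h'))] fun ω => modelFun P (cpt R I k h ω) :=
  @measurable_modelFun S A _ _ Ω (filt (toLex (k, h'))) P (R.state k h) (R.act k h)
    (measurable_state hR hk hh.le hle) (measurable_act hR hk hh hle) (cval R I k (h + 1))
    (measurable_cval hR hk hh) I.M.H fun ω s => abs_cval_le k (h + 1) ω s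

/-- Given the past, the next state is drawn from `M.P`, so only an integral over that kernel with
`ω` frozen has to be bounded. -/
theorem isStep_transition [IsProbabilityMeasure μ] (hR : R.IsExecution I μ filt) {k h : ℕ}
    (hk : k < I.K) (hh : h < I.M.H) {ψ : Ω × S → ℝ}
    (hψ : Measurable[(filt (toLex (k, h))).prod inferInstance] ψ)
    (hint : ∀ ω, ∫⁻ s, ENNReal.ofReal (Real.exp (ψ (ω, s)))
      ∂(I.M.P h (R.state k h ω, R.act k h ω)) ≤ 1) :
    IsStep μ (filt (toLex (k, h))) fun ω => ψ (ω, R.state k (h + 1) ω) := by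
  intro G hG
  have hle := filt.le (toLex (k, h))
  have hs := measurable_state hR hk hh.le (le_refl h)
  have ha := measurable_act hR hk hh (le_refl h)
  have hs' : Measurable (R.state k (h + 1)) :=
    (hR.state_measurable k hk (h + 1) hh).mono (filt.le _) le_rfl
  have key := lintegral_of_condExp_eq_kernel (φ := fun q => G q.1 * ENNReal.ofReal (Real.exp (ψ q)))
    hle μ hs' (@stepKernel S A _ _ I.M h Ω (filt (toLex (k, h))) _ _ hs ha)
    inferInstance (fun B hB => hR.state_law k hk h hh B hB) ?_
  · rw [key]
    refine lintegral_mono fun ω => ?_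
    have h1 : Measurable fun s => ψ (ω, s) :=
      @Measurable.comp S (Ω × S) ℝ _ ((filt (toLex (k, h))).prod inferInstance) _ ψ _ hψ
        (@measurable_prodMk_left Ω S (filt (toLex (k, h))) _ ω)
    change ∫⁻ s, G ω * ENNReal.ofReal (Real.exp (ψ (ω, s)))
      ∂(I.M.P h (R.state k h ω, R.act k h ω)) ≤ G ω
    have h2 : Measurable fun s => ENNReal.ofReal (Real.exp (ψ (ω, s))) :=
      (Real.measurable_exp.comp h1).ennreal_ofReal
    rw [lintegral_const_mul _ h2]
    calc _ ≤ G ω * 1 := by gcongr; exact hint ω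
      _ = G ω := mul_one _
  · refine @Measurable.mul _ _ _ _ _ (_) _ _ ?_ ?_
    · exact @Measurable.comp _ _ _ (_) (filt (toLex (k, h))) _ _ _ hG (@measurable_fst _ _ (_) _)
    · exact ENNReal.measurable_ofReal.comp (Real.measurable_exp.comp hψ)

theorem measurable_at_next_state (hR : R.IsExecution I μ filt) {k h : ℕ}
    (hk : k < I.K) (hh : h < I.M.H) {ψ : Ω × S → ℝ}
    (hψ : Measurable[(filt (toLex (k, h))).prod inferInstance] ψ) :
    Measurable[filt (toLex (k, h + 1))] fun ω => ψ (ω, R.state k (h + 1) ω) :=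
  measurable_comp_graph (filt.mono (lex_le_of_le (Nat.le_succ h))) hψ
    (hR.state_measurable k hk (h + 1) hh)

/-- Hoeffding's lemma, with its bound moved into the exponent as a compensator. -/
theorem lintegral_exp_centered_le_one {X : Type*} [MeasurableSpace X] (ν : Measure X)
    [IsProbabilityMeasure ν] {φ : X → ℝ} (hφ : Measurable φ) {c : ℝ}
    (hb : ∀ x, φ x ∈ Set.Icc 0 c) (t : ℝ) :
    ∫⁻ x, ENNReal.ofReal (Real.exp (t * (φ x - ∫ y, φ y ∂ν) - t ^ 2 * c ^ 2 / 8)) ∂ν ≤ 1 := by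
  have hsub := hasSubgaussianMGF_of_mem_Icc (μ := ν) hφ.aemeasurable
    (Filter.Eventually.of_forall hb)
  have h1 := hsub.mgf_le t
  have h2 := hsub.integrable_exp_mul t
  have h3 : ∀ x, Real.exp (t * (φ x - ∫ y, φ y ∂ν) - t ^ 2 * c ^ 2 / 8)
      = Real.exp (t * (φ x - ∫ y, φ y ∂ν)) * Real.exp (-(t ^ 2 * c ^ 2 / 8)) := fun x => by
    rw [← Real.exp_add]; ring_nf
  simp_rw [h3]
  rw [← ofReal_integral_eq_lintegral_ofReal (h2.mul_const _)
    (Filter.Eventually.of_forall fun x => by positivity), integral_mul_const]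
  rw [ENNReal.ofReal_le_one]
  unfold mgf at h1
  calc _ ≤ Real.exp (((‖c - 0‖₊ / 2) ^ 2 : NNReal) * t ^ 2 / 2)
        * Real.exp (-(t ^ 2 * c ^ 2 / 8)) := by gcongr
    _ = 1 := by
      rw [← Real.exp_add, Real.exp_eq_one_iff]
      push_cast
      rw [sub_zero, Real.norm_eq_abs, div_pow, sq_abs]
      ring

/-- Concentration of weighted sums of the transition noise. -/
theorem measure_noise_ge_le [IsProbabilityMeasure μ] (hR : R.IsExecution I μ filt) {n : ℕ}
    (hn : n ≤ I.K) {c : ℝ} (w : ℕ → ℕ → Ω → ℝ)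
    (hw : ∀ k < I.K, ∀ h < I.M.H, Measurable[filt (toLex (k, h))] (w k h))
    (U : ℕ → ℕ → Ω × S → ℝ)
    (hU : ∀ k < I.K, ∀ h < I.M.H, Measurable[(filt (toLex (k, h))).prod inferInstance] (U k h))
    (hUc : ∀ k h q, U k h q ∈ Set.Icc 0 c) (L : ℝ) :
    μ {ω | L ≤ ∑ k ∈ Finset.range n, ∑ h ∈ Finset.range I.M.H,
      (w k h ω * (U k h (ω, R.state k (h + 1) ω)
        - ∫ s, U k h (ω, s) ∂(I.M.P h (R.state k h ω, R.act k h ω)))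
        - w k h ω ^ 2 * c ^ 2 / 8)} ≤ ENNReal.ofReal (Real.exp (-L)) := by
  have hψ : ∀ k < I.K, ∀ h < I.M.H, Measurable[(filt (toLex (k, h))).prod inferInstance]
      fun q : Ω × S => w k h q.1 * (U k h q
        - ∫ s, U k h (q.1, s) ∂(I.M.P h (R.state k h q.1, R.act k h q.1)))
        - w k h q.1 ^ 2 * c ^ 2 / 8 := by
    intro k hk h hh
    have hs := measurable_state hR hk hh.le (le_refl h)
    have ha := measurable_act hR hk hh (le_refl h)
    have h1 : Measurable[filt (toLex (k, h))] fun ω =>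
        ∫ s, U k h (ω, s) ∂(I.M.P h (R.state k h ω, R.act k h ω)) :=
      @measurable_integral_kernel Ω S (filt (toLex (k, h))) _
        (@stepKernel S A _ _ I.M h Ω (filt (toLex (k, h))) _ _ hs ha) inferInstance
        (fun ω s => U k h (ω, s)) (hU k hk h hh)
    have hfst := @measurable_fst Ω S (filt (toLex (k, h))) inferInstance
    have hw' := (hw k hk h hh).comp hfst
    have h1' := h1.comp hfst
    exact (hw'.mul ((hU k hk h hh).sub h1')).sub (((hw'.pow_const 2).mul_const _).div_const _)
  refine measure_sum_ge_le filt n I.M.H 0 _ (fun k hk h hh => ?_) (fun k hk h hh => ?_) L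
  · rw [Nat.zero_add]
    exact measurable_at_next_state hR (by omega) hh (hψ k (by omega) h hh)
  · rw [Nat.zero_add]
    refine isStep_transition hR (by omega) hh (hψ k (by omega) h hh) fun ω => ?_
    have h1 : Measurable fun s => U k h (ω, s) :=
      @Measurable.comp S (Ω × S) ℝ _ ((filt (toLex (k, h))).prod inferInstance) _ (U k h) _
        (hU k (by omega) h hh) (@measurable_prodMk_left Ω S (filt (toLex (k, h))) _ ω)
    exact lintegral_exp_centered_le_one _ h1 (fun s => hUc k h _) (w k h ω)

end ExecutionSteps

/-! ### The sampling coins. -/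

section Coins

variable {S A Ω : Type*} [MeasurableSpace S] [MeasurableSpace A] [mΩ : MeasurableSpace Ω]
  {R : Interaction S A Ω} {I : Input S A} {μ : Measure Ω} {filt : Filtration (ℕ ×ₗ ℕ) mΩ}

/-- The conditional probability that `z_h^k` is sampled. -/
noncomputable def coinProb (R : Interaction S A Ω) (I : Input S A) (μ : Measure Ω)
    (filt : Filtration (ℕ ×ₗ ℕ) mΩ) (k h : ℕ) : Ω → ℝ :=
  μ[(R.coin k h).indicator (fun _ => (1 : ℝ)) | filt (toLex (k, I.M.H + h))]

theorem measurable_coinProb (k h : ℕ) :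
    Measurable[filt (toLex (k, I.M.H + h))] (coinProb R I μ filt k h) :=
  stronglyMeasurable_condExp.measurable

theorem measurableSet_coin (hR : R.IsExecution I μ filt) {k h : ℕ} (hk : k < I.K)
    (hh : h < I.M.H) : MeasurableSet (R.coin k h) :=
  filt.le _ _ (hR.coin_measurable k hk h hh)

/-- `I.prob` contains a supremum over a possibly uncountable class, so its measurability is not at
hand. The conditional expectation is measurable by construction, and its inverse is almost surely
the number of copies. -/
theorem ae_coinProb_inv (hR : R.IsExecution I μ filt) {k h : ℕ} (hk : k < I.K) (hh : h < I.M.H) :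
    ∀ᵐ ω ∂μ, (coinProb R I μ filt k h ω)⁻¹ = numCopies R I k h ω := by
  filter_upwards [hR.coin_law k hk h hh] with ω hω
  have : coinProb R I μ filt k h ω = I.prob h (R.dataset I k h ω) (R.pt k h ω) := hω
  rw [this, Input.prob, one_div, inv_inv]
  rfl

theorem ae_coinProb_eq (hR : R.IsExecution I μ filt) {k h : ℕ} (hk : k < I.K) (hh : h < I.M.H) :
    ∀ᵐ ω ∂μ, coinProb R I μ filt k h ω = I.prob h (R.dataset I k h ω) (R.pt k h ω) :=
  hR.coin_law k hk h hh

theorem measure_coin_sum_ge_le [IsProbabilityMeasure μ] (hR : R.IsExecution I μ filt)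
    (u v : ℕ → ℕ → Ω → ℝ)
    (hu : ∀ k < I.K, ∀ h < I.M.H, Measurable[filt (toLex (k, I.M.H + h))] (u k h))
    (hv : ∀ k < I.K, ∀ h < I.M.H, Measurable[filt (toLex (k, I.M.H + h))] (v k h))
    (huv : ∀ k h ω, 0 ≤ coinProb R I μ filt k h ω → coinProb R I μ filt k h ω ≤ 1 →
      coinProb R I μ filt k h ω * Real.exp (u k h ω + v k h ω)
        + (1 - coinProb R I μ filt k h ω) * Real.exp (v k h ω) ≤ 1) {n : ℕ} (hn : n ≤ I.K) (L : ℝ) :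
    μ {ω | L ≤ ∑ k ∈ Finset.range n, ∑ h ∈ Finset.range I.M.H,
      ((R.coin k h).indicator (fun _ => (1 : ℝ)) ω * u k h ω + v k h ω)}
      ≤ ENNReal.ofReal (Real.exp (-L)) := by
  refine measure_sum_ge_le filt n I.M.H I.M.H _ (fun k hk h hh => ?_) (fun k hk h hh => ?_) L
  · have hle : filt (toLex (k, I.M.H + h)) ≤ filt (toLex (k, I.M.H + h + 1)) :=
      filt.mono (lex_le_of_le (Nat.le_succ _))
    have h1 := hR.coin_measurable k (by omega) h hh
    exact ((measurable_const.indicator h1).mul ((hu k (by omega) h hh).mono hle le_rfl)).add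
      ((hv k (by omega) h hh).mono hle le_rfl)
  · exact isStep_of_condExp_indicator (filt.le _) μ (measurableSet_coin hR (by omega) hh)
      (measurable_coinProb k h) (Filter.EventuallyEq.refl _ _) (hu k (by omega) h hh)
      (hv k (by omega) h hh) (Filter.Eventually.of_forall fun ω => huv k h ω)

/-- The number of sampled points is controlled by the sum of the sampling probabilities. -/
theorem measure_coin_count_ge_le [IsProbabilityMeasure μ] (hR : R.IsExecution I μ filt) (L : ℝ) :
    μ {ω | L ≤ ∑ k ∈ Finset.range I.K, ∑ h ∈ Finset.range I.M.H,
      ((R.coin k h).indicator (fun _ => (1 : ℝ)) ω * 1 + -(2 * coinProb R I μ filt k h ω))}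
      ≤ ENNReal.ofReal (Real.exp (-L)) := by
  refine measure_coin_sum_ge_le hR (fun _ _ _ => 1) (fun k h ω => -(2 * coinProb R I μ filt k h ω))
    (fun _ _ _ _ => measurable_const)
    (fun k _ h _ => ((measurable_coinProb k h).const_mul 2).neg) (fun k h ω h0 h1 => ?_) le_rfl L
  set p := coinProb R I μ filt k h ω
  -- From `e < 3`, the factor `p e + (1 - p)` is at most `1 + 2 p`, hence at most `exp (2 p)`: this
  -- is why the compensator is twice the probability.
  have e1 : Real.exp 1 < 3 := Real.exp_one_lt_three
  have e2 : 2 * p + 1 ≤ Real.exp (2 * p) := Real.add_one_le_exp _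
  have e3 : p * Real.exp (1 + -(2 * p)) + (1 - p) * Real.exp (-(2 * p))
      = (p * Real.exp 1 + (1 - p)) * Real.exp (-(2 * p)) := by
    rw [Real.exp_add]; ring
  rw [e3, Real.exp_neg, ← div_eq_mul_inv, div_le_one (Real.exp_pos _)]
  nlinarith

theorem measure_coin_sum_single_ge_le [IsProbabilityMeasure μ] (hR : R.IsExecution I μ filt)
    {h₀ : ℕ} (hh₀ : h₀ < I.M.H) (u v : ℕ → Ω → ℝ)
    (hu : ∀ k < I.K, Measurable[filt (toLex (k, I.M.H + h₀))] (u k))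
    (hv : ∀ k < I.K, Measurable[filt (toLex (k, I.M.H + h₀))] (v k))
    (huv : ∀ k ω, 0 ≤ coinProb R I μ filt k h₀ ω → coinProb R I μ filt k h₀ ω ≤ 1 →
      coinProb R I μ filt k h₀ ω * Real.exp (u k ω + v k ω)
        + (1 - coinProb R I μ filt k h₀ ω) * Real.exp (v k ω) ≤ 1) {n : ℕ} (hn : n ≤ I.K) (L : ℝ) :
    μ {ω | L ≤ ∑ k ∈ Finset.range n,
      ((R.coin k h₀).indicator (fun _ => (1 : ℝ)) ω * u k ω + v k ω)}
      ≤ ENNReal.ofReal (Real.exp (-L)) := by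
  have h1 := measure_coin_sum_ge_le hR (fun k h ω => if h = h₀ then u k ω else 0)
    (fun k h ω => if h = h₀ then v k ω else 0) (fun k hk h hh => ?_) (fun k hk h hh => ?_)
    (fun k h ω h0 h1 => ?_) hn L
  · convert h1 using 5 with ω
    refine Finset.sum_congr rfl fun k _ => ?_
    rw [Finset.sum_eq_single_of_mem h₀ (Finset.mem_range.2 hh₀) fun h _ hne => by simp [hne]]
    simp
  · by_cases he : h = h₀
    · subst he; simpa using hu k hk
    · simp only [he, if_false]; exact measurable_const
  · by_cases he : h = h₀
    · subst he; simpa using hv k hk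
    · simp only [he, if_false]; exact measurable_const
  · by_cases he : h = h₀
    · subst he; simpa using huv k ω h0 h1
    · simp [he]

/-- A point is added in `1 / p` copies with probability `p`; the inequality is strict only where `p`
vanishes. -/
theorem lintegral_coin_mul_copies_le [IsProbabilityMeasure μ] (hR : R.IsExecution I μ filt)
    {k h : ℕ} (hk : k < I.K) (hh : h < I.M.H) :
    ∫⁻ ω, ENNReal.ofReal ((R.coin k h).indicator (fun _ => (1 : ℝ)) ω * numCopies R I k h ω) ∂μ
      ≤ 1 := by
  have hD := measurableSet_coin hR hk hh
  have hp := measurable_coinProb (R := R) (I := I) (μ := μ) (filt := filt) k h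
  have h1 : ∀ᵐ ω ∂μ, ENNReal.ofReal ((R.coin k h).indicator (fun _ => (1 : ℝ)) ω
      * numCopies R I k h ω)
      = (R.coin k h).indicator (fun ω => ENNReal.ofReal (coinProb R I μ filt k h ω)⁻¹) ω := by
    filter_upwards [ae_coinProb_inv hR hk hh] with ω hω
    by_cases hc : ω ∈ R.coin k h
    · simp [hc, hω]
    · simp [hc]
  have hm : Measurable[filt (toLex (k, I.M.H + h))]
      fun ω => ENNReal.ofReal (coinProb R I μ filt k h ω)⁻¹ := ENNReal.measurable_ofReal.comp hp.inv
  rw [lintegral_congr_ae h1, lintegral_indicator hD,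
    setLIntegral_of_condExp_indicator (filt.le _) μ hD hp (Filter.EventuallyEq.refl _ _) hm]
  calc _ ≤ ∫⁻ _, 1 ∂μ := by
        refine lintegral_mono fun ω => ?_
        rcases le_or_gt (coinProb R I μ filt k h ω) 0 with h0 | hpos
        · simp [ENNReal.ofReal_of_nonpos h0]
        · simp only
          rw [← ENNReal.ofReal_mul (by positivity), inv_mul_cancel₀ hpos.ne', ENNReal.ofReal_one]
    _ = 1 := by simp

/-- Plain Markov suffices: the total number of copies only multiplies the discretisation error of a
cover, whose scale can afford a factor `T / δ`. -/
theorem measure_copies_ge_le [IsProbabilityMeasure μ] (hR : R.IsExecution I μ filt) {a : ℝ}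
    (ha : 0 < a) :
    μ {ω | a ≤ ∑ k ∈ Finset.range I.K, ∑ h ∈ Finset.range I.M.H,
      (R.coin k h).indicator (fun _ => (1 : ℝ)) ω * numCopies R I k h ω}
      ≤ ENNReal.ofReal ((I.K * I.M.H : ℝ) / a) := by
  have hterm : ∀ k h ω, 0 ≤ (R.coin k h).indicator (fun _ => (1 : ℝ)) ω * numCopies R I k h ω :=
    fun k h ω => mul_nonneg (Set.indicator_nonneg (fun _ _ => zero_le_one) ω) (Nat.cast_nonneg _)
  have hae : ∀ k < I.K, ∀ h < I.M.H, AEMeasurable (fun ω => ENNReal.ofReal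
      ((R.coin k h).indicator (fun _ => (1 : ℝ)) ω * numCopies R I k h ω)) μ := by
    intro k hk h hh
    have hp := (measurable_coinProb (R := R) (I := I) (μ := μ) (filt := filt) k h).mono
      (filt.le _) le_rfl
    refine AEMeasurable.ennreal_ofReal (AEMeasurable.mul
      (measurable_const.indicator (measurableSet_coin hR hk hh)).aemeasurable ?_)
    exact ⟨_, hp.inv, (ae_coinProb_inv hR hk hh).mono fun ω h => h.symm⟩
  have h1 : ∫⁻ ω, ENNReal.ofReal (∑ k ∈ Finset.range I.K, ∑ h ∈ Finset.range I.M.H,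
      (R.coin k h).indicator (fun _ => (1 : ℝ)) ω * numCopies R I k h ω) ∂μ
      ≤ ENNReal.ofReal (I.K * I.M.H : ℝ) := by
    have h2 : ∀ ω, ENNReal.ofReal (∑ k ∈ Finset.range I.K, ∑ h ∈ Finset.range I.M.H,
        (R.coin k h).indicator (fun _ => (1 : ℝ)) ω * numCopies R I k h ω)
        = ∑ k ∈ Finset.range I.K, ∑ h ∈ Finset.range I.M.H, ENNReal.ofReal
        ((R.coin k h).indicator (fun _ => (1 : ℝ)) ω * numCopies R I k h ω) := by
      intro ω
      rw [ENNReal.ofReal_sum_of_nonneg fun k _ => Finset.sum_nonneg fun h _ => hterm k h ω]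
      refine Finset.sum_congr rfl fun k _ => ?_
      rw [ENNReal.ofReal_sum_of_nonneg fun h _ => hterm k h ω]
    simp_rw [h2]
    rw [lintegral_finsetSum' _ fun k hk => Finset.aemeasurable_fun_sum _ fun h hh =>
      hae k (Finset.mem_range.1 hk) h (Finset.mem_range.1 hh)]
    calc _ ≤ ∑ k ∈ Finset.range I.K, ∑ h ∈ Finset.range I.M.H, (1 : ℝ≥0∞) := by
          refine Finset.sum_le_sum fun k hk => ?_
          rw [lintegral_finsetSum' _ fun h hh =>
            hae k (Finset.mem_range.1 hk) h (Finset.mem_range.1 hh)]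
          exact Finset.sum_le_sum fun h hh =>
            lintegral_coin_mul_copies_le hR (Finset.mem_range.1 hk) (Finset.mem_range.1 hh)
      _ = _ := by
          simp only [Finset.sum_const, Finset.card_range, nsmul_eq_mul, mul_one]
          rw [ENNReal.ofReal_mul (Nat.cast_nonneg _)]
          simp
  have h3 : AEMeasurable (fun ω => ENNReal.ofReal (∑ k ∈ Finset.range I.K,
      ∑ h ∈ Finset.range I.M.H,
      (R.coin k h).indicator (fun _ => (1 : ℝ)) ω * numCopies R I k h ω)) μ := by
    refine AEMeasurable.ennreal_ofReal (Finset.aemeasurable_fun_sum _ fun k hk =>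
      Finset.aemeasurable_fun_sum _ fun h hh => ?_)
    have hp := (measurable_coinProb (R := R) (I := I) (μ := μ) (filt := filt) k h).mono
      (filt.le _) le_rfl
    refine AEMeasurable.mul (measurable_const.indicator (measurableSet_coin hR
      (Finset.mem_range.1 hk) (Finset.mem_range.1 hh))).aemeasurable ?_
    exact ⟨_, hp.inv, (ae_coinProb_inv hR (Finset.mem_range.1 hk)
      (Finset.mem_range.1 hh)).mono fun ω h => h.symm⟩
  have h4 := meas_ge_le_lintegral_div h3 (ε := ENNReal.ofReal a)
    (by simpa using ha) ENNReal.ofReal_ne_top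
  calc _ ≤ _ := measure_mono fun ω hω => ENNReal.ofReal_le_ofReal hω
    _ ≤ _ := h4
    _ ≤ ENNReal.ofReal (I.K * I.M.H : ℝ) / ENNReal.ofReal a := by gcongr
    _ = _ := by rw [ENNReal.ofReal_div_of_pos ha]

end Coins

/-! ### Concentration of sub-sampled squared norms. -/

section Sampling

theorem exp_neg_le_one_sub_half {x : ℝ} (h0 : 0 ≤ x) (h1 : x ≤ 1) : Real.exp (-x) ≤ 1 - x / 2 := by
  have h2 : x + 1 ≤ Real.exp x := Real.add_one_le_exp x
  rw [Real.exp_neg]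
  have h3 : (Real.exp x)⁻¹ ≤ (x + 1)⁻¹ := inv_anti₀ (by linarith) h2
  refine h3.trans ?_
  rw [inv_le_iff_one_le_mul₀ (by linarith)]
  nlinarith

theorem exp_le_one_add_two_mul {x : ℝ} (h0 : 0 ≤ x) (h1 : x ≤ 1) : Real.exp x ≤ 1 + 2 * x := by
  have h2 := Real.abs_exp_sub_one_sub_id_le (abs_le.2 ⟨by linarith, h1⟩)
  have h3 := (abs_le.1 h2).2
  nlinarith

/-- The points for which the sampling causes an increment of size at most `b`, or no randomness. -/
def goodSet {Ω : Type*} (c D : Ω → ℝ) (b : ℝ) : Set Ω :=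
  {ω | D ω = 0 ∨ (1 ≤ c ω ∧ (c ω = 1 ∨ c ω * D ω ^ 2 ≤ b))}

theorem measurableSet_goodSet {Ω : Type*} {m : MeasurableSpace Ω} {c D : Ω → ℝ}
    (hc : Measurable[m] c) (hD : Measurable[m] D) (b : ℝ) : MeasurableSet[m] (goodSet c D b) := by
  refine MeasurableSet.union (hD (measurableSet_singleton 0)) (MeasurableSet.inter
    (hc measurableSet_Ici) (MeasurableSet.union (hc (measurableSet_singleton 1)) ?_))
  exact (hc.mul (hD.pow_const 2)) measurableSet_Iic

/-- The normalised increment `x = p⁻¹ D² / b` lies in `[0, 1]` and occurs with probability `p`. Then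
`exp (-x) ≤ 1 - x / 2` allows compensation by half of its mean. For `p = 1` nothing is random and no
bound on the size of `D` is required. -/
theorem exp_sampling_lower {p D b : ℝ} (hb : 0 < b) (hp1 : p ≤ 1)
    (h : D = 0 ∨ (1 ≤ p⁻¹ ∧ (p⁻¹ = 1 ∨ p⁻¹ * D ^ 2 ≤ b))) :
    p * Real.exp (-(p⁻¹ * D ^ 2 / b) + D ^ 2 / (2 * b)) + (1 - p) * Real.exp (D ^ 2 / (2 * b))
      ≤ 1 := by
  rcases h with rfl | ⟨h1, h2⟩
  · simp
  have hp : 0 < p := by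
    by_contra hcon
    have : p⁻¹ ≤ 0 := inv_nonpos.2 (not_lt.1 hcon)
    linarith
  rcases h2 with h2 | h2
  · rw [inv_eq_one] at h2
    subst h2
    have h3 : -((1 : ℝ)⁻¹ * D ^ 2 / b) + D ^ 2 / (2 * b) = -(D ^ 2 / (2 * b)) := by
      field_simp; ring
    rw [h3]
    have : Real.exp (-(D ^ 2 / (2 * b))) ≤ 1 := Real.exp_le_one_iff.2 (by
      have : 0 ≤ D ^ 2 / (2 * b) := by positivity
      linarith)
    linarith
  · set x := p⁻¹ * D ^ 2 / b with hx
    have hx0 : 0 ≤ x := by positivity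
    have hx1 : x ≤ 1 := by rw [hx, div_le_one hb]; exact h2
    have hD : D ^ 2 / (2 * b) = p * x / 2 := by rw [hx]; field_simp
    rw [hD, Real.exp_add]
    have h3 := exp_neg_le_one_sub_half hx0 hx1
    have h4 : 1 - p * x / 2 ≤ Real.exp (-(p * x / 2)) := by
      have := Real.add_one_le_exp (-(p * x / 2)); linarith
    have h5 : Real.exp (-(p * x / 2)) * Real.exp (p * x / 2) = 1 := by
      rw [← Real.exp_add]; simp
    calc _ = (p * Real.exp (-x) + (1 - p)) * Real.exp (p * x / 2) := by ring
      _ ≤ Real.exp (-(p * x / 2)) * Real.exp (p * x / 2) := by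
        gcongr
        nlinarith
      _ = 1 := h5

/-- The same with `exp x ≤ 1 + 2 x`, so the compensator is twice the mean. -/
theorem exp_sampling_upper {p D b : ℝ} (hb : 0 < b) (hp1 : p ≤ 1)
    (h : D = 0 ∨ (1 ≤ p⁻¹ ∧ (p⁻¹ = 1 ∨ p⁻¹ * D ^ 2 ≤ b))) :
    p * Real.exp (p⁻¹ * D ^ 2 / b + -(2 * D ^ 2 / b)) + (1 - p) * Real.exp (-(2 * D ^ 2 / b))
      ≤ 1 := by
  rcases h with rfl | ⟨h1, h2⟩
  · simp
  have hp : 0 < p := by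
    by_contra hcon
    have : p⁻¹ ≤ 0 := inv_nonpos.2 (not_lt.1 hcon)
    linarith
  rcases h2 with h2 | h2
  · rw [inv_eq_one] at h2
    subst h2
    have h3 : (1 : ℝ)⁻¹ * D ^ 2 / b + -(2 * D ^ 2 / b) = -(D ^ 2 / b) := by
      field_simp; ring
    rw [h3]
    have : Real.exp (-(D ^ 2 / b)) ≤ 1 := Real.exp_le_one_iff.2 (by
      have : 0 ≤ D ^ 2 / b := by positivity
      linarith)
    linarith
  · set x := p⁻¹ * D ^ 2 / b with hx
    have hx0 : 0 ≤ x := by positivity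
    have hx1 : x ≤ 1 := by rw [hx, div_le_one hb]; exact h2
    have hD : 2 * D ^ 2 / b = 2 * p * x := by rw [hx]; field_simp
    rw [hD, Real.exp_add]
    have h3 := exp_le_one_add_two_mul hx0 hx1
    have h4 : 2 * p * x + 1 ≤ Real.exp (2 * p * x) := Real.add_one_le_exp _
    have h5 : Real.exp (2 * p * x) * Real.exp (-(2 * p * x)) = 1 := by
      rw [← Real.exp_add]; simp
    calc _ = (p * Real.exp x + (1 - p)) * Real.exp (-(2 * p * x)) := by ring
      _ ≤ Real.exp (2 * p * x) * Real.exp (-(2 * p * x)) := by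
        gcongr
        nlinarith
      _ = 1 := h5

variable {S A Ω : Type*} [MeasurableSpace S] [MeasurableSpace A] [mΩ : MeasurableSpace Ω]
  {R : Interaction S A Ω} {I : Input S A} {μ : Measure Ω} {filt : Filtration (ℕ ×ₗ ℕ) mΩ}

open Classical in
-- The indicators of `goodSet` make the process a supermartingale at every outcome; the event then
-- retains only outcomes on which they all equal `1`. The measurable `(coinProb)⁻¹` stands for
-- `numCopies`.
theorem measure_sampling_lower [IsProbabilityMeasure μ] (hR : R.IsExecution I μ filt)
    {h₀ : ℕ} (hh₀ : h₀ < I.M.H) (D : ℕ → Ω → ℝ)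
    (hD : ∀ k < I.K, Measurable[filt (toLex (k, I.M.H + h₀))] (D k)) {b : ℝ} (hb : 0 < b)
    {n : ℕ} (hn : n ≤ I.K) (L : ℝ) :
    μ {ω | (∀ k < n, (coinProb R I μ filt k h₀ ω)⁻¹ = numCopies R I k h₀ ω) ∧
      (∀ k < n, ω ∈ goodSet (fun ω => (numCopies R I k h₀ ω : ℝ)) (D k) b) ∧
      L * b + ∑ k ∈ Finset.range n,
        (R.coin k h₀).indicator (fun _ => (1 : ℝ)) ω * (numCopies R I k h₀ ω * D k ω ^ 2)
      ≤ ∑ k ∈ Finset.range n, D k ω ^ 2 / 2} ≤ ENNReal.ofReal (Real.exp (-L)) := by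
  set c : ℕ → Ω → ℝ := fun k ω => (coinProb R I μ filt k h₀ ω)⁻¹ with hc
  have hcm : ∀ k, Measurable[filt (toLex (k, I.M.H + h₀))] (c k) :=
    fun k => (measurable_coinProb k h₀).inv
  have h1 := measure_coin_sum_single_ge_le hR hh₀
    (fun k => (goodSet (c k) (D k) b).indicator fun ω => -(c k ω * D k ω ^ 2 / b))
    (fun k => (goodSet (c k) (D k) b).indicator fun ω => D k ω ^ 2 / (2 * b))
    (fun k hk => (((hcm k).mul ((hD k hk).pow_const 2)).div_const b).neg.indicator
      (measurableSet_goodSet (hcm k) (hD k hk) b))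
    (fun k hk => (((hD k hk).pow_const 2).div_const _).indicator
      (measurableSet_goodSet (hcm k) (hD k hk) b))
    (fun k ω h0 h1 => ?_) hn L
  · refine le_trans (measure_mono ?_) h1
    rintro ω ⟨hω1, hω2, hω3⟩
    have h2 : ∀ k ∈ Finset.range n, (R.coin k h₀).indicator (fun _ => (1 : ℝ)) ω
        * (goodSet (c k) (D k) b).indicator (fun ω => -(c k ω * D k ω ^ 2 / b)) ω
        + (goodSet (c k) (D k) b).indicator (fun ω => D k ω ^ 2 / (2 * b)) ω
        = (D k ω ^ 2 / 2 - (R.coin k h₀).indicator (fun _ => (1 : ℝ)) ω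
          * (numCopies R I k h₀ ω * D k ω ^ 2)) / b := by
      intro k hk
      have hk' := Finset.mem_range.1 hk
      have hmem : ω ∈ goodSet (c k) (D k) b := by
        have := hω2 k hk'
        simp only [goodSet, Set.mem_ofPred_eq, hc, hω1 k hk'] at this ⊢
        exact this
      rw [Set.indicator_of_mem hmem, Set.indicator_of_mem hmem]
      simp only [hc, hω1 k hk']
      field_simp
      ring
    change L ≤ _
    rw [Finset.sum_congr rfl h2, ← Finset.sum_div, Finset.sum_sub_distrib, le_div_iff₀ hb]
    linarith
  · by_cases hg : ω ∈ goodSet (c k) (D k) b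
    · simp only [Set.indicator_of_mem hg]
      exact exp_sampling_lower hb h1 hg
    · simp [Set.indicator_of_notMem hg]

open Classical in
theorem measure_sampling_upper [IsProbabilityMeasure μ] (hR : R.IsExecution I μ filt)
    {h₀ : ℕ} (hh₀ : h₀ < I.M.H) (D : ℕ → Ω → ℝ)
    (hD : ∀ k < I.K, Measurable[filt (toLex (k, I.M.H + h₀))] (D k)) {b : ℝ} (hb : 0 < b)
    {n : ℕ} (hn : n ≤ I.K) (L : ℝ) :
    μ {ω | (∀ k < n, (coinProb R I μ filt k h₀ ω)⁻¹ = numCopies R I k h₀ ω) ∧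
      (∀ k < n, ω ∈ goodSet (fun ω => (numCopies R I k h₀ ω : ℝ)) (D k) b) ∧
      L * b + ∑ k ∈ Finset.range n, 2 * D k ω ^ 2 ≤ ∑ k ∈ Finset.range n,
        (R.coin k h₀).indicator (fun _ => (1 : ℝ)) ω * (numCopies R I k h₀ ω * D k ω ^ 2)}
      ≤ ENNReal.ofReal (Real.exp (-L)) := by
  set c : ℕ → Ω → ℝ := fun k ω => (coinProb R I μ filt k h₀ ω)⁻¹ with hc
  have hcm : ∀ k, Measurable[filt (toLex (k, I.M.H + h₀))] (c k) :=
    fun k => (measurable_coinProb k h₀).inv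
  have h1 := measure_coin_sum_single_ge_le hR hh₀
    (fun k => (goodSet (c k) (D k) b).indicator fun ω => c k ω * D k ω ^ 2 / b)
    (fun k => (goodSet (c k) (D k) b).indicator fun ω => -(2 * D k ω ^ 2 / b))
    (fun k hk => (((hcm k).mul ((hD k hk).pow_const 2)).div_const b).indicator
      (measurableSet_goodSet (hcm k) (hD k hk) b))
    (fun k hk => ((((hD k hk).pow_const 2).const_mul 2).div_const b).neg.indicator
      (measurableSet_goodSet (hcm k) (hD k hk) b))
    (fun k ω h0 h1 => ?_) hn L
  · refine le_trans (measure_mono ?_) h1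
    rintro ω ⟨hω1, hω2, hω3⟩
    have h2 : ∀ k ∈ Finset.range n, (R.coin k h₀).indicator (fun _ => (1 : ℝ)) ω
        * (goodSet (c k) (D k) b).indicator (fun ω => c k ω * D k ω ^ 2 / b) ω
        + (goodSet (c k) (D k) b).indicator (fun ω => -(2 * D k ω ^ 2 / b)) ω
        = ((R.coin k h₀).indicator (fun _ => (1 : ℝ)) ω
          * (numCopies R I k h₀ ω * D k ω ^ 2) - 2 * D k ω ^ 2) / b := by
      intro k hk
      have hk' := Finset.mem_range.1 hk
      have hmem : ω ∈ goodSet (c k) (D k) b := by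
        have := hω2 k hk'
        simp only [goodSet, Set.mem_ofPred_eq, hc, hω1 k hk'] at this ⊢
        exact this
      rw [Set.indicator_of_mem hmem, Set.indicator_of_mem hmem]
      simp only [hc, hω1 k hk']
      field_simp
      ring
    change L ≤ _
    rw [Finset.sum_congr rfl h2, ← Finset.sum_div, Finset.sum_sub_distrib, le_div_iff₀ hb]
    linarith
  · by_cases hg : ω ∈ goodSet (c k) (D k) b
    · simp only [Set.indicator_of_mem hg]
      exact exp_sampling_upper hb h1 hg
    · simp [Set.indicator_of_notMem hg]

end Sampling

/-! ### Regret against the gaps met on the trajectories. -/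

section Trajectories

variable {S A Ω : Type*} [MeasurableSpace S] [MeasurableSpace A] [mΩ : MeasurableSpace Ω]
  {R : Interaction S A Ω} {I : Input S A} {μ : Measure Ω} {filt : Filtration (ℕ ×ₗ ℕ) mΩ}
  {πs : ℕ → S → A}

theorem measurable_subopt_joint (hR : R.IsExecution I μ filt) (hs : I.M.IsOptimal πs) {k h h' : ℕ}
    (hk : k < I.K) (hh : h ≤ I.M.H) :
    Measurable[(filt (toLex (k, h'))).prod inferInstance]
      fun q : Ω × S => subopt I.M πs (fun j => R.policy k j q.1) h q.2 := by
  have h1 := @measurable_V_joint S A _ _ I.M Ω (filt (toLex (k, h'))) (fun ω j => R.policy k j ω)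
    (fun j hj => measurable_prod_mono (filt.mono (lex_le_of_le (Nat.zero_le h')))
      (hR.policy_measurable k hk j hj)) (I.M.H - h) h (by omega)
  have h2 := (measurable_V I.M (fun h _ => hs.1 h) hh).comp
    (@measurable_snd Ω S (filt (toLex (k, h'))) inferInstance)
  exact h2.sub h1

/-- With `x` the current sub-optimality and `g` the current gap, `x - g` is the conditional mean of
the next sub-optimality, so this is the supermartingale inequality of `measure_gap_sum_le`. Since `x
≤ H`, the right side is at least `1 / 2`, which pays for the gain of `g / (2 H)`. -/
theorem exp_gap_mul_le {H g x : ℝ} (hH : 0 < H) (hg : 0 ≤ g) (hx : x ≤ H) :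
    Real.exp (-(g / H)) * (1 - (x - g) / (2 * H)) ≤ 1 - x / (2 * H) := by
  have h1 : g / H + 1 ≤ Real.exp (g / H) := Real.add_one_le_exp _
  have h2 : 1 / 2 ≤ 1 - x / (2 * H) := by
    have : x / (2 * H) ≤ 1 / 2 := by rw [div_le_div_iff₀ (by positivity) (by norm_num)]; linarith
    linarith
  rw [Real.exp_neg, inv_mul_le_iff₀ (Real.exp_pos _)]
  have h3 : 1 - (x - g) / (2 * H) = (1 - x / (2 * H)) + (g / H) * (1 / 2) := by field_simp; ring
  rw [h3]
  have h4 : 0 ≤ g / H := by positivity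
  nlinarith

/-- The regret is controlled by the sum of the gaps that are incurred along the trajectories. -/
theorem measure_gap_sum_le [IsProbabilityMeasure μ] (hR : R.IsExecution I μ filt)
    (hs : I.M.IsOptimal πs) (L : ℝ) :
    μ {ω | L ≤ ∑ k ∈ Finset.range I.K,
      (subopt I.M πs (fun j => R.policy k j ω) 0 I.M.s₁ / (2 * I.M.H)
        - (∑ h ∈ Finset.range I.M.H, I.M.gap πs h (R.state k h ω) (R.act k h ω)) / I.M.H)}
      ≤ ENNReal.ofReal (Real.exp (-L)) := by
  have hH : (0 : ℝ) < I.M.H := by exact_mod_cast I.M.H_pos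
  set Δ : ℕ → ℕ → Ω → S → ℝ := fun k h ω s => subopt I.M πs (fun j => R.policy k j ω) h s with hΔ
  have hpm := fun k (hk : k < I.K) ω => measurable_policy hR hk ω
  have hΔb : ∀ k < I.K, ∀ h ≤ I.M.H, ∀ ω s, Δ k h ω s ∈ Set.Icc (0 : ℝ) I.M.H :=
    fun k hk h hh ω s => subopt_mem_Icc hs (hpm k hk ω) hh s
  have hpos : ∀ k < I.K, ∀ h ≤ I.M.H, ∀ ω s, 0 < 1 - Δ k h ω s / (2 * I.M.H) := by
    intro k hk h hh ω s
    have h1 : Δ k h ω s / (2 * I.M.H) ≤ 1 / 2 := by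
      rw [div_le_div_iff₀ (by positivity) (by norm_num)]
      have := (hΔb k hk h hh ω s).2
      linarith
    linarith
  -- The logarithmic increment of `exp (-∑ gap / H) (1 - Δ / (2 H))`. It telescopes over an episode,
  -- and `Δ ≤ H` keeps the argument of the logarithm positive.
  set ψ : ℕ → ℕ → Ω × S → ℝ := fun k h q =>
    -(I.M.gap πs h (R.state k h q.1) (R.act k h q.1) / I.M.H)
      + Real.log (1 - Δ k (h + 1) q.1 q.2 / (2 * I.M.H))
      - Real.log (1 - Δ k h q.1 (R.state k h q.1) / (2 * I.M.H)) with hψ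
  have hψm : ∀ k < I.K, ∀ h < I.M.H,
      Measurable[(filt (toLex (k, h))).prod inferInstance] (ψ k h) := by
    intro k hk h hh
    have hs1 := measurable_state hR hk hh.le (le_refl h)
    have ha1 := measurable_act hR hk hh (le_refl h)
    have hfst := @measurable_fst Ω S (filt (toLex (k, h))) inferInstance
    have hg := ((measurable_gap hs hh).comp (hs1.prodMk ha1)).comp hfst
    have h1 := measurable_subopt_joint hR hs (h' := h) hk (Nat.succ_le_of_lt hh)
    have h2 := (measurable_comp_graph le_rfl
      (measurable_subopt_joint hR hs (h' := h) hk hh.le) hs1).comp hfst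
    exact ((hg.div_const _).neg.add (Real.measurable_log.comp
      (measurable_const.sub (h1.div_const _)))).sub (Real.measurable_log.comp
      (measurable_const.sub (h2.div_const _)))
  have hstep := measure_sum_ge_le filt I.K I.M.H 0
    (fun k h ω => ψ k h (ω, R.state k (h + 1) ω)) (fun k hk h hh => by
      rw [Nat.zero_add]; exact measurable_at_next_state hR hk hh (hψm k hk h hh))
    (fun k hk h hh => by
      rw [Nat.zero_add]
      refine isStep_transition hR hk hh (hψm k hk h hh) fun ω => ?_
      set s := R.state k h ω
      set ν := I.M.P h (s, R.act k h ω)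
      set g := I.M.gap πs h s (R.act k h ω) with hg
      have hg0 : 0 ≤ g := gap_nonneg hs hh _ _
      have hsub := subopt_eq hs (hpm k hk ω) hh s
      have hmeas : Measurable (Δ k (h + 1) ω) :=
        (measurable_V I.M (fun h _ => hs.1 h) hh).sub (measurable_V I.M (hpm k hk ω) hh)
      have hint : Integrable (Δ k (h + 1) ω) ν :=
        integrable_of_bounds hmeas fun x => hΔb k hk (h + 1) hh ω x
      have e1 : ∀ x, Real.exp (ψ k h (ω, x)) = Real.exp (-(g / I.M.H))
          * (1 - Δ k (h + 1) ω x / (2 * I.M.H)) / (1 - Δ k h ω s / (2 * I.M.H)) := by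
        intro x
        simp only [hψ]
        rw [Real.exp_sub, Real.exp_add, Real.exp_log (hpos k hk (h + 1) hh ω x),
          Real.exp_log (hpos k hk h hh.le ω _)]
      simp_rw [e1]
      have hi2 : Integrable (fun x => Real.exp (-(g / I.M.H))
          * (1 - Δ k (h + 1) ω x / (2 * I.M.H)) / (1 - Δ k h ω s / (2 * I.M.H))) ν :=
        (((integrable_const _).sub (hint.div_const _)).const_mul _).div_const _
      rw [← ofReal_integral_eq_lintegral_ofReal hi2 (Filter.Eventually.of_forall fun x =>
        div_nonneg (mul_nonneg (Real.exp_nonneg _) (hpos k hk (h + 1) hh ω x).le)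
          (hpos k hk h hh.le ω s).le), ENNReal.ofReal_le_one, integral_div, integral_const_mul,
        integral_sub (integrable_const _) (hint.div_const _), integral_div]
      rw [div_le_one (hpos k hk h hh.le ω s)]
      have e2 : ∫ x, Δ k (h + 1) ω x ∂ν = Δ k h ω s - g := by
        have : Δ k h ω s = g + ∫ x, Δ k (h + 1) ω x ∂ν := hsub
        linarith
      rw [e2]
      simp only [integral_const, probReal_univ, smul_eq_mul, mul_one]
      exact exp_gap_mul_le hH hg0 (hΔb k hk h hh.le ω s).2) L
  refine le_trans (measure_mono fun ω hω => ?_) hstep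
  change L ≤ _ at hω
  change L ≤ _
  refine hω.trans (Finset.sum_le_sum fun k hk => ?_)
  have hk' := Finset.mem_range.1 hk
  have htel : ∑ h ∈ Finset.range I.M.H, ψ k h (ω, R.state k (h + 1) ω)
      = -((∑ h ∈ Finset.range I.M.H, I.M.gap πs h (R.state k h ω) (R.act k h ω)) / I.M.H)
        + (Real.log (1 - Δ k I.M.H ω (R.state k I.M.H ω) / (2 * I.M.H))
        - Real.log (1 - Δ k 0 ω (R.state k 0 ω) / (2 * I.M.H))) := by
    rw [← Finset.sum_range_sub (fun h => Real.log (1 - Δ k h ω (R.state k h ω) / (2 * I.M.H))),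
      Finset.sum_div, ← Finset.sum_neg_distrib, ← Finset.sum_add_distrib]
    refine Finset.sum_congr rfl fun h _ => ?_
    simp only [hψ]
    ring
  rw [htel]
  have h1 : Δ k I.M.H ω (R.state k I.M.H ω) = 0 := by
    simp only [hΔ, subopt, V_last, sub_zero]
  rw [h1, hR.state_zero k hk' ω]
  -- The inequality `log (1 - y) ≤ -y` at the initial state turns the remaining logarithm into the
  -- regret of the episode divided by `2 H`.
  have h2 := Real.log_le_sub_one_of_pos (hpos k hk' 0 (Nat.zero_le _) ω I.M.s₁)
  simp only [zero_div, sub_zero, Real.log_one]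
  simp only [hΔ] at h2 ⊢
  linarith

end Trajectories

/-! ### Consequences of the concentration event. -/

section GoodEvents

variable {S A Ω : Type*} [MeasurableSpace S] [MeasurableSpace A]

/-- The total number of steps. -/
def Input.T (I : Input S A) : ℝ := (I.K : ℝ) * I.M.H

/-- Standing assumptions: realizability by `Ps`, bounded differences, covers `C₁`, `C₂` of the
function classes, and lower bounds for the parameters of the algorithm. -/
structure Setting (I : Input S A) (δ La : ℝ) (C₁ C₂ : ℕ → Finset (Pt S A → ℝ))
    (Ps : ℕ → SignedKernel S A) : Prop where
  two_le : 2 ≤ I.T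
  δ_pos : 0 < δ
  δ_lt : δ < 1
  Ps_mem : ∀ h < I.M.H, Ps h ∈ I.cP h
  Ps_eq : ∀ h < I.M.H, ∀ s a, ∀ B : Set S, MeasurableSet B →
    (Ps h).toFun s a B = (I.M.P h (s, a)).real B
  diam : ∀ h < I.M.H, ∀ f ∈ I.F h, ∀ g ∈ I.F h, ∀ z ∈ dom S A I.M.H, |f z - g z| ≤ (I.M.H : ℝ) + 1
  C₁_sub : ∀ h < I.M.H, (C₁ h : Set (Pt S A → ℝ)) ⊆ I.F h
  C₁_cover : ∀ h < I.M.H, ∀ f ∈ I.F h, ∃ g ∈ C₁ h, ∀ z ∈ dom S A I.M.H, |f z - g z| ≤ 1 / I.T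
  C₂_sub : ∀ h < I.M.H, (C₂ h : Set (Pt S A → ℝ)) ⊆ I.F h
  C₂_cover : ∀ h < I.M.H, ∀ f ∈ I.F h, ∃ g ∈ C₂ h, ∀ z ∈ dom S A I.M.H,
    |f z - g z| ≤ Real.sqrt (δ / (64 * I.T ^ 3))
  lam_ge : 1 ≤ I.lam
  La_ge : 1 ≤ La
  β_ge : 976 * (I.M.H : ℝ) ^ 2 * La ≤ I.β

/-- The increment sizes at which the sampling is analysed. -/
noncomputable def Input.level (I : Input S A) (m : ℕ) : ℝ := (m + 2) * I.β / I.lam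

/-- The event that all the concentration bounds for the datasets hold. -/
structure GoodEvent (R : Interaction S A Ω) (I : Input S A) (δ La : ℝ)
    (C₁ C₂ : ℕ → Finset (Pt S A → ℝ)) (Ps : ℕ → SignedKernel S A) (ω : Ω) : Prop where
  lower : ∀ h < I.M.H, ∀ g₁ ∈ C₂ h, ∀ g₂ ∈ C₂ h, ∀ n ≤ I.K,
    ∀ m < I.K * I.M.H * (I.M.H + 1) ^ 2,
    (∀ k < n, ω ∈ goodSet (fun ω => (numCopies R I k h ω : ℝ))
      (fun ω => g₁ (cpt R I k h ω) - g₂ (cpt R I k h ω)) (I.level m)) →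
    ∑ k ∈ Finset.range n, (g₁ (cpt R I k h ω) - g₂ (cpt R I k h ω)) ^ 2 / 2
      < I.lam / 16 * I.level m + ∑ k ∈ Finset.range n,
        (R.coin k h).indicator (fun _ => (1 : ℝ)) ω
          * (numCopies R I k h ω * (g₁ (cpt R I k h ω) - g₂ (cpt R I k h ω)) ^ 2)
  upper : ∀ h < I.M.H, ∀ g₁ ∈ C₂ h, ∀ g₂ ∈ C₂ h, ∀ n ≤ I.K,
    (∀ k < n, ω ∈ goodSet (fun ω => (numCopies R I k h ω : ℝ))
      (fun ω => g₁ (cpt R I k h ω) - g₂ (cpt R I k h ω)) (I.level 0)) →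
    ∑ k ∈ Finset.range n, (R.coin k h).indicator (fun _ => (1 : ℝ)) ω
        * (numCopies R I k h ω * (g₁ (cpt R I k h ω) - g₂ (cpt R I k h ω)) ^ 2)
      < I.lam / 16 * I.level 0
        + ∑ k ∈ Finset.range n, 2 * (g₁ (cpt R I k h ω) - g₂ (cpt R I k h ω)) ^ 2
  count : ∑ k ∈ Finset.range I.K, ∑ h ∈ Finset.range I.M.H,
      (R.coin k h).indicator (fun _ => (1 : ℝ)) ω * numCopies R I k h ω < 8 * I.T / δ
  lsq : ∀ h < I.M.H, ∀ g ∈ C₁ h, ∀ n < I.K, ∑ k ∈ Finset.range n,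
      (2 * (g (cpt R I k h ω) - modelFun (Ps h) (cpt R I k h ω)) / (I.M.H : ℝ) ^ 2
        * (cval R I k (h + 1) ω (R.state k (h + 1) ω)
          - ∫ s, cval R I k (h + 1) ω s ∂(I.M.P h (R.state k h ω, R.act k h ω)))
        - (2 * (g (cpt R I k h ω) - modelFun (Ps h) (cpt R I k h ω)) / (I.M.H : ℝ) ^ 2) ^ 2
          * (I.M.H : ℝ) ^ 2 / 8) < La

/-- The value estimates of the first `n` episodes lie in `[0, H]`. -/
def InRange (R : Interaction S A Ω) (I : Input S A) (n : ℕ) (ω : Ω) : Prop :=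
  ∀ j < n, ∀ h ≤ I.M.H, ∀ s, R.val j h ω s ∈ Set.Icc (0 : ℝ) I.M.H

variable {R : Interaction S A Ω} {I : Input S A} {δ La : ℝ} {C₁ C₂ : ℕ → Finset (Pt S A → ℝ)}
  {Ps : ℕ → SignedKernel S A} {ω : Ω}

theorem InRange.mono {m n : ℕ} (h : InRange R I n ω) (hmn : m ≤ n) : InRange R I m ω :=
  fun j hj => h j (by omega)

theorem InRange.cval_eq {n : ℕ} (h : InRange R I n ω) {j h' : ℕ} (hj : j < n) (hh : h' ≤ I.M.H) :
    cval R I j h' ω = R.val j h' ω := by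
  ext s
  have := h j hj h' hh s
  rw [cval, min_eq_right this.2, max_eq_right this.1]

theorem InRange.cpt_eq {n : ℕ} (h : InRange R I n ω) {j h' : ℕ} (hj : j < n) (hh : h' < I.M.H) :
    cpt R I j h' ω = R.pt j h' ω := by
  rw [cpt, h.cval_eq hj hh, Interaction.pt]

theorem Setting.H_ge (_ : Setting I δ La C₁ C₂ Ps) : (1 : ℝ) ≤ I.M.H := by
  exact_mod_cast I.M.H_pos

theorem Setting.K_le (hS : Setting I δ La C₁ C₂ Ps) : (I.K : ℝ) ≤ I.T := by
  have := hS.H_ge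
  unfold Input.T
  nlinarith [Nat.cast_nonneg (α := ℝ) I.K]

theorem Setting.β_ge' (hS : Setting I δ La C₁ C₂ Ps) : 976 ≤ I.β := by
  have h1 := hS.β_ge
  have h2 := hS.La_ge
  have h3 := hS.H_ge
  have h4 : (1 : ℝ) ≤ (I.M.H : ℝ) ^ 2 := one_le_pow₀ h3
  have h5 : 1 * 1 ≤ (I.M.H : ℝ) ^ 2 * La := by gcongr
  linarith

/-- The sum of the squared differences over all the data. -/
def fullSum (R : Interaction S A Ω) (n h : ℕ) (ω : Ω) (f g : Pt S A → ℝ) : ℝ :=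
  ∑ j ∈ Finset.range n, (f (R.pt j h ω) - g (R.pt j h ω)) ^ 2

/-- The sum of the squared differences over the sub-sampled dataset. -/
noncomputable def subSum (R : Interaction S A Ω) (I : Input S A) (n h : ℕ) (ω : Ω)
    (f g : Pt S A → ℝ) : ℝ :=
  ∑ j ∈ Finset.range n, (R.coin j h).indicator (fun _ => (1 : ℝ)) ω
    * (numCopies R I j h ω * (f (R.pt j h ω) - g (R.pt j h ω)) ^ 2)

theorem dataNorm_sub_sq (n h : ℕ) (f g : Pt S A → ℝ) :
    dataNorm (R.dataset I n h ω) (f - g) ^ 2 = subSum R I n h ω f g := by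
  rw [dataNorm_dataset_sq]; rfl

theorem indicator_one_nonneg (s : Set Ω) (ω : Ω) : 0 ≤ s.indicator (fun _ => (1 : ℝ)) ω :=
  Set.indicator_nonneg (fun _ _ => zero_le_one) ω

theorem subSum_nonneg (n h : ℕ) (f g : Pt S A → ℝ) : 0 ≤ subSum R I n h ω f g :=
  Finset.sum_nonneg fun _ _ => mul_nonneg (indicator_one_nonneg _ _) (by positivity)

theorem fullSum_nonneg (n h : ℕ) (f g : Pt S A → ℝ) : 0 ≤ fullSum R n h ω f g :=
  Finset.sum_nonneg fun _ _ => sq_nonneg _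

theorem subSum_mono {m n : ℕ} (hmn : m ≤ n) (h : ℕ) (f g : Pt S A → ℝ) :
    subSum R I m h ω f g ≤ subSum R I n h ω f g :=
  Finset.sum_le_sum_of_subset_of_nonneg (Finset.range_mono hmn)
    fun j _ _ => mul_nonneg (indicator_one_nonneg _ _) (by positivity)

theorem fullSum_mono {m n : ℕ} (hmn : m ≤ n) (h : ℕ) (f g : Pt S A → ℝ) :
    fullSum R m h ω f g ≤ fullSum R n h ω f g :=
  Finset.sum_le_sum_of_subset_of_nonneg (Finset.range_mono hmn) fun _ _ _ => sq_nonneg _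

theorem sq_add_le_two_mul (a b : ℝ) : (a + b) ^ 2 ≤ 2 * a ^ 2 + 2 * b ^ 2 := by
  nlinarith [sq_nonneg (a - b)]

theorem sq_le_of_abs_sub_le {a b e : ℝ} (h : |a - b| ≤ e) : a ^ 2 ≤ 2 * b ^ 2 + 2 * e ^ 2 := by
  have h1 := sq_add_le_two_mul b (a - b)
  have h2 : (a - b) ^ 2 ≤ e ^ 2 := by
    rw [← sq_abs]; exact pow_le_pow_left₀ (abs_nonneg _) h 2
  have h3 : b + (a - b) = a := by ring
  rw [h3] at h1
  linarith

theorem trunc_nonneg : 0 ≤ I.trunc := by unfold Input.trunc; positivity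

/-- The admissible size of the increment depends on the value of the sub-sampled norm just before
it, so a bound `b` valid along the run must come from a bound on that norm. -/
theorem mem_goodSet (hS : Setting I δ La C₁ C₂ Ps) {n k h : ℕ} (hr : InRange R I n ω)
    (hk : k < n) (hh : h < I.M.H) {f g : Pt S A → ℝ} (hf : f ∈ I.F h) (hg : g ∈ I.F h) {b : ℝ}
    (hb : (subSum R I k h ω f g + I.β) / I.lam ≤ b) :
    ω ∈ goodSet (fun ω => (numCopies R I k h ω : ℝ))
      (fun ω => f (cpt R I k h ω) - g (cpt R I k h ω)) b := by
  have hβ : 0 < I.β := by linarith [hS.β_ge']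
  have h1 := copies_mul_sq_le I (Z := R.dataset I k h ω) (z := R.pt k h ω) hS.lam_ge hβ
    trunc_nonneg hf hg
  change _ = _ ∨ _
  simp only [hr.cpt_eq hk hh]
  refine h1.imp id fun h2 => ⟨?_, h2.2.imp ?_ ?_⟩
  · exact_mod_cast h2.1
  · intro h3; exact_mod_cast h3
  · intro h3
    rw [dataNorm_sub_sq] at h3
    exact h3.trans hb

/-- A stopping argument at the first time the sub-sampled sum exceeds `β / 4`. Until then all
increments are below level `0`, so the upper tail bound applies and gives less than `β / 8 + 2 (β /
16) = β / 4`, a contradiction. -/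
theorem subSum_cover_le (hS : Setting I δ La C₁ C₂ Ps)
    (hG : GoodEvent R I δ La C₁ C₂ Ps ω) {n h : ℕ} (hn : n ≤ I.K) (hr : InRange R I n ω)
    (hh : h < I.M.H) {g₁ g₂ : Pt S A → ℝ} (hg₁ : g₁ ∈ C₂ h) (hg₂ : g₂ ∈ C₂ h)
    (hA : fullSum R n h ω g₁ g₂ ≤ I.β / 16) : subSum R I n h ω g₁ g₂ ≤ I.β / 4 := by
  have hβ : 976 ≤ I.β := hS.β_ge'
  have hlam := hS.lam_ge
  have hF₁ := hS.C₂_sub h hh hg₁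
  have hF₂ := hS.C₂_sub h hh hg₂
  by_contra hcon
  push Not at hcon
  have hex : ∃ n, I.β / 4 < subSum R I n h ω g₁ g₂ := ⟨n, hcon⟩
  classical
  set n' := Nat.find hex
  have hn1 : I.β / 4 < subSum R I n' h ω g₁ g₂ := Nat.find_spec hex
  have hn2 : n' ≤ n := Nat.find_min' hex hcon
  have hn3 : ∀ k < n', subSum R I k h ω g₁ g₂ ≤ I.β / 4 := fun k hk =>
    not_lt.1 (Nat.find_min hex hk)
  have hgood := hG.upper h hh g₁ hg₁ g₂ hg₂ n' (hn2.trans hn) fun k hk => by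
    refine mem_goodSet hS (hr.mono hn2) hk hh hF₁ hF₂ ?_
    unfold Input.level
    have := hn3 k hk
    gcongr
    norm_num
    linarith
  have e1 : ∑ k ∈ Finset.range n', 2 * (g₁ (cpt R I k h ω) - g₂ (cpt R I k h ω)) ^ 2
      = 2 * fullSum R n' h ω g₁ g₂ := by
    rw [fullSum, Finset.mul_sum]
    exact Finset.sum_congr rfl fun k hk => by
      rw [(hr.mono hn2).cpt_eq (Finset.mem_range.1 hk) hh]
  have e2 : ∑ k ∈ Finset.range n', (R.coin k h).indicator (fun _ => (1 : ℝ)) ω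
      * (numCopies R I k h ω * (g₁ (cpt R I k h ω) - g₂ (cpt R I k h ω)) ^ 2)
      = subSum R I n' h ω g₁ g₂ :=
    Finset.sum_congr rfl fun k hk => by rw [(hr.mono hn2).cpt_eq (Finset.mem_range.1 hk) hh]
  rw [e1, e2] at hgood
  have e3 : I.lam / 16 * I.level 0 = 2 * I.β / 16 := by
    unfold Input.level
    push_cast
    field_simp
    ring
  rw [e3] at hgood
  have := fullSum_mono (R := R) (ω := ω) hn2 h g₁ g₂
  linarith

theorem sum_copies_le (hG : GoodEvent R I δ La C₁ C₂ Ps ω) {n h : ℕ} (hn : n ≤ I.K)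
    (hh : h < I.M.H) : ∑ j ∈ Finset.range n, (R.coin j h).indicator (fun _ => (1 : ℝ)) ω
      * numCopies R I j h ω ≤ 8 * I.T / δ := by
  have hnn : ∀ j h, 0 ≤ (R.coin j h).indicator (fun _ => (1 : ℝ)) ω * numCopies R I j h ω :=
    fun j h => mul_nonneg (indicator_one_nonneg _ _) (Nat.cast_nonneg _)
  refine le_trans ?_ hG.count.le
  calc _ ≤ ∑ j ∈ Finset.range I.K, (R.coin j h).indicator (fun _ => (1 : ℝ)) ω
      * numCopies R I j h ω :=
        Finset.sum_le_sum_of_subset_of_nonneg (Finset.range_mono hn) fun j _ _ => hnn j h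
    _ ≤ _ := Finset.sum_le_sum fun j _ => Finset.single_le_sum
        (f := fun h => (R.coin j h).indicator (fun _ => (1 : ℝ)) ω * numCopies R I j h ω)
        (fun h _ => hnn j h) (Finset.mem_range.2 hh)

theorem exists_cover_pair (hS : Setting I δ La C₁ C₂ Ps) {h : ℕ} (hh : h < I.M.H)
    {f₁ f₂ : Pt S A → ℝ} (hf₁ : f₁ ∈ I.F h) (hf₂ : f₂ ∈ I.F h) :
    ∃ g₁ ∈ C₂ h, ∃ g₂ ∈ C₂ h, ∀ z ∈ dom S A I.M.H, |(f₁ z - f₂ z) - (g₁ z - g₂ z)|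
      ≤ 2 * Real.sqrt (δ / (64 * I.T ^ 3)) := by
  obtain ⟨g₁, hg₁, h1⟩ := hS.C₂_cover h hh f₁ hf₁
  obtain ⟨g₂, hg₂, h2⟩ := hS.C₂_cover h hh f₂ hf₂
  refine ⟨g₁, hg₁, g₂, hg₂, fun z hz => ?_⟩
  have e : (f₁ z - f₂ z) - (g₁ z - g₂ z) = (f₁ z - g₁ z) - (f₂ z - g₂ z) := by ring
  rw [e]
  have := abs_sub (f₁ z - g₁ z) (f₂ z - g₂ z)
  linarith [h1 z hz, h2 z hz]

theorem fullSum_le_of_close {n h : ℕ} {f₁ f₂ g₁ g₂ : Pt S A → ℝ} {e : ℝ}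
    (hc : ∀ j < n, |(f₁ (R.pt j h ω) - f₂ (R.pt j h ω)) - (g₁ (R.pt j h ω) - g₂ (R.pt j h ω))| ≤ e) :
    fullSum R n h ω f₁ f₂ ≤ 2 * fullSum R n h ω g₁ g₂ + n * (2 * e ^ 2) := by
  unfold fullSum
  rw [Finset.mul_sum]
  calc _ ≤ ∑ j ∈ Finset.range n, (2 * (g₁ (R.pt j h ω) - g₂ (R.pt j h ω)) ^ 2 + 2 * e ^ 2) :=
        Finset.sum_le_sum fun j hj => sq_le_of_abs_sub_le (hc j (Finset.mem_range.1 hj))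
    _ = _ := by rw [Finset.sum_add_distrib]; simp

theorem subSum_le_of_close {n h : ℕ} {f₁ f₂ g₁ g₂ : Pt S A → ℝ} {e : ℝ}
    (hc : ∀ j < n, |(f₁ (R.pt j h ω) - f₂ (R.pt j h ω)) - (g₁ (R.pt j h ω) - g₂ (R.pt j h ω))| ≤ e) :
    subSum R I n h ω f₁ f₂ ≤ 2 * subSum R I n h ω g₁ g₂
      + (∑ j ∈ Finset.range n, (R.coin j h).indicator (fun _ => (1 : ℝ)) ω
        * numCopies R I j h ω) * (2 * e ^ 2) := by
  unfold subSum
  rw [Finset.mul_sum, Finset.sum_mul, ← Finset.sum_add_distrib]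
  refine Finset.sum_le_sum fun j hj => ?_
  have h1 := sq_le_of_abs_sub_le (hc j (Finset.mem_range.1 hj))
  have h2 : 0 ≤ (R.coin j h).indicator (fun _ => (1 : ℝ)) ω * numCopies R I j h ω :=
    mul_nonneg (indicator_one_nonneg _ _) (Nat.cast_nonneg _)
  nlinarith

/-- This explains the scale of the finer cover: its squared error stays below `1` even when
multiplied by the number `8 T / δ` of copies. -/
theorem Setting.resolution (hS : Setting I δ La C₁ C₂ Ps) :
    8 * I.T / δ * (2 * (2 * Real.sqrt (δ / (64 * I.T ^ 3))) ^ 2) ≤ 1 ∧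
    I.T * (2 * (2 * Real.sqrt (δ / (64 * I.T ^ 3))) ^ 2) ≤ 1 := by
  have hT := hS.two_le
  have hδ := hS.δ_pos
  have hδ1 := hS.δ_lt
  have h1 : 2 * (2 * Real.sqrt (δ / (64 * I.T ^ 3))) ^ 2 = δ / (8 * I.T ^ 3) := by
    rw [mul_pow, Real.sq_sqrt (by positivity)]
    field_simp
    ring
  rw [h1]
  have hT2 : (4 : ℝ) ≤ I.T ^ 2 := by nlinarith
  constructor
  · have : 8 * I.T / δ * (δ / (8 * I.T ^ 3)) = 1 / I.T ^ 2 := by field_simp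
    rw [this, div_le_one (by positivity)]
    linarith
  · have : I.T * (δ / (8 * I.T ^ 3)) = δ / (8 * I.T ^ 2) := by field_simp
    rw [this, div_le_one (by positivity)]
    linarith

theorem modelFun_Ps (hS : Setting I δ La C₁ C₂ Ps) {h : ℕ} (hh : h < I.M.H) (s : S) (a : A)
    (V : S → ℝ) : modelFun (Ps h) (s, a, V) = ∫ x, V x ∂(I.M.P h (s, a)) :=
  modelFun_eq_integral _ _ _ _ (hS.Ps_eq h hh s a) V

theorem Ps_mem_F (hS : Setting I δ La C₁ C₂ Ps) {h : ℕ} (hh : h < I.M.H) :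
    modelFun (Ps h) ∈ I.F h := ⟨Ps h, hS.Ps_mem h hh, rfl⟩

section

variable [mΩ : MeasurableSpace Ω] {μ : Measure Ω} {filt : Filtration (ℕ ×ₗ ℕ) mΩ}

theorem InRange.pt_mem_dom (hR : R.IsExecution I μ filt) {n : ℕ} (hn : n ≤ I.K)
    (h : InRange R I n ω) {j h' : ℕ} (hj : j < n) (hh : h' < I.M.H) :
    R.pt j h' ω ∈ dom S A I.M.H :=
  ⟨measurable_val hR (by omega) hh ω, h j hj (h' + 1) hh⟩

theorem fullSum_le_trunc (hS : Setting I δ La C₁ C₂ Ps) (hR : R.IsExecution I μ filt) {n h : ℕ}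
    (hn : n ≤ I.K) (hr : InRange R I n ω) (hh : h < I.M.H) {f g : Pt S A → ℝ} (hf : f ∈ I.F h)
    (hg : g ∈ I.F h) : fullSum R n h ω f g ≤ I.trunc := by
  have h1 : fullSum R n h ω f g ≤ ∑ j ∈ Finset.range n, ((I.M.H : ℝ) + 1) ^ 2 := by
    refine Finset.sum_le_sum fun j hj => ?_
    rw [← sq_abs]
    exact pow_le_pow_left₀ (abs_nonneg _)
      (hS.diam h hh f hf g hg _ (hr.pt_mem_dom hR hn (Finset.mem_range.1 hj) hh)) 2
  refine h1.trans ?_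
  rw [Finset.sum_const, Finset.card_range, nsmul_eq_mul]
  have h2 : (n : ℝ) ≤ (I.K : ℝ) * I.M.H := by
    have h3 : (n : ℝ) ≤ I.K := by exact_mod_cast hn
    exact h3.trans hS.K_le
  unfold Input.trunc
  gcongr

/-- The admissible increment size is proportional to the final sub-sampled sum, which is random;
therefore `GoodEvent.lower` holds simultaneously for all levels `m`, and the fitting one is chosen
afterwards. If the sub-sampled sum exceeds the truncation, the trivial bound on the full sum
suffices. -/
theorem fullSum_cover_le (hS : Setting I δ La C₁ C₂ Ps) (hR : R.IsExecution I μ filt)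
    (hG : GoodEvent R I δ La C₁ C₂ Ps ω) {n h : ℕ} (hn : n ≤ I.K) (hr : InRange R I n ω)
    (hh : h < I.M.H) {g₁ g₂ : Pt S A → ℝ} (hg₁ : g₁ ∈ C₂ h) (hg₂ : g₂ ∈ C₂ h) :
    fullSum R n h ω g₁ g₂ ≤ 3 * (subSum R I n h ω g₁ g₂ + I.β) := by
  have hβ : 976 ≤ I.β := hS.β_ge'
  have hlam := hS.lam_ge
  have hF₁ := hS.C₂_sub h hh hg₁
  have hF₂ := hS.C₂_sub h hh hg₂
  have hS0 := subSum_nonneg (R := R) (I := I) (ω := ω) n h g₁ g₂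
  rcases le_or_gt I.trunc (subSum R I n h ω g₁ g₂) with hbig | hsmall
  · have := fullSum_le_trunc hS hR hn hr hh hF₁ hF₂
    linarith
  set s := subSum R I n h ω g₁ g₂ with hs
  -- With `m β ≤ s < (m + 1) β`, the tail bound reads `fullSum / 2 < (m + 2) β / 16 + s`. Only
  -- finitely many `m` occur since `s` is below the truncation and `β ≥ 1`.
  set m := ⌊s / I.β⌋₊ with hm
  have hm1 : (m : ℝ) ≤ s / I.β := Nat.floor_le (by positivity)
  have hm2 : s / I.β < m + 1 := Nat.lt_floor_add_one _
  rw [le_div_iff₀ (by linarith)] at hm1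
  rw [div_lt_iff₀ (by linarith)] at hm2
  have hmB : m < I.K * I.M.H * (I.M.H + 1) ^ 2 := by
    have h1 : (m : ℝ) < I.trunc := by nlinarith
    unfold Input.trunc at h1
    exact_mod_cast h1
  have hgood := hG.lower h hh g₁ hg₁ g₂ hg₂ n hn m hmB fun k hk => by
    refine mem_goodSet hS hr hk hh hF₁ hF₂ ?_
    unfold Input.level
    have := subSum_mono (R := R) (I := I) (ω := ω) hk.le h g₁ g₂
    gcongr
    linarith
  have e1 : ∑ k ∈ Finset.range n, (g₁ (cpt R I k h ω) - g₂ (cpt R I k h ω)) ^ 2 / 2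
      = fullSum R n h ω g₁ g₂ / 2 := by
    rw [fullSum, Finset.sum_div]
    exact Finset.sum_congr rfl fun k hk => by rw [hr.cpt_eq (Finset.mem_range.1 hk) hh]
  have e2 : ∑ k ∈ Finset.range n, (R.coin k h).indicator (fun _ => (1 : ℝ)) ω
      * (numCopies R I k h ω * (g₁ (cpt R I k h ω) - g₂ (cpt R I k h ω)) ^ 2) = s :=
    Finset.sum_congr rfl fun k hk => by rw [hr.cpt_eq (Finset.mem_range.1 hk) hh]
  rw [e1, e2] at hgood
  have e3 : I.lam / 16 * I.level m = (m + 2) * I.β / 16 := by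
    unfold Input.level
    field_simp
  rw [e3] at hgood
  linarith

/-- On the good event the data norm is controlled by that of the sub-sampled dataset. -/
theorem fullSum_le (hS : Setting I δ La C₁ C₂ Ps) (hR : R.IsExecution I μ filt)
    (hG : GoodEvent R I δ La C₁ C₂ Ps ω) {n h : ℕ} (hn : n ≤ I.K) (hr : InRange R I n ω)
    (hh : h < I.M.H) {f₁ f₂ : Pt S A → ℝ} (hf₁ : f₁ ∈ I.F h) (hf₂ : f₂ ∈ I.F h) :
    fullSum R n h ω f₁ f₂ ≤ 12 * (subSum R I n h ω f₁ f₂ + I.β) := by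
  obtain ⟨g₁, hg₁, g₂, hg₂, hc⟩ := exists_cover_pair hS hh hf₁ hf₂
  set e := 2 * Real.sqrt (δ / (64 * I.T ^ 3)) with he
  have hc' : ∀ j < n, |(f₁ (R.pt j h ω) - f₂ (R.pt j h ω))
      - (g₁ (R.pt j h ω) - g₂ (R.pt j h ω))| ≤ e := fun j hj => hc _ (hr.pt_mem_dom hR hn hj hh)
  have hc'' : ∀ j < n, |(g₁ (R.pt j h ω) - g₂ (R.pt j h ω))
      - (f₁ (R.pt j h ω) - f₂ (R.pt j h ω))| ≤ e := fun j hj => by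
    rw [abs_sub_comm]; exact hc' j hj
  -- Passing to the cover and back doubles both sums and adds at most `1` each time: `2 * 3 (2 s + 1
  -- + β) + 1`, where the constants are absorbed by `β`.
  have h1 := fullSum_le_of_close hc'
  have h2 := subSum_le_of_close (I := I) hc''
  have h3 := fullSum_cover_le hS hR hG hn hr hh hg₁ hg₂
  obtain ⟨h4, h5⟩ := hS.resolution
  rw [← he] at h4 h5
  have h6 : (n : ℝ) * (2 * e ^ 2) ≤ 1 := by
    refine le_trans ?_ h5
    have : (n : ℝ) ≤ I.T := le_trans (by exact_mod_cast hn) hS.K_le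
    gcongr
  have h7 : (∑ j ∈ Finset.range n, (R.coin j h).indicator (fun _ => (1 : ℝ)) ω
        * numCopies R I j h ω) * (2 * e ^ 2) ≤ 1 := by
    refine le_trans ?_ h4
    gcongr
    exact sum_copies_le hG hn hh
  have h8 := hS.β_ge'
  linarith

/-- On the good event pairs that are close on all the data are close on the sub-sampled dataset. -/
theorem subSum_le (hS : Setting I δ La C₁ C₂ Ps) (hR : R.IsExecution I μ filt)
    (hG : GoodEvent R I δ La C₁ C₂ Ps ω) {n h : ℕ} (hn : n ≤ I.K) (hr : InRange R I n ω)
    (hh : h < I.M.H) {f₁ f₂ : Pt S A → ℝ} (hf₁ : f₁ ∈ I.F h) (hf₂ : f₂ ∈ I.F h)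
    (hA : fullSum R n h ω f₁ f₂ ≤ 26 + 4 * (I.M.H : ℝ) ^ 2 * La) :
    subSum R I n h ω f₁ f₂ ≤ I.β := by
  obtain ⟨g₁, hg₁, g₂, hg₂, hc⟩ := exists_cover_pair hS hh hf₁ hf₂
  set e := 2 * Real.sqrt (δ / (64 * I.T ^ 3)) with he
  have hc' : ∀ j < n, |(f₁ (R.pt j h ω) - f₂ (R.pt j h ω))
      - (g₁ (R.pt j h ω) - g₂ (R.pt j h ω))| ≤ e := fun j hj => hc _ (hr.pt_mem_dom hR hn hj hh)
  have hc'' : ∀ j < n, |(g₁ (R.pt j h ω) - g₂ (R.pt j h ω))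
      - (f₁ (R.pt j h ω) - f₂ (R.pt j h ω))| ≤ e := fun j hj => by
    rw [abs_sub_comm]; exact hc' j hj
  have h1 := fullSum_le_of_close hc''
  have h2 := subSum_le_of_close (I := I) hc'
  obtain ⟨h4, h5⟩ := hS.resolution
  rw [← he] at h4 h5
  have h6 : (n : ℝ) * (2 * e ^ 2) ≤ 1 := by
    refine le_trans ?_ h5
    have : (n : ℝ) ≤ I.T := le_trans (by exact_mod_cast hn) hS.K_le
    gcongr
  have h7 : (∑ j ∈ Finset.range n, (R.coin j h).indicator (fun _ => (1 : ℝ)) ω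
        * numCopies R I j h ω) * (2 * e ^ 2) ≤ 1 := by
    refine le_trans ?_ h4
    gcongr
    exact sum_copies_le hG hn hh
  have h8 := hS.β_ge'
  have h9 := hS.β_ge
  -- The full sum of the cover pair is at most `2 (26 + 4 H² La) + 1 ≤ 61 H² La`, and `16 * 61 =
  -- 976` is the constant in `β_ge`.
  have hq : 1 ≤ (I.M.H : ℝ) ^ 2 * La := by
    have h10 : 1 * 1 ≤ (I.M.H : ℝ) ^ 2 * La := by
      gcongr
      · exact one_le_pow₀ hS.H_ge
      · exact hS.La_ge
    linarith
  have h3 := subSum_cover_le hS hG hn hr hh hg₁ hg₂ (by linarith)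
  linarith

/-- On the good event the least-squares estimate is close to the truth on all the data. -/
theorem lsq_fullSum_le (hS : Setting I δ La C₁ C₂ Ps) (hR : R.IsExecution I μ filt)
    (hG : GoodEvent R I δ La C₁ C₂ Ps ω) {n h : ℕ} (hn : n < I.K) (hr : InRange R I n ω)
    (hh : h < I.M.H) {P : SignedKernel S A} (hP : P ∈ I.cP h)
    (hmin : R.loss n h ω P ≤ R.loss n h ω (Ps h)) :
    fullSum R n h ω (modelFun P) (modelFun (Ps h)) ≤ 26 + 4 * (I.M.H : ℝ) ^ 2 * La := by
  have hT := hS.two_le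
  have hH := hS.H_ge
  have hPF : modelFun P ∈ I.F h := ⟨P, hP, rfl⟩
  have hPsF := Ps_mem_F hS hh
  obtain ⟨g, hg, hgc⟩ := hS.C₁_cover h hh (modelFun P) hPF
  have hgF := hS.C₁_sub h hh hg
  have hdom : ∀ j < n, R.pt j h ω ∈ dom S A I.M.H := fun j hj => hr.pt_mem_dom hR hn.le hj hh
  set H : ℝ := (I.M.H : ℝ) with hHdef
  set F : ℕ → ℝ := fun j => modelFun P (R.pt j h ω) with hF
  set Fs : ℕ → ℝ := fun j => modelFun (Ps h) (R.pt j h ω) with hFs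
  set G : ℕ → ℝ := fun j => g (R.pt j h ω) with hGd
  set y : ℕ → ℝ := fun j => R.val j (h + 1) ω (R.state j (h + 1) ω) with hy
  have hyb : ∀ j < n, y j ∈ Set.Icc 0 H := fun j hj => hr j hj (h + 1) hh _
  have hFsb : ∀ j < n, Fs j ∈ Set.Icc 0 H := fun j hj => by
    have h1 : Fs j = ∫ x, R.val j (h + 1) ω x ∂(I.M.P h (R.state j h ω, R.act j h ω)) :=
      modelFun_Ps hS hh _ _ _
    rw [h1]
    exact integral_mem_Icc (measurable_val hR (by omega) hh ω) (hr j hj (h + 1) hh)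
  have hFb : ∀ j < n, |F j - Fs j| ≤ H + 1 := fun j hj =>
    hS.diam h hh _ hPF _ hPsF _ (hdom j hj)
  have hGb : ∀ j < n, |G j - Fs j| ≤ H + 1 := fun j hj =>
    hS.diam h hh _ hgF _ hPsF _ (hdom j hj)
  have hFG : ∀ j < n, |F j - G j| ≤ 1 / I.T := fun j hj => hgc _ (hdom j hj)
  have hlsq := hG.lsq h hh g hg n hn
  -- The weight `2 (g - f*) / H²` is chosen so that each term becomes minus the excess loss plus
  -- half of the squared distance, divided by `H²`: the compensator uses up only half of the square.
  have e1 : ∀ j ∈ Finset.range n,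
      (2 * (g (cpt R I j h ω) - modelFun (Ps h) (cpt R I j h ω)) / H ^ 2
        * (cval R I j (h + 1) ω (R.state j (h + 1) ω)
          - ∫ s, cval R I j (h + 1) ω s ∂(I.M.P h (R.state j h ω, R.act j h ω)))
        - (2 * (g (cpt R I j h ω) - modelFun (Ps h) (cpt R I j h ω)) / H ^ 2) ^ 2
          * H ^ 2 / 8)
      = (-((G j - y j) ^ 2 - (Fs j - y j) ^ 2) + (G j - Fs j) ^ 2 / 2) / H ^ 2 := by
    intro j hj
    have hj' := Finset.mem_range.1 hj
    have h1 : ∫ s, cval R I j (h + 1) ω s ∂(I.M.P h (R.state j h ω, R.act j h ω)) = Fs j := by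
      rw [hr.cval_eq hj' hh]
      exact (modelFun_Ps hS hh _ _ _).symm
    rw [h1, hr.cval_eq hj' hh, hr.cpt_eq hj' hh]
    change 2 * (G j - Fs j) / H ^ 2 * (y j - Fs j) - (2 * (G j - Fs j) / H ^ 2) ^ 2 * H ^ 2 / 8 = _
    field_simp
    ring
  rw [Finset.sum_congr rfl e1, ← Finset.sum_div, div_lt_iff₀ (by positivity),
    Finset.sum_add_distrib, Finset.sum_neg_distrib] at hlsq
  have hloss : ∑ j ∈ Finset.range n, ((F j - y j) ^ 2 - (Fs j - y j) ^ 2) ≤ 0 := by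
    rw [Finset.sum_sub_distrib]
    exact sub_nonpos.2 hmin
  -- The minimiser depends on the data, while the event concerns fixed elements of the cover. The
  -- exchange costs at most `6 H / T` per term, hence `6` in total.
  have hswap : ∀ j ∈ Finset.range n, (G j - y j) ^ 2 - (Fs j - y j) ^ 2
      ≤ (F j - y j) ^ 2 - (Fs j - y j) ^ 2 + 6 * H / I.T := by
    intro j hj
    have hj' := Finset.mem_range.1 hj
    have h1 : (G j - y j) ^ 2 - (F j - y j) ^ 2 = (G j - F j) * ((G j - y j) + (F j - y j)) := by
      ring
    have hyj := hyb j hj'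
    have hfj := hFsb j hj'
    have hsy : |Fs j - y j| ≤ H := abs_le.2 ⟨by linarith [hyj.2, hfj.1], by linarith [hyj.1, hfj.2]⟩
    have h2 : |G j - y j| ≤ 2 * H + 1 := by
      have := abs_add_le (G j - Fs j) (Fs j - y j)
      rw [sub_add_sub_cancel] at this
      linarith [hGb j hj']
    have h3 : |F j - y j| ≤ 2 * H + 1 := by
      have := abs_add_le (F j - Fs j) (Fs j - y j)
      rw [sub_add_sub_cancel] at this
      linarith [hFb j hj']
    have h4 : |(G j - F j) * ((G j - y j) + (F j - y j))| ≤ 1 / I.T * (6 * H) := by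
      rw [abs_mul]
      gcongr
      · rw [abs_sub_comm]; exact hFG j hj'
      · have := abs_add_le (G j - y j) (F j - y j)
        linarith
    have h5 := (abs_le.1 h4).2
    have h6 : 1 / I.T * (6 * H) = 6 * H / I.T := by ring
    linarith
  have hsum := Finset.sum_le_sum hswap
  rw [Finset.sum_add_distrib, Finset.sum_const, Finset.card_range, nsmul_eq_mul] at hsum
  have hnT : (n : ℝ) * (6 * H / I.T) ≤ 6 := by
    have h1 : (n : ℝ) * H ≤ I.T := by
      unfold Input.T
      have : (n : ℝ) ≤ I.K := by exact_mod_cast hn.le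
      gcongr
    rw [mul_div_assoc', div_le_iff₀ (by linarith)]
    linarith
  have hG2 : ∑ j ∈ Finset.range n, (G j - Fs j) ^ 2 ≤ 12 + 2 * H ^ 2 * La := by
    rw [← Finset.sum_div] at hlsq
    linarith
  have hfin : ∀ j ∈ Finset.range n, (F j - Fs j) ^ 2 ≤ 2 * (G j - Fs j) ^ 2 + 2 * (1 / I.T) ^ 2 := by
    intro j hj
    refine sq_le_of_abs_sub_le ?_
    have : F j - Fs j - (G j - Fs j) = F j - G j := by ring
    rw [this]
    exact hFG j (Finset.mem_range.1 hj)
  have hfs := Finset.sum_le_sum hfin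
  rw [Finset.sum_add_distrib, ← Finset.mul_sum, Finset.sum_const, Finset.card_range,
    nsmul_eq_mul] at hfs
  have hnT2 : (n : ℝ) * (2 * (1 / I.T) ^ 2) ≤ 2 := by
    have h1 : (n : ℝ) ≤ I.T := le_trans (by exact_mod_cast hn.le) hS.K_le
    have h2 : I.T * (2 * (1 / I.T) ^ 2) = 2 / I.T := by field_simp
    have h3 : 2 / I.T ≤ 2 := by rw [div_le_iff₀ (by linarith)]; linarith
    calc _ ≤ I.T * (2 * (1 / I.T) ^ 2) := by gcongr
      _ ≤ 2 := by rw [h2]; exact h3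
  change ∑ j ∈ Finset.range n, (F j - Fs j) ^ 2 ≤ _
  linarith

end

end GoodEvents

/-! ### Optimism and boundedness of the value estimates. -/

section Optimism

/-- The bonus may be infinite at points where the class is not known to be bounded; then only the
cap remains. -/
theorem toReal_min_add (x H : ℝ) (b : ℝ≥0∞) :
    (min ((x : EReal) + (b : EReal)) (H : EReal)).toReal
      = if b = ∞ then H else min (x + b.toReal) H := by
  split_ifs with hb
  · subst hb
    simp
  · lift b to NNReal using hb
    have h1 : (x : EReal) + ((b : ℝ≥0∞) : EReal) = ((x + b : ℝ) : EReal) := by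
      rw [EReal.coe_add]; rfl
    rw [h1]
    rcases le_total (x + b) H with h | h
    · rw [min_eq_left (by exact_mod_cast h), EReal.toReal_coe]
      simp [h]
    · rw [min_eq_right (by exact_mod_cast h), EReal.toReal_coe]
      simp [h]

variable {S A Ω : Type*} [MeasurableSpace S] [MeasurableSpace A]
  {R : Interaction S A Ω} {I : Input S A} {δ La : ℝ} {C₁ C₂ : ℕ → Finset (Pt S A → ℝ)}
  {Ps : ℕ → SignedKernel S A} {ω : Ω} {πs : ℕ → S → A}

theorem qEst_le_H (k h : ℕ) (s : S) (a : A) : R.qEst I k h ω s a ≤ I.M.H := by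
  unfold Interaction.qEst
  rw [toReal_min_add]
  split_ifs
  · exact le_rfl
  · exact min_le_right _ _

theorem le_qEst {k h : ℕ} {s : S} {a : A} {e y : ℝ} (he : ENNReal.ofReal e
      ≤ I.bonus h (R.dataset I k h ω) (s, a, R.val k (h + 1) ω))
    (hy : y ≤ I.M.r h s a + modelFun (R.model k h ω) (s, a, R.val k (h + 1) ω) + e)
    (hyH : y ≤ I.M.H) : y ≤ R.qEst I k h ω s a := by
  unfold Interaction.qEst
  rw [toReal_min_add]
  split_ifs with hb
  · exact hyH
  · refine le_min (hy.trans ?_) hyH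
    have := (ENNReal.ofReal_le_iff_le_toReal hb).1 he
    linarith

theorem qEst_le {k h : ℕ} {s : S} {a : A}
    (hb : I.bonus h (R.dataset I k h ω) (s, a, R.val k (h + 1) ω) ≠ ∞) :
    R.qEst I k h ω s a ≤ I.M.r h s a + modelFun (R.model k h ω) (s, a, R.val k (h + 1) ω)
      + (I.bonus h (R.dataset I k h ω) (s, a, R.val k (h + 1) ω)).toReal := by
  unfold Interaction.qEst
  rw [toReal_min_add, if_neg hb]
  exact min_le_left _ _

theorem le_bonus {h : ℕ} {Z : Multiset (Pt S A)} {f g : Pt S A → ℝ} (hf : f ∈ I.F h)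
    (hg : g ∈ I.F h) (hn : min (dataNorm Z (f - g) ^ 2) I.trunc ≤ I.β) (z : Pt S A) :
    ENNReal.ofReal |f z - g z| ≤ I.bonus h Z z :=
  le_iSup₂_of_le (f := fun f₁ (_ : f₁ ∈ I.F h) => ⨆ f₂ ∈ I.F h,
    ⨆ (_ : min (dataNorm Z (f₁ - f₂) ^ 2) I.trunc ≤ I.β), ENNReal.ofReal |f₁ z - f₂ z|) f hf
    (le_iSup₂_of_le (f := fun f₂ (_ : f₂ ∈ I.F h) =>
      ⨆ (_ : min (dataNorm Z (f - f₂) ^ 2) I.trunc ≤ I.β), ENNReal.ofReal |f z - f₂ z|) g hg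
      (le_iSup_of_le hn le_rfl))

theorem bonus_le {h : ℕ} {Z : Multiset (Pt S A)} {z : Pt S A} {c : ℝ}
    (hc : ∀ f ∈ I.F h, ∀ g ∈ I.F h, |f z - g z| ≤ c) : I.bonus h Z z ≤ ENNReal.ofReal c :=
  iSup₂_le fun f hf => iSup₂_le fun g hg => iSup_le fun _ =>
    ENNReal.ofReal_le_ofReal (hc f hf g hg)

theorem exists_of_lt_bonus {h : ℕ} {Z : Multiset (Pt S A)} {z : Pt S A} {x : ℝ} (hx0 : 0 ≤ x)
    (hx : x < (I.bonus h Z z).toReal) : ∃ f ∈ I.F h, ∃ g ∈ I.F h, x < |f z - g z| ∧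
      min (dataNorm Z (f - g) ^ 2) I.trunc ≤ I.β := by
  have h1 : ENNReal.ofReal x < I.bonus h Z z :=
    (ENNReal.ofReal_lt_ofReal_iff_of_nonneg hx0).2 hx |>.trans_le ENNReal.ofReal_toReal_le
  unfold Input.bonus at h1
  simp only [lt_iSup_iff] at h1
  obtain ⟨f, hf, g, hg, hn, h2⟩ := h1
  exact ⟨f, hf, g, hg, (ENNReal.ofReal_lt_ofReal_iff_of_nonneg hx0).1 h2, hn⟩

/-- The bonus at the point `z_h^k`. -/
noncomputable def bon (R : Interaction S A Ω) (I : Input S A) (k h : ℕ) (ω : Ω) (s : S) (a : A) :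
    ℝ :=
  (I.bonus h (R.dataset I k h ω) (s, a, R.val k (h + 1) ω)).toReal

theorem bon_le {c : ℝ} (hc0 : 0 ≤ c) {k h : ℕ} {s : S} {a : A}
    (hc : ∀ f ∈ I.F h, ∀ g ∈ I.F h,
      |f (s, a, R.val k (h + 1) ω) - g (s, a, R.val k (h + 1) ω)| ≤ c) :
    bon R I k h ω s a ≤ c := by
  unfold bon
  exact ENNReal.toReal_le_of_le_ofReal hc0 (bonus_le hc)

variable [mΩ : MeasurableSpace Ω] {μ : Measure Ω} {filt : Filtration (ℕ ×ₗ ℕ) mΩ}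

theorem ofReal_model_error_le_bonus (hS : Setting I δ La C₁ C₂ Ps) (hR : R.IsExecution I μ filt)
    (hG : GoodEvent R I δ La C₁ C₂ Ps ω) {k : ℕ} (hk : k < I.K) (hr : InRange R I k ω)
    (hu : R.lastUpdate I k ω = k) {h : ℕ} (hh : h < I.M.H) (z : Pt S A) :
    ENNReal.ofReal |modelFun (R.model k h ω) z - modelFun (Ps h) z|
      ≤ I.bonus h (R.dataset I k h ω) z := by
  have hP := hR.model_mem k hk ω hu h hh
  refine le_bonus ⟨_, hP, rfl⟩ (Ps_mem_F hS hh) ((min_le_left _ _).trans ?_) z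
  rw [dataNorm_sub_sq]
  exact subSum_le hS hR hG hk.le hr hh ⟨_, hP, rfl⟩ (Ps_mem_F hS hh)
    (lsq_fullSum_le hS hR hG hk hr hh hP (hR.model_min k hk ω hu h hh _ (hS.Ps_mem h hh)))

/-- Optimism, and boundedness of the value estimates, in an episode with recomputation. -/
theorem optimism_step (hS : Setting I δ La C₁ C₂ Ps) (hR : R.IsExecution I μ filt)
    (hs : I.M.IsOptimal πs)
    (hG : GoodEvent R I δ La C₁ C₂ Ps ω) {k : ℕ} (hk : k < I.K) (hr : InRange R I k ω)
    (hu : R.lastUpdate I k ω = k) (n : ℕ) : ∀ h, h + n = I.M.H → ∀ s,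
      R.val k h ω s ∈ Set.Icc (0 : ℝ) I.M.H ∧ I.M.V πs h s ≤ R.val k h ω s := by
  have hm : ∀ h < I.M.H, Measurable (πs h) := fun h _ => hs.1 h
  induction n with
  | zero =>
    intro h hh s
    obtain rfl : h = I.M.H := by omega
    rw [hR.val_last k hk ω hu s, V_last]
    exact ⟨⟨le_rfl, Nat.cast_nonneg _⟩, le_rfl⟩
  | succ n ih =>
    intro h hh s
    have hlt : h < I.M.H := by omega
    have ih' := ih (h + 1) (by omega)
    have hvm := measurable_val hR hk (Nat.succ_le_of_lt hlt) ω
    -- Used twice: with `y = 0` for nonnegativity, which is not automatic for a signed model, and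
    -- with `y` the optimal value for optimism.
    have key : ∀ a, ∀ y ≤ (I.M.H : ℝ),
        y ≤ I.M.r h s a + ∫ x, R.val k (h + 1) ω x ∂(I.M.P h (s, a)) →
        y ≤ R.qEst I k h ω s a := by
      intro a y hyH hy
      refine le_qEst (ofReal_model_error_le_bonus hS hR hG hk hr hu hlt _) ?_ hyH
      have h1 := modelFun_Ps hS hlt s a (R.val k (h + 1) ω)
      have h2 := neg_abs_le (modelFun (R.model k h ω) (s, a, R.val k (h + 1) ω)
        - modelFun (Ps h) (s, a, R.val k (h + 1) ω))
      linarith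
    rw [hR.val_eq k hk ω hu h hlt s]
    have hint : ∀ a, 0 ≤ ∫ x, R.val k (h + 1) ω x ∂(I.M.P h (s, a)) := fun a =>
      (integral_mem_Icc hvm fun x => (ih' x).1).1
    refine ⟨⟨?_, qEst_le_H k h s _⟩, ?_⟩
    · refine key _ 0 (Nat.cast_nonneg _) ?_
      linarith [hint (R.policy k h ω s), (I.M.r_mem h s (R.policy k h ω s)).1]
    · refine le_trans ?_ (hR.greedy k hk ω hu h hlt s (πs h s))
      refine key _ _ (V_mem_Icc I.M hm hlt.le s).2 ?_
      rw [V_bellman I.M hm hlt]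
      have := integral_mono (μ := I.M.P h (s, πs h s))
        (integrable_of_bounds (measurable_V I.M hm hlt) fun x => V_mem_Icc I.M hm hlt x)
        (integrable_of_bounds hvm fun x => (ih' x).1) fun x => (ih' x).2
      linarith

/-- The good event speaks of truncated values, so it says something about an episode only once all
earlier episodes are known to be in range; hence the induction over episodes, each step referring to
the last recomputation. -/
theorem inRange (hS : Setting I δ La C₁ C₂ Ps) (hR : R.IsExecution I μ filt)
    (hs : I.M.IsOptimal πs)
    (hG : GoodEvent R I δ La C₁ C₂ Ps ω) {n : ℕ} (hn : n ≤ I.K) : InRange R I n ω := by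
  induction n with
  | zero => intro j hj; omega
  | succ n ih =>
    have ih' := ih (by omega)
    intro j hj h hh s
    rcases Nat.lt_or_ge j n with hjn | hjn
    · exact ih' j hjn h hh s
    obtain rfl : j = n := by omega
    have hle := lastUpdate_le R I j ω
    rw [hR.val_keep j (by omega) ω h hh]
    exact (optimism_step hS hR hs hG (by omega) (ih'.mono hle) (lastUpdate_idem R I j ω)
      (I.M.H - h) h (by omega) s).1

theorem V_le_val (hS : Setting I δ La C₁ C₂ Ps) (hR : R.IsExecution I μ filt)
    (hs : I.M.IsOptimal πs)
    (hG : GoodEvent R I δ La C₁ C₂ Ps ω) {k h : ℕ} (hk : k < I.K) (hh : h ≤ I.M.H) (s : S) :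
    I.M.V πs h s ≤ R.val k h ω s := by
  have hle := lastUpdate_le R I k ω
  rw [hR.val_keep k hk ω h hh]
  exact (optimism_step hS hR hs hG (by omega) (inRange hS hR hs hG (by omega))
    (lastUpdate_idem R I k ω) (I.M.H - h) h (by omega) s).2

theorem val_last_eq (hR : R.IsExecution I μ filt) {k : ℕ} (hk : k < I.K) (s : S) :
    R.val k I.M.H ω s = 0 := by
  have hle := lastUpdate_le R I k ω
  rw [hR.val_keep k hk ω _ le_rfl]
  exact hR.val_last _ (by omega) ω (lastUpdate_idem R I k ω) s

theorem mem_dom_of_inRange (hR : R.IsExecution I μ filt) (hr : InRange R I I.K ω) {k h : ℕ}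
    (hk : k < I.K) (hh : h < I.M.H) (s : S) (a : A) :
    ((s, a, R.val k (h + 1) ω) : Pt S A) ∈ dom S A I.M.H :=
  ⟨measurable_val hR hk hh ω, hr k hk (h + 1) hh⟩

/-- One bonus is part of the estimate, the other one bounds the model error. All quantities are
those of the last recomputation, where the least-squares property holds. -/
theorem val_le (hS : Setting I δ La C₁ C₂ Ps) (hR : R.IsExecution I μ filt)
    (hs : I.M.IsOptimal πs)
    (hG : GoodEvent R I δ La C₁ C₂ Ps ω) {k h : ℕ} (hk : k < I.K) (hh : h < I.M.H) (s : S) :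
    R.val k h ω s ≤ I.M.r h s (R.policy k h ω s)
      + ∫ x, R.val k (h + 1) ω x ∂(I.M.P h (s, R.policy k h ω s))
      + 2 * bon R I k h ω s (R.policy k h ω s) := by
  have hle := lastUpdate_le R I k ω
  have hr := inRange hS hR hs hG le_rfl
  set k' := R.lastUpdate I k ω with hk'
  have hk'K : k' < I.K := by omega
  have hu : R.lastUpdate I k' ω = k' := lastUpdate_idem R I k ω
  have hbon : ∀ a, bon R I k h ω s a = bon R I k' h ω s a := by
    intro a
    unfold bon
    rw [hR.val_keep k hk ω (h + 1) hh, hk', dataset_lastUpdate R I k ω hh]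
  rw [hR.val_keep k hk ω h hh.le, hR.val_keep k hk ω (h + 1) hh, hR.policy_keep k hk ω h hh,
    hbon, ← hk', hR.val_eq k' hk'K ω hu h hh s]
  set a := R.policy k' h ω s
  have hdom := mem_dom_of_inRange hR hr hk'K hh s a
  have hfin : I.bonus h (R.dataset I k' h ω) (s, a, R.val k' (h + 1) ω) ≠ ∞ :=
    ne_top_of_le_ne_top ENNReal.ofReal_ne_top (bonus_le fun f hf g hg => hS.diam h hh f hf g hg _ hdom)
  have h1 := qEst_le hfin
  have h2 := ofReal_model_error_le_bonus hS hR hG hk'K (hr.mono hk'K.le) hu hh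
    (s, a, R.val k' (h + 1) ω)
  rw [ENNReal.ofReal_le_iff_le_toReal hfin, modelFun_Ps hS hh] at h2
  have h3 := le_abs_self (modelFun (R.model k' h ω) (s, a, R.val k' (h + 1) ω)
    - ∫ x, R.val k' (h + 1) ω x ∂(I.M.P h (s, a)))
  unfold bon
  linarith

theorem gap_le_bon_add (hS : Setting I δ La C₁ C₂ Ps) (hR : R.IsExecution I μ filt)
    (hs : I.M.IsOptimal πs) (hG : GoodEvent R I δ La C₁ C₂ Ps ω) {k h : ℕ} (hk : k < I.K)
    (hh : h < I.M.H) (s : S) :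
    R.val k h ω s - I.M.V πs h s + I.M.gap πs h s (R.policy k h ω s)
      ≤ 2 * bon R I k h ω s (R.policy k h ω s)
        + ∫ x, (R.val k (h + 1) ω x - I.M.V πs (h + 1) x) ∂(I.M.P h (s, R.policy k h ω s)) := by
  have hm : ∀ h < I.M.H, Measurable (πs h) := fun h _ => hs.1 h
  have hr := inRange hS hR hs hG le_rfl
  rw [integral_sub (integrable_of_bounds (measurable_val hR hk hh ω) (hr k hk (h + 1) hh))
    (integrable_of_bounds (measurable_V I.M hm hh) fun x => V_mem_Icc I.M hm hh x),
    MDP.gap, Q_eq I.M hm hh]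
  have := val_le hS hR hs hG hk hh s
  linarith

/-- If all functions agree up to `w`, then every episode has regret at most `2 H w`. -/
theorem subopt_le_of_diam (hS : Setting I δ La C₁ C₂ Ps) (hR : R.IsExecution I μ filt)
    (hs : I.M.IsOptimal πs) (hG : GoodEvent R I δ La C₁ C₂ Ps ω) {w : ℝ} (hw : 0 ≤ w)
    (hF : ∀ h < I.M.H, ∀ f ∈ I.F h, ∀ g ∈ I.F h, ∀ z ∈ dom S A I.M.H, |f z - g z| ≤ w)
    {k : ℕ} (hk : k < I.K) :
    subopt I.M πs (fun h => R.policy k h ω) 0 I.M.s₁ ≤ I.M.H * (2 * w) := by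
  have hr := inRange hS hR hs hG le_rfl
  have hpm := measurable_policy hR hk ω
  have key : ∀ n h, h + n = I.M.H → ∀ s,
      R.val k h ω s - I.M.V (fun h => R.policy k h ω) h s ≤ n * (2 * w) := by
    intro n
    induction n with
    | zero =>
      intro h hh s
      obtain rfl : h = I.M.H := by omega
      rw [val_last_eq hR hk, V_last]; simp
    | succ n ih =>
      intro h hh s
      have hlt : h < I.M.H := by omega
      rw [V_bellman I.M hpm hlt]
      have h1 := val_le hS hR hs hG hk hlt s
      have h2 : bon R I k h ω s (R.policy k h ω s) ≤ w := bon_le hw fun f hf g hg =>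
        hF h hlt f hf g hg _ (mem_dom_of_inRange hR hr hk hlt s _)
      have h3 : ∫ x, R.val k (h + 1) ω x ∂(I.M.P h (s, R.policy k h ω s))
          - ∫ x, I.M.V (fun h => R.policy k h ω) (h + 1) x ∂(I.M.P h (s, R.policy k h ω s))
          ≤ n * (2 * w) := by
        have hi1 := integrable_of_bounds (ν := I.M.P h (s, R.policy k h ω s))
          (measurable_val hR hk hlt ω) (hr k hk (h + 1) hlt)
        have hi2 := integrable_of_bounds (ν := I.M.P h (s, R.policy k h ω s))
          (measurable_V I.M hpm hlt) fun x => V_mem_Icc I.M hpm hlt x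
        rw [← integral_sub hi1 hi2]
        have := integral_mono (hi1.sub hi2) (integrable_const ((n : ℝ) * (2 * w)))
          fun x => ih (h + 1) (by omega) x
        simpa using this
      push_cast
      linarith
  have h1 := key I.M.H 0 (by omega) I.M.s₁
  have h2 := V_le_val hS hR hs hG hk (Nat.zero_le _) I.M.s₁
  unfold subopt
  linarith

end Optimism

/-! ### Counting large bonuses and large gaps on the good event. -/

section Deterministic

variable {S A Ω : Type*} [MeasurableSpace S] [MeasurableSpace A]
  {R : Interaction S A Ω} {I : Input S A} {δ La : ℝ} {C₁ C₂ : ℕ → Finset (Pt S A → ℝ)}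
  {Ps : ℕ → SignedKernel S A} {ω : Ω} {πs : ℕ → S → A}

/-- The overestimation of the optimal value, truncated to `[0, H]`. -/
noncomputable def excess (R : Interaction S A Ω) (I : Input S A) (πs : ℕ → S → A) (k h : ℕ)
    (q : Ω × S) : ℝ :=
  max 0 (min (I.M.H : ℝ) (R.val k h q.1 q.2 - I.M.V πs h q.2))

theorem excess_mem_Icc (k h : ℕ) (q : Ω × S) :
    excess R I πs k h q ∈ Set.Icc (0 : ℝ) I.M.H :=
  ⟨le_max_left _ _, max_le (Nat.cast_nonneg _) (min_le_left _ _)⟩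

open Classical in
/-- The weight by which the transition noise of step `h` in episode `k` is multiplied when the
episodes with a gap larger than `ε` at step `h₀` are counted. -/
noncomputable def noiseWeight (R : Interaction S A Ω) (I : Input S A) (πs : ℕ → S → A) (h₀ : ℕ)
    (ε : ℝ) (k h : ℕ) (ω : Ω) : ℝ :=
  if h₀ ≤ h ∧ ε < I.M.gap πs h₀ (R.state k h₀ ω) (R.act k h₀ ω) then -(2 * ε / (I.M.H : ℝ) ^ 3)
  else 0

/-- The accumulated transition noise in the episodes with a gap larger than `ε` at step `h₀`. -/
noncomputable def noiseSum (R : Interaction S A Ω) (I : Input S A) (πs : ℕ → S → A) (h₀ : ℕ)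
    (ε : ℝ) (ω : Ω) : ℝ :=
  ∑ k ∈ Finset.range I.K, ∑ h ∈ Finset.range I.M.H,
    (noiseWeight R I πs h₀ ε k h ω * (excess R I πs k (h + 1) (ω, R.state k (h + 1) ω)
      - ∫ s, excess R I πs k (h + 1) (ω, s) ∂(I.M.P h (R.state k h ω, R.act k h ω)))
      - noiseWeight R I πs h₀ ε k h ω ^ 2 * (I.M.H : ℝ) ^ 2 / 8)

/-- The weight vanishes outside `J` and before step `h₀`; where it does not, its compensator `(2 ε /
H³)² H² / 8` is `ε² / (2 H⁴)`. -/
theorem noiseSum_eq (h₀ : ℕ) (hH : 0 < I.M.H) (ε : ℝ) (J : Finset ℕ)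
    (hJ : ∀ k, k ∈ J ↔ k < I.K ∧ ε < I.M.gap πs h₀ (R.state k h₀ ω) (R.act k h₀ ω)) :
    noiseSum R I πs h₀ ε ω = ∑ k ∈ J, ∑ h ∈ Finset.Ico h₀ I.M.H,
      (-(2 * ε / (I.M.H : ℝ) ^ 3) * (excess R I πs k (h + 1) (ω, R.state k (h + 1) ω)
        - ∫ s, excess R I πs k (h + 1) (ω, s) ∂(I.M.P h (R.state k h ω, R.act k h ω)))
        - ε ^ 2 / (2 * (I.M.H : ℝ) ^ 4)) := by
  have hH' : (0 : ℝ) < I.M.H := by exact_mod_cast hH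
  unfold noiseSum
  symm
  refine Finset.sum_subset_zero_on_sdiff (fun k hk => Finset.mem_range.2 ((hJ k).1 hk).1)
    (fun k hk => ?_) fun k hk => ?_
  · rw [Finset.mem_sdiff, Finset.mem_range, hJ, not_and] at hk
    refine Finset.sum_eq_zero fun h _ => ?_
    rw [noiseWeight, if_neg fun hc => hk.2 hk.1 hc.2]
    ring
  · refine Finset.sum_subset_zero_on_sdiff (fun h hh => Finset.mem_range.2
      (Finset.mem_Ico.1 hh).2) (fun h hh => ?_) fun h hh => ?_
    · rw [Finset.mem_sdiff, Finset.mem_range, Finset.mem_Ico] at hh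
      rw [noiseWeight, if_neg fun hc => hh.2 ⟨hc.1, hh.1⟩]
      ring
    · rw [noiseWeight, if_pos ⟨(Finset.mem_Ico.1 hh).1, ((hJ k).1 hk).2⟩]
      congr 1
      field_simp
      ring

variable [mΩ : MeasurableSpace Ω] {μ : Measure Ω} {filt : Filtration (ℕ ×ₗ ℕ) mΩ}

/-- Either the sub-sampled sum is at most `β`, or the truncation itself is, and that bounds the full
sum trivially. -/
theorem fullSum_le_of_min_le (hS : Setting I δ La C₁ C₂ Ps) (hR : R.IsExecution I μ filt)
    (hG : GoodEvent R I δ La C₁ C₂ Ps ω) {n h : ℕ} (hn : n ≤ I.K) (hr : InRange R I n ω)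
    (hh : h < I.M.H) {f g : Pt S A → ℝ} (hf : f ∈ I.F h) (hg : g ∈ I.F h)
    (hle : min (dataNorm (R.dataset I n h ω) (f - g) ^ 2) I.trunc ≤ I.β) :
    fullSum R n h ω f g ≤ 24 * I.β := by
  have hβ := hS.β_ge'
  rcases min_le_iff.1 hle with h1 | h1
  · rw [dataNorm_sub_sq] at h1
    linarith [fullSum_le hS hR hG hn hr hh hf hg]
  · linarith [fullSum_le_trunc hS hR hn hr hh hf hg]

theorem card_large_bon_le (hS : Setting I δ La C₁ C₂ Ps) (hR : R.IsExecution I μ filt)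
    (hs : I.M.IsOptimal πs) (hG : GoodEvent R I δ La C₁ C₂ Ps ω) {h d : ℕ} (hh : h < I.M.H)
    (hd : eluderDim (I.F h) (dom S A I.M.H) (1 / I.T) ≤ d) {x : ℝ} (hx : 1 / I.T ≤ x)
    (J : Finset ℕ) (hJ : J ⊆ Finset.range I.K) :
    ((J.filter fun k => x < bon R I k h ω (R.state k h ω) (R.act k h ω)).card : ℝ)
      ≤ (24 * I.β / x ^ 2 + 1) * d := by
  have hr := inRange hS hR hs hG le_rfl
  have hT := hS.two_le
  have hx0 : 0 < x := lt_of_lt_of_le (by positivity) hx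
  have hK : ∀ k ∈ J.filter fun k => x < bon R I k h ω (R.state k h ω) (R.act k h ω),
      k < I.K ∧ x < bon R I k h ω (R.state k h ω) (R.act k h ω) := fun k hk =>
    ⟨Finset.mem_range.1 (hJ (Finset.mem_filter.1 hk).1), (Finset.mem_filter.1 hk).2⟩
  refine card_le_of_separated hd hx hx0 (by linarith [hS.β_ge']) _ (fun k => R.pt k h ω)
    (fun k hk => hr.pt_mem_dom hR le_rfl (hK k hk).1 hh) fun k hk => ?_
  obtain ⟨f, hf, g, hg, hfg, hn⟩ := exists_of_lt_bonus hx0.le (hK k hk).2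
  exact ⟨f, hf, g, hg, hfg, fullSum_le_of_min_le hS hR hG (hK k hk).1.le (hr.mono (hK k hk).1.le)
    hh hf hg hn⟩

theorem sum_sensitivity_le (hS : Setting I δ La C₁ C₂ Ps) (hR : R.IsExecution I μ filt)
    (hs : I.M.IsOptimal πs) (hG : GoodEvent R I δ La C₁ C₂ Ps ω) (hK : 1 ≤ I.K) {h d : ℕ}
    (hh : h < I.M.H) (hd : eluderDim (I.F h) (dom S A I.M.H) (1 / I.T) ≤ d) :
    ∑ k ∈ Finset.range I.K,
      sensitivity (I.F h) I.trunc I.β (R.dataset I k h ω) (R.pt k h ω)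
      ≤ 5000 * (max 1 (d : ℝ) * Real.log I.T ^ 2) := by
  have hr := inRange hS hR hs hG le_rfl
  have hT := hS.two_le
  have hβ := hS.β_ge'
  refine sum_sens_le hd hT hK hS.K_le (by linarith) (fun k => R.pt k h ω) _
    (fun k hk => hr.pt_mem_dom hR le_rfl hk hh) (fun k _ => sensitivity_le_one)
    (fun f hf g hg z hz => ?_) fun k hk hpos => ?_
  · refine (hS.diam h hh f hf g hg z hz).trans ?_
    have h1 : (I.M.H : ℝ) ≤ I.T := by
      unfold Input.T
      have : (1 : ℝ) ≤ I.K := by exact_mod_cast hK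
      nlinarith [hS.H_ge]
    nlinarith
  · obtain ⟨f, hf, g, hg, hle⟩ := exists_of_sensitivity_pos hpos
    refine ⟨f, hf, g, hg, hle.trans ?_⟩
    rw [dataNorm_sub_sq]
    change _ ≤ 26 * (f (R.pt k h ω) - g (R.pt k h ω)) ^ 2 / (fullSum R k h ω f g + I.β)
    have h1 := fullSum_le hS hR hG hk.le (hr.mono hk.le) hh hf hg
    have h2 := fullSum_le_trunc hS hR hk.le (hr.mono hk.le) hh hf hg
    have h3 := fullSum_nonneg (R := R) (ω := ω) k h f g
    have h4 : 0 ≤ min (subSum R I k h ω f g) I.trunc := le_min (subSum_nonneg _ _ _ _) trunc_nonneg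
    -- The full sum is bounded both by `12` times the sub-sampled sum plus `β` and by the
    -- truncation. Together with the factor `2` of the almost maximising pair this is the constant
    -- `26` of `sum_sens_le`.
    have h5 : fullSum R k h ω f g + I.β ≤ 13 * (min (subSum R I k h ω f g) I.trunc + I.β) := by
      rcases le_total (subSum R I k h ω f g) I.trunc with h6 | h6
      · rw [min_eq_left h6]; linarith [subSum_nonneg (R := R) (I := I) (ω := ω) k h f g]
      · rw [min_eq_right h6]; linarith [trunc_nonneg (I := I)]
    rw [mul_div_assoc', div_le_div_iff₀ (by linarith) (by linarith)]
    nlinarith [sq_nonneg (f (R.pt k h ω) - g (R.pt k h ω))]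

/-- Successes are at most twice the sum of the probabilities plus `L`, each probability is at most
`2 lam` times a sensitivity, and each step has total sensitivity `5000 max 1 d log² T`. -/
theorem switches_le_of_good (hS : Setting I δ La C₁ C₂ Ps) (hR : R.IsExecution I μ filt)
    (hs : I.M.IsOptimal πs) (hG : GoodEvent R I δ La C₁ C₂ Ps ω) (hK : 1 ≤ I.K) {d : ℕ}
    (hd : ∀ h < I.M.H, eluderDim (I.F h) (dom S A I.M.H) (1 / I.T) ≤ d) {L : ℝ}
    (hp : ∀ k < I.K, ∀ h < I.M.H,
      coinProb R I μ filt k h ω = I.prob h (R.dataset I k h ω) (R.pt k h ω))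
    (hc : ∑ k ∈ Finset.range I.K, ∑ h ∈ Finset.range I.M.H,
      ((R.coin k h).indicator (fun _ => (1 : ℝ)) ω * 1 + -(2 * coinProb R I μ filt k h ω)) < L) :
    (R.switches I ω : ℝ)
      ≤ 20000 * I.lam * I.M.H * (max 1 (d : ℝ) * Real.log I.T ^ 2) + L := by
  have hlam := hS.lam_ge
  have h1 := switches_le hR ω
  have h2 : ∑ k ∈ Finset.range I.K, ∑ h ∈ Finset.range I.M.H, 2 * coinProb R I μ filt k h ω
      ≤ ∑ h ∈ Finset.range I.M.H, 4 * I.lam * (5000 * (max 1 (d : ℝ) * Real.log I.T ^ 2)) := by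
    rw [Finset.sum_comm]
    refine Finset.sum_le_sum fun h hh => ?_
    have hh := Finset.mem_range.1 hh
    calc _ ≤ ∑ k ∈ Finset.range I.K, 4 * I.lam *
          sensitivity (I.F h) I.trunc I.β (R.dataset I k h ω) (R.pt k h ω) := by
          refine Finset.sum_le_sum fun k hk => ?_
          rw [hp k (Finset.mem_range.1 hk) h hh]
          have := prob_le (I := I) (h := h) (Z := R.dataset I k h ω) (z := R.pt k h ω)
            (by linarith)
          linarith
      _ ≤ _ := by
          rw [← Finset.mul_sum]
          have := sum_sensitivity_le hS hR hs hG hK hh (hd h hh)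
          gcongr
  rw [Finset.sum_const, Finset.card_range, nsmul_eq_mul] at h2
  simp only [mul_one, ← sub_eq_add_neg, Finset.sum_sub_distrib] at hc
  linarith

theorem excess_eq (hS : Setting I δ La C₁ C₂ Ps) (hR : R.IsExecution I μ filt)
    (hs : I.M.IsOptimal πs) (hG : GoodEvent R I δ La C₁ C₂ Ps ω) {k h : ℕ} (hk : k < I.K)
    (hh : h ≤ I.M.H) (s : S) :
    excess R I πs k h (ω, s) = R.val k h ω s - I.M.V πs h s := by
  have h1 := inRange hS hR hs hG le_rfl k hk h hh s
  have h2 := V_le_val hS hR hs hG hk hh s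
  have h3 := V_mem_Icc I.M (fun h _ => hs.1 h) hh s
  unfold excess
  rw [min_eq_right (by linarith [h1.2, h3.1]), max_eq_right (by linarith)]

/-- Along the trajectory the expected next excess is the realised one minus the noise; iterating
`gap_le_bon_add` up to the horizon, where the excess is zero, and dropping the later nonnegative
gaps gives the sum. -/
theorem gap_le_sum (hS : Setting I δ La C₁ C₂ Ps) (hR : R.IsExecution I μ filt)
    (hs : I.M.IsOptimal πs) (hG : GoodEvent R I δ La C₁ C₂ Ps ω) {k : ℕ} (hk : k < I.K) (n : ℕ) :
    ∀ h, h + n = I.M.H → excess R I πs k h (ω, R.state k h ω)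
      + (if h < I.M.H then I.M.gap πs h (R.state k h ω) (R.act k h ω) else 0)
      ≤ ∑ h' ∈ Finset.Ico h I.M.H, (2 * bon R I k h' ω (R.state k h' ω) (R.act k h' ω)
        - (excess R I πs k (h' + 1) (ω, R.state k (h' + 1) ω)
          - ∫ s, excess R I πs k (h' + 1) (ω, s) ∂(I.M.P h' (R.state k h' ω, R.act k h' ω)))) := by
  induction n with
  | zero =>
    intro h hh
    obtain rfl : h = I.M.H := by omega
    rw [excess_eq hS hR hs hG hk le_rfl, val_last_eq hR hk, V_last]
    simp
  | succ n ih =>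
    intro h hh
    have hlt : h < I.M.H := by omega
    have h1 := ih (h + 1) (by omega)
    have h2 := gap_le_bon_add hS hR hs hG hk hlt (R.state k h ω)
    rw [Finset.sum_eq_sum_Ico_succ_bot hlt, if_pos hlt, excess_eq hS hR hs hG hk hlt.le]
    have h3 : (0 : ℝ) ≤ if h + 1 < I.M.H then
        I.M.gap πs (h + 1) (R.state k (h + 1) ω) (R.act k (h + 1) ω) else 0 := by
      split_ifs with h4
      · exact gap_nonneg hs h4 _ _
      · exact le_rfl
    simp_rw [excess_eq hS hR hs hG hk (Nat.succ_le_of_lt hlt)] at h1 ⊢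
    change _ ≤ 2 * bon R I k h ω (R.state k h ω) (R.act k h ω)
      + ∫ x, (R.val k (h + 1) ω x - I.M.V πs (h + 1) x) ∂(I.M.P h (R.state k h ω, R.act k h ω)) at h2
    change R.val k h ω (R.state k h ω) - _ + I.M.gap πs h (R.state k h ω) (R.act k h ω) ≤ _ at h2
    linarith

/-- Bonuses below `x` cost at most `x` each; the others are rare by eluder counting and are summed
over dyadic levels. -/
theorem sum_bon_le (hS : Setting I δ La C₁ C₂ Ps) (hR : R.IsExecution I μ filt)
    (hs : I.M.IsOptimal πs) (hG : GoodEvent R I δ La C₁ C₂ Ps ω) {h d : ℕ} (hh : h < I.M.H)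
    (hd : eluderDim (I.F h) (dom S A I.M.H) (1 / I.T) ≤ d) {x : ℝ} (hx : 1 / I.T ≤ x)
    (hxH : x ≤ I.M.H + 1) (J : Finset ℕ) (hJ : J ⊆ Finset.range I.K) :
    ∑ k ∈ J, bon R I k h ω (R.state k h ω) (R.act k h ω)
      ≤ J.card * x + (96 * I.β * d / x + 4 * (I.M.H + 1) * d) := by
  classical
  have hr := inRange hS hR hs hG le_rfl
  have hT := hS.two_le
  have hβ := hS.β_ge'
  have hx0 : 0 < x := lt_of_lt_of_le (by positivity) hx
  have h1 := sum_large_le (J := J) (b := fun k => bon R I k h ω (R.state k h ω) (R.act k h ω))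
    (B := 24 * I.β) (d := d) hx0 hxH (Nat.cast_nonneg _) (by linarith)
    (fun k hk => bon_le (by positivity) fun f hf g hg => hS.diam h hh f hf g hg _
      (mem_dom_of_inRange hR hr (Finset.mem_range.1 (hJ hk)) hh _ _))
    (fun y hy => card_large_bon_le hS hR hs hG hh hd (hx.trans hy) J hJ)
  have h2 : ∑ k ∈ J.filter (fun k => ¬ x < bon R I k h ω (R.state k h ω) (R.act k h ω)),
      bon R I k h ω (R.state k h ω) (R.act k h ω) ≤ J.card * x := by
    calc _ ≤ ∑ k ∈ J.filter (fun k => ¬ x < bon R I k h ω (R.state k h ω) (R.act k h ω)), x :=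
          Finset.sum_le_sum fun k hk => not_lt.1 (Finset.mem_filter.1 hk).2
      _ ≤ _ := by
          rw [Finset.sum_const, nsmul_eq_mul]
          gcongr
          exact Finset.filter_subset _ _
  rw [← Finset.sum_filter_add_sum_filter_not J
    (fun k => x < bon R I k h ω (R.state k h ω) (R.act k h ω))]
  have e : 4 * (24 * I.β) * d / x = 96 * I.β * d / x := by ring
  rw [e] at h1
  linarith

/-- Each episode of `J` has gap more than `ε`, which is dominated by twice its bonuses plus noise.
Bonus threshold and noise weight are tuned so that each takes back at most `|J| ε / 4`; what remains
is of order `β d H² / ε`, and half of the left side is left. -/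
theorem card_large_gap_le (hS : Setting I δ La C₁ C₂ Ps) (hR : R.IsExecution I μ filt)
    (hs : I.M.IsOptimal πs) (hG : GoodEvent R I δ La C₁ C₂ Ps ω) {h₀ d : ℕ} (hh₀ : h₀ < I.M.H)
    (hd1 : 1 ≤ d) (hd : ∀ h < I.M.H, eluderDim (I.F h) (dom S A I.M.H) (1 / I.T) ≤ d)
    {ε Le : ℝ} (hε : 8 * I.M.H / I.T ≤ ε) (hLe : (I.M.H : ℝ) ^ 2 * Le ≤ I.β)
    (hnoise : noiseSum R I πs h₀ ε ω < Le) (J : Finset ℕ)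
    (hJ : ∀ k, k ∈ J ↔ k < I.K ∧ ε < I.M.gap πs h₀ (R.state k h₀ ω) (R.act k h₀ ω)) :
    (J.card : ℝ) ≤ 3074 * I.β * d * (I.M.H : ℝ) ^ 2 / ε ^ 2 := by
  have hT := hS.two_le
  have hβ := hS.β_ge'
  have hH := hS.H_ge
  have hd1' : (1 : ℝ) ≤ d := by exact_mod_cast hd1
  have hε0 : 0 < ε := lt_of_lt_of_le (by positivity) hε
  have hJs : J ⊆ Finset.range I.K := fun k hk => Finset.mem_range.2 ((hJ k).1 hk).1
  rcases J.eq_empty_or_nonempty with rfl | ⟨k₀, hk₀⟩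
  · simp; positivity
  have hεH : ε ≤ I.M.H := ((hJ k₀).1 hk₀).2.le.trans (gap_le hs hh₀ _ _)
  rw [noiseSum_eq h₀ I.M.H_pos ε J hJ] at hnoise
  set H : ℝ := (I.M.H : ℝ) with hHdef
  set lam := 2 * ε / H ^ 3 with hlam
  set ξ : ℕ → ℕ → ℝ := fun k h => excess R I πs k (h + 1) (ω, R.state k (h + 1) ω)
    - ∫ s, excess R I πs k (h + 1) (ω, s) ∂(I.M.P h (R.state k h ω, R.act k h ω)) with hξ
  set b : ℕ → ℕ → ℝ := fun k h => bon R I k h ω (R.state k h ω) (R.act k h ω) with hb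
  have hlow : (J.card : ℝ) * ε ≤ ∑ k ∈ J, ∑ h ∈ Finset.Ico h₀ I.M.H, (2 * b k h - ξ k h) := by
    rw [← nsmul_eq_mul, ← Finset.sum_const]
    refine Finset.sum_le_sum fun k hk => ?_
    have h1 := gap_le_sum hS hR hs hG ((hJ k).1 hk).1 (I.M.H - h₀) h₀ (by omega)
    rw [if_pos hh₀] at h1
    have h2 := (excess_mem_Icc (R := R) (I := I) (πs := πs) k h₀ (ω, R.state k h₀ ω)).1
    linarith [((hJ k).1 hk).2]
  -- With this bonus threshold, twice the small bonuses over at most `H` steps add up to `ε / 4` per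
  -- episode; `hε` makes the scale admissible for the eluder dimension.
  have hx : 1 / I.T ≤ ε / (8 * H) := by
    rw [div_le_iff₀ (by linarith)] at hε
    rw [div_le_div_iff₀ (by linarith) (by linarith)]
    linarith
  have hx' : ε / (8 * H) ≤ H + 1 := by
    rw [div_le_iff₀ (by linarith)]
    nlinarith
  have hbon : ∑ k ∈ J, ∑ h ∈ Finset.Ico h₀ I.M.H, 2 * b k h
      ≤ H * (2 * (J.card * (ε / (8 * H)) + (96 * I.β * d / (ε / (8 * H)) + 4 * (H + 1) * d))) := by
    rw [Finset.sum_comm]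
    calc _ ≤ ∑ h ∈ Finset.Ico h₀ I.M.H,
          2 * (J.card * (ε / (8 * H)) + (96 * I.β * d / (ε / (8 * H)) + 4 * (H + 1) * d)) := by
          refine Finset.sum_le_sum fun h hh => ?_
          rw [← Finset.mul_sum]
          have hh' := (Finset.mem_Ico.1 hh).2
          have := sum_bon_le hS hR hs hG hh' (hd h hh') hx hx' J hJs
          linarith
      _ ≤ _ := by
          rw [Finset.sum_const, nsmul_eq_mul]
          have : ((Finset.Ico h₀ I.M.H).card : ℝ) ≤ H := by
            rw [Nat.card_Ico, hHdef]
            exact_mod_cast Nat.sub_le _ _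
          gcongr
  -- Dividing by the weight `2 ε / H³` turns the compensator, at most `ε² / (2 H³)` per episode,
  -- into `ε / 4`.
  have hnoise2 : ∑ k ∈ J, ∑ h ∈ Finset.Ico h₀ I.M.H, -ξ k h
      ≤ Le * H ^ 3 / (2 * ε) + J.card * ε / 4 := by
    have h1 : ∑ k ∈ J, ∑ h ∈ Finset.Ico h₀ I.M.H, (-lam * ξ k h - ε ^ 2 / (2 * H ^ 4))
        = lam * (∑ k ∈ J, ∑ h ∈ Finset.Ico h₀ I.M.H, -ξ k h)
          - J.card * ((Finset.Ico h₀ I.M.H).card * (ε ^ 2 / (2 * H ^ 4))) := by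
      simp only [Finset.sum_sub_distrib, Finset.sum_const, nsmul_eq_mul, Finset.mul_sum]
      congr 1
      exact Finset.sum_congr rfl fun k _ => Finset.sum_congr rfl fun h _ => by ring
    rw [h1] at hnoise
    have h2 : ((Finset.Ico h₀ I.M.H).card : ℝ) ≤ H := by
      rw [Nat.card_Ico, hHdef]
      exact_mod_cast Nat.sub_le _ _
    have h3 : J.card * ((Finset.Ico h₀ I.M.H).card * (ε ^ 2 / (2 * H ^ 4)))
        ≤ J.card * (H * (ε ^ 2 / (2 * H ^ 4))) := by gcongr
    have h4 : lam * (∑ k ∈ J, ∑ h ∈ Finset.Ico h₀ I.M.H, -ξ k h)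
        ≤ Le + J.card * (H * (ε ^ 2 / (2 * H ^ 4))) := by linarith
    have hlam0 : 0 < lam := by positivity
    rw [mul_comm, ← le_div_iff₀ hlam0] at h4
    refine h4.trans (le_of_eq ?_)
    rw [hlam]
    field_simp
    ring
  have hmain : (J.card : ℝ) * ε ≤ H * (2 * (J.card * (ε / (8 * H)) + (96 * I.β * d / (ε / (8 * H))
      + 4 * (H + 1) * d))) + (Le * H ^ 3 / (2 * ε) + J.card * ε / 4) := by
    refine hlow.trans ?_
    simp only [sub_eq_add_neg, Finset.sum_add_distrib]
    linarith
  have e1 : H * (2 * (J.card * (ε / (8 * H)) + (96 * I.β * d / (ε / (8 * H)) + 4 * (H + 1) * d)))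
      = J.card * ε / 4 + (1536 * I.β * d * H ^ 2 / ε + 8 * H * (H + 1) * d) := by
    field_simp
    ring
  rw [e1] at hmain
  have h5 : (J.card : ℝ) * ε ≤ (3072 * I.β * d * H ^ 2 + 16 * H * (H + 1) * d * ε + Le * H ^ 3) / ε := by
    have e2 : (3072 * I.β * d * H ^ 2 + 16 * H * (H + 1) * d * ε + Le * H ^ 3) / ε
        = 2 * (1536 * I.β * d * H ^ 2 / ε + 8 * H * (H + 1) * d + Le * H ^ 3 / (2 * ε)) := by
      field_simp
      ring
    rw [e2]
    linarith
  rw [le_div_iff₀ hε0] at h5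
  rw [le_div_iff₀ (by positivity)]
  have hβH : 976 * H ^ 2 ≤ I.β := by
    have := hS.β_ge
    have hLa := hS.La_ge
    have : 976 * H ^ 2 * 1 ≤ 976 * H ^ 2 * La := by gcongr
    linarith
  have h6 : 16 * H * (H + 1) * d * ε ≤ I.β * d * H ^ 2 := by
    calc 16 * H * (H + 1) * d * ε ≤ 16 * H * (H + H) * d * H := by gcongr
      _ = (32 * H) * d * H ^ 2 := by ring
      _ ≤ I.β * d * H ^ 2 := by
        gcongr
        nlinarith
  have h7 : Le * H ^ 3 ≤ I.β * d * H ^ 2 := by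
    calc Le * H ^ 3 = H * (H ^ 2 * Le) := by ring
      _ ≤ H * I.β := by gcongr
      _ = I.β * 1 * (H * 1) := by ring
      _ ≤ I.β * d * (H * H) := by gcongr
      _ = _ := by ring
  nlinarith

/-- Levels start at `gapMin / 2`, strictly below every nonzero gap. The count at level `ε` decays
like `1 / ε²` while its contribution grows like `ε`, so the sum is geometric and dominated by the
lowest level. -/
theorem sum_gap_le (hS : Setting I δ La C₁ C₂ Ps) (hR : R.IsExecution I μ filt)
    (hs : I.M.IsOptimal πs) (hG : GoodEvent R I δ La C₁ C₂ Ps ω) {h₀ d : ℕ} (hh₀ : h₀ < I.M.H)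
    (hd1 : 1 ≤ d) (hd : ∀ h < I.M.H, eluderDim (I.F h) (dom S A I.M.H) (1 / I.T) ≤ d)
    {Le : ℝ} (hgm : 16 * I.M.H / I.T ≤ I.M.gapMin πs) (hLe : (I.M.H : ℝ) ^ 2 * Le ≤ I.β)
    (hnoise : ∀ i < I.K * I.M.H, noiseSum R I πs h₀ (2 ^ i * (I.M.gapMin πs / 2)) ω < Le) :
    ∑ k ∈ Finset.range I.K, I.M.gap πs h₀ (R.state k h₀ ω) (R.act k h₀ ω)
      ≤ 24592 * I.β * d * (I.M.H : ℝ) ^ 2 / I.M.gapMin πs := by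
  classical
  have hT := hS.two_le
  have hβ := hS.β_ge'
  have hH := hS.H_ge
  set gm := I.M.gapMin πs with hgmdef
  set n := I.K * I.M.H with hn
  have hnT : (n : ℝ) = I.T := by rw [hn, Input.T]; push_cast; ring
  have hgm0 : 0 < gm := lt_of_lt_of_le (by positivity) hgm
  have hgm2 : 8 * I.M.H / I.T ≤ gm / 2 := by
    have : 8 * (I.M.H : ℝ) / I.T = (16 * I.M.H / I.T) / 2 := by ring
    rw [this]; linarith
  have h1 : ∀ k ∈ Finset.range I.K, I.M.gap πs h₀ (R.state k h₀ ω) (R.act k h₀ ω)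
      ≤ ∑ i ∈ Finset.range n, 2 * (2 ^ i * (gm / 2)) *
        (if 2 ^ i * (gm / 2) < I.M.gap πs h₀ (R.state k h₀ ω) (R.act k h₀ ω) then 1 else 0) := by
    intro k _
    by_cases hg : I.M.gap πs h₀ (R.state k h₀ ω) (R.act k h₀ ω) = 0
    · rw [hg]
      exact Finset.sum_nonneg fun i _ => by split_ifs <;> positivity
    · have h2 := gapMin_le hs hh₀ _ _ hg
      -- `K H` levels are far more than needed, but they suffice because `2 ^ T ≥ T`, and a union
      -- bound over them costs only a logarithm of `T`.
      refine dyadic_le (by positivity) n ((gap_le hs hh₀ _ _).trans ?_) (by linarith)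
      have h3 : (n : ℝ) ≤ 2 ^ n := by exact_mod_cast Nat.lt_two_pow_self.le
      calc (I.M.H : ℝ) ≤ I.T * (8 * I.M.H / I.T) := by
            rw [mul_div_cancel₀ _ (by linarith)]; linarith
        _ ≤ 2 ^ n * (gm / 2) := by
            rw [← hnT] at hgm2 ⊢
            gcongr
  refine (Finset.sum_le_sum h1).trans ?_
  rw [Finset.sum_comm]
  have h2 : ∀ i ∈ Finset.range n, ∑ k ∈ Finset.range I.K, 2 * (2 ^ i * (gm / 2)) *
        (if 2 ^ i * (gm / 2) < I.M.gap πs h₀ (R.state k h₀ ω) (R.act k h₀ ω) then (1 : ℝ) else 0)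
      ≤ 12296 * I.β * d * (I.M.H : ℝ) ^ 2 / gm * ((2 : ℝ) ^ i)⁻¹ := by
    intro i hi
    rw [← Finset.mul_sum, Finset.sum_boole]
    have h3 : gm / 2 ≤ 2 ^ i * (gm / 2) := le_mul_of_one_le_left (by positivity)
      (one_le_pow₀ (by norm_num))
    have h4 := card_large_gap_le hS hR hs hG hh₀ hd1 hd (hgm2.trans h3) hLe
      (hnoise i (Finset.mem_range.1 hi)) ((Finset.range I.K).filter fun k =>
        2 ^ i * (gm / 2) < I.M.gap πs h₀ (R.state k h₀ ω) (R.act k h₀ ω))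
      (fun k => by rw [Finset.mem_filter, Finset.mem_range])
    calc _ ≤ 2 * (2 ^ i * (gm / 2)) *
          (3074 * I.β * d * (I.M.H : ℝ) ^ 2 / (2 ^ i * (gm / 2)) ^ 2) := by gcongr
      _ = _ := by
          field_simp
          ring
  refine (Finset.sum_le_sum h2).trans ?_
  rw [← Finset.mul_sum]
  calc _ ≤ 12296 * I.β * d * (I.M.H : ℝ) ^ 2 / gm * 2 := by
        have := sum_half_pow_le n
        gcongr
    _ = _ := by ring

end Deterministic

/-! ### Probability of the favourable event. -/

section Probability

theorem card_range_le (n : ℕ) : ((Finset.range n).card : ℝ) ≤ n := by simp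

theorem measure_exists_le {Ω ι : Type*} [MeasurableSpace Ω] {μ : Measure Ω} (s : Finset ι)
    (B : ι → Set Ω) {n c : ℝ} (hc : 0 ≤ c) (hn : (s.card : ℝ) ≤ n)
    (h : ∀ i ∈ s, μ (B i) ≤ ENNReal.ofReal c) :
    μ {ω | ∃ i ∈ s, ω ∈ B i} ≤ ENNReal.ofReal (n * c) := by
  have e : {ω | ∃ i ∈ s, ω ∈ B i} = ⋃ i ∈ s, B i := by ext ω; simp
  rw [e]
  calc μ (⋃ i ∈ s, B i) ≤ ∑ i ∈ s, μ (B i) := measure_biUnion_finset_le _ _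
    _ ≤ ∑ i ∈ s, ENNReal.ofReal c := Finset.sum_le_sum h
    _ = ENNReal.ofReal (s.card * c) := by
        rw [Finset.sum_const, nsmul_eq_mul, ENNReal.ofReal_mul (Nat.cast_nonneg _),
          ENNReal.ofReal_natCast]
    _ ≤ _ := ENNReal.ofReal_le_ofReal (by gcongr)

variable {S A Ω : Type*} [MeasurableSpace S] [MeasurableSpace A]
  {R : Interaction S A Ω} {I : Input S A} {δ La : ℝ} {C₁ C₂ : ℕ → Finset (Pt S A → ℝ)}
  {Ps : ℕ → SignedKernel S A} {πs : ℕ → S → A}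
  [mΩ : MeasurableSpace Ω] {μ : Measure Ω} {filt : Filtration (ℕ ×ₗ ℕ) mΩ}

theorem measurable_F_cpt (hR : R.IsExecution I μ filt) {k h h' : ℕ} (hk : k < I.K)
    (hh : h < I.M.H) (hle : h ≤ h') {f : Pt S A → ℝ} (hf : f ∈ I.F h) :
    Measurable[filt (toLex (k, h'))] fun ω => f (cpt R I k h ω) := by
  obtain ⟨P, _, rfl⟩ := hf
  exact measurable_modelFun_cpt hR hk hh hle P

theorem measure_not_lower_le [IsProbabilityMeasure μ] (hS : Setting I δ La C₁ C₂ Ps)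
    (hR : R.IsExecution I μ filt) {h : ℕ} (hh : h < I.M.H) {g₁ g₂ : Pt S A → ℝ}
    (hg₁ : g₁ ∈ C₂ h) (hg₂ : g₂ ∈ C₂ h) {n : ℕ} (hn : n ≤ I.K) (m : ℕ) :
    μ {ω | (∀ k < n, ω ∈ goodSet (fun ω => (numCopies R I k h ω : ℝ))
        (fun ω => g₁ (cpt R I k h ω) - g₂ (cpt R I k h ω)) (I.level m)) ∧
      I.lam / 16 * I.level m + ∑ k ∈ Finset.range n,
        (R.coin k h).indicator (fun _ => (1 : ℝ)) ω
          * (numCopies R I k h ω * (g₁ (cpt R I k h ω) - g₂ (cpt R I k h ω)) ^ 2)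
      ≤ ∑ k ∈ Finset.range n, (g₁ (cpt R I k h ω) - g₂ (cpt R I k h ω)) ^ 2 / 2}
      ≤ ENNReal.ofReal (Real.exp (-(I.lam / 16))) := by
  have hβ := hS.β_ge'
  have hlam := hS.lam_ge
  have hinv : ∀ᵐ ω ∂μ, ∀ k < n, (coinProb R I μ filt k h ω)⁻¹ = numCopies R I k h ω := by
    refine ae_all_iff.2 fun k => ?_
    by_cases hk : k < n
    · filter_upwards [ae_coinProb_inv hR (hk.trans_le hn) hh] with ω hω _ using hω
    · exact Filter.Eventually.of_forall fun ω hk' => absurd hk' hk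
  refine le_trans (measure_mono_ae ?_) (measure_sampling_lower hR hh
    (fun k ω => g₁ (cpt R I k h ω) - g₂ (cpt R I k h ω)) (fun k hk =>
      (measurable_F_cpt hR hk hh (by omega) (hS.C₂_sub h hh hg₁)).sub
        (measurable_F_cpt hR hk hh (by omega) (hS.C₂_sub h hh hg₂)))
    (b := I.level m) (by unfold Input.level; positivity) hn (I.lam / 16))
  filter_upwards [hinv] with ω hω h1
  exact ⟨hω, h1.1, h1.2⟩

theorem measure_not_upper_le [IsProbabilityMeasure μ] (hS : Setting I δ La C₁ C₂ Ps)
    (hR : R.IsExecution I μ filt) {h : ℕ} (hh : h < I.M.H) {g₁ g₂ : Pt S A → ℝ}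
    (hg₁ : g₁ ∈ C₂ h) (hg₂ : g₂ ∈ C₂ h) {n : ℕ} (hn : n ≤ I.K) :
    μ {ω | (∀ k < n, ω ∈ goodSet (fun ω => (numCopies R I k h ω : ℝ))
        (fun ω => g₁ (cpt R I k h ω) - g₂ (cpt R I k h ω)) (I.level 0)) ∧
      I.lam / 16 * I.level 0
        + ∑ k ∈ Finset.range n, 2 * (g₁ (cpt R I k h ω) - g₂ (cpt R I k h ω)) ^ 2
      ≤ ∑ k ∈ Finset.range n, (R.coin k h).indicator (fun _ => (1 : ℝ)) ω
        * (numCopies R I k h ω * (g₁ (cpt R I k h ω) - g₂ (cpt R I k h ω)) ^ 2)}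
      ≤ ENNReal.ofReal (Real.exp (-(I.lam / 16))) := by
  have hβ := hS.β_ge'
  have hlam := hS.lam_ge
  have hinv : ∀ᵐ ω ∂μ, ∀ k < n, (coinProb R I μ filt k h ω)⁻¹ = numCopies R I k h ω := by
    refine ae_all_iff.2 fun k => ?_
    by_cases hk : k < n
    · filter_upwards [ae_coinProb_inv hR (hk.trans_le hn) hh] with ω hω _ using hω
    · exact Filter.Eventually.of_forall fun ω hk' => absurd hk' hk
  refine le_trans (measure_mono_ae ?_) (measure_sampling_upper hR hh
    (fun k ω => g₁ (cpt R I k h ω) - g₂ (cpt R I k h ω)) (fun k hk =>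
      (measurable_F_cpt hR hk hh (by omega) (hS.C₂_sub h hh hg₁)).sub
        (measurable_F_cpt hR hk hh (by omega) (hS.C₂_sub h hh hg₂)))
    (b := I.level 0) (by unfold Input.level; positivity) hn (I.lam / 16))
  filter_upwards [hinv] with ω hω h1
  exact ⟨hω, h1.1, h1.2⟩

theorem measure_not_lsq_le [IsProbabilityMeasure μ] (hS : Setting I δ La C₁ C₂ Ps)
    (hR : R.IsExecution I μ filt) {h : ℕ} (hh : h < I.M.H) {g : Pt S A → ℝ}
    (hg : g ∈ C₁ h) {n : ℕ} (hn : n ≤ I.K) :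
    μ {ω | La ≤ ∑ k ∈ Finset.range n,
      (2 * (g (cpt R I k h ω) - modelFun (Ps h) (cpt R I k h ω)) / (I.M.H : ℝ) ^ 2
        * (cval R I k (h + 1) ω (R.state k (h + 1) ω)
          - ∫ s, cval R I k (h + 1) ω s ∂(I.M.P h (R.state k h ω, R.act k h ω)))
        - (2 * (g (cpt R I k h ω) - modelFun (Ps h) (cpt R I k h ω)) / (I.M.H : ℝ) ^ 2) ^ 2
          * (I.M.H : ℝ) ^ 2 / 8)} ≤ ENNReal.ofReal (Real.exp (-La)) := by
  have h1 := measure_noise_ge_le hR hn (c := I.M.H)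
    (fun k h' ω => if h' = h then
      2 * (g (cpt R I k h ω) - modelFun (Ps h) (cpt R I k h ω)) / (I.M.H : ℝ) ^ 2 else 0)
    (fun k hk h' hh' => by
      by_cases he : h' = h
      · subst he
        simp only [if_true]
        exact (((measurable_F_cpt hR hk hh le_rfl (hS.C₁_sub _ hh hg)).sub
          (measurable_F_cpt hR hk hh le_rfl (Ps_mem_F hS hh))).const_mul 2).div_const _
      · simp only [if_neg he]
        exact measurable_const)
    (fun k h' q => cval R I k (h' + 1) q.1 q.2)
    (fun k hk h' hh' => measurable_cval hR hk hh')
    (fun k h' q => cval_mem_Icc k (h' + 1) q.1 q.2) La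
  refine le_trans (measure_mono fun ω hω => ?_) h1
  refine le_trans (α := ℝ) hω (le_of_eq (Finset.sum_congr rfl fun k _ => ?_))
  rw [Finset.sum_eq_single_of_mem h (Finset.mem_range.2 hh) fun h' _ hne => by simp [hne]]
  simp

/-- Whether the gap at step `h₀` exceeds `ε` is known from time `h₀` on, and the weight is zero
before; so the weights are predictable although they select episodes. -/
theorem measure_noiseSum_ge_le [IsProbabilityMeasure μ] (hR : R.IsExecution I μ filt)
    (hs : I.M.IsOptimal πs) {h₀ : ℕ} (hh₀ : h₀ < I.M.H) (ε Le : ℝ) :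
    μ {ω | Le ≤ noiseSum R I πs h₀ ε ω} ≤ ENNReal.ofReal (Real.exp (-Le)) := by
  have hw : ∀ k < I.K, ∀ h < I.M.H,
      Measurable[filt (toLex (k, h))] (noiseWeight R I πs h₀ ε k h) := by
    intro k hk h hh
    unfold noiseWeight
    by_cases hle : h₀ ≤ h
    · have hs1 := measurable_state hR hk hh₀.le hle
      have ha1 := measurable_act hR hk hh₀ hle
      have h1 := (measurable_gap hs hh₀).comp (hs1.prodMk ha1)
      simp only [hle, true_and]
      exact Measurable.ite (h1 measurableSet_Ioi) measurable_const measurable_const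
    · simp only [hle, false_and, if_false]
      exact measurable_const
  have hU : ∀ k < I.K, ∀ h < I.M.H, Measurable[(filt (toLex (k, h))).prod inferInstance]
      (excess R I πs k (h + 1)) := by
    intro k hk h hh
    have h1 : Measurable[(filt (toLex (k, h))).prod inferInstance]
        fun q : Ω × S => R.val k (h + 1) q.1 q.2 :=
      measurable_prod_mono (filt.mono (lex_le_of_le (Nat.zero_le h)))
        (hR.val_measurable k hk (h + 1) hh)
    have h2 : Measurable[(filt (toLex (k, h))).prod inferInstance]
        fun q : Ω × S => I.M.V πs (h + 1) q.2 :=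
      (measurable_V I.M (fun h _ => hs.1 h) hh).comp
        (@measurable_snd Ω S (filt (toLex (k, h))) _)
    exact measurable_const.max (measurable_const.min (h1.sub h2))
  exact measure_noise_ge_le hR le_rfl (c := I.M.H) (noiseWeight R I πs h₀ ε) hw
    (fun k h => excess R I πs k (h + 1)) hU (fun k h q => excess_mem_Icc k (h + 1) q) Le

/-- Each of the four families of bounds fails with probability at most `δ / 8`. The largest family
has at most `8 T⁴ N₂²` members: steps, pairs of the cover, times and levels. -/
theorem measure_not_goodEvent_le [IsProbabilityMeasure μ] (hS : Setting I δ La C₁ C₂ Ps)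
    (hR : R.IsExecution I μ filt) (hK : 1 ≤ I.K) {N₁ N₂ : ℝ}
    (hN₁ : ∀ h < I.M.H, ((C₁ h).card : ℝ) ≤ N₁) (hN₂ : ∀ h < I.M.H, ((C₂ h).card : ℝ) ≤ N₂)
    (hN₂1 : 1 ≤ N₂)
    (hLa : I.T * N₁ * Real.exp (-La) ≤ δ / 8)
    (hlam : 8 * I.T ^ 4 * N₂ ^ 2 * Real.exp (-(I.lam / 16)) ≤ δ / 8) :
    μ {ω | ¬ GoodEvent R I δ La C₁ C₂ Ps ω} ≤ ENNReal.ofReal (δ / 2) := by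
  have hT := hS.two_le
  have hδ := hS.δ_pos
  have hH := hS.H_ge
  have hK' : (1 : ℝ) ≤ I.K := by exact_mod_cast hK
  have hTdef : I.T = (I.K : ℝ) * I.M.H := rfl
  have hHT : (I.M.H : ℝ) ≤ I.T := by rw [hTdef]; nlinarith
  set e := Real.exp (-(I.lam / 16)) with he
  have he0 : 0 ≤ e := (Real.exp_pos _).le
  have hN0 : 0 ≤ N₁ := (Nat.cast_nonneg _).trans (hN₁ 0 I.M.H_pos)
  have hcardK : ((Finset.range (I.K + 1)).card : ℝ) ≤ I.K + 1 := by simp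
  have b1 := measure_exists_le (μ := μ) (Finset.range I.M.H) _ (by positivity)
    (card_range_le _) fun h hh =>
    have hh := Finset.mem_range.1 hh
    measure_exists_le (C₂ h) _ (by positivity) (hN₂ h hh) fun g₁ hg₁ =>
    measure_exists_le (C₂ h) _ (by positivity) (hN₂ h hh) fun g₂ hg₂ =>
    measure_exists_le (Finset.range (I.K + 1)) _ (by positivity) hcardK fun n hn =>
    measure_exists_le (Finset.range (I.K * I.M.H * (I.M.H + 1) ^ 2)) _ he0
      (card_range_le _) fun m hm =>
      measure_not_lower_le hS hR hh hg₁ hg₂ (Nat.lt_succ_iff.1 (Finset.mem_range.1 hn)) m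
  have b2 := measure_exists_le (μ := μ) (Finset.range I.M.H) _ (by positivity)
    (card_range_le _) fun h hh =>
    have hh := Finset.mem_range.1 hh
    measure_exists_le (C₂ h) _ (by positivity) (hN₂ h hh) fun g₁ hg₁ =>
    measure_exists_le (C₂ h) _ (by positivity) (hN₂ h hh) fun g₂ hg₂ =>
    measure_exists_le (Finset.range (I.K + 1)) _ he0 hcardK fun n hn =>
      measure_not_upper_le hS hR hh hg₁ hg₂ (Nat.lt_succ_iff.1 (Finset.mem_range.1 hn))
  have b3 := measure_exists_le (μ := μ) (Finset.range I.M.H) _ (by positivity)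
    (card_range_le _) fun h hh =>
    have hh := Finset.mem_range.1 hh
    measure_exists_le (C₁ h) _ (by positivity) (hN₁ h hh) fun g hg =>
    measure_exists_le (Finset.range I.K) _ (Real.exp_pos _).le (card_range_le _)
      fun n hn => measure_not_lsq_le hS hR hh hg (Finset.mem_range.1 hn).le
  have b4 := measure_copies_ge_le (μ := μ) hR (a := 8 * I.T / δ) (by positivity)
  have hK2 : (I.M.H : ℝ) * (I.K + 1) ≤ 2 * I.T := by rw [hTdef]; nlinarith
  have c1 : (I.M.H : ℝ) * (N₂ * (N₂ * ((I.K + 1)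
      * (((I.K * I.M.H * (I.M.H + 1) ^ 2 : ℕ) : ℝ) * e)))) ≤ δ / 8 := by
    refine le_trans ?_ hlam
    push_cast
    calc _ = ((I.M.H : ℝ) * (I.K + 1)) * N₂ ^ 2 * (I.T * ((I.M.H : ℝ) + 1) ^ 2) * e := by
          rw [hTdef]; ring
      _ ≤ (2 * I.T) * N₂ ^ 2 * (I.T * (2 * I.T) ^ 2) * e := by
          gcongr
          linarith
      _ = _ := by ring
  have c2 : (I.M.H : ℝ) * (N₂ * (N₂ * ((I.K + 1) * e))) ≤ δ / 8 := by
    refine le_trans ?_ hlam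
    calc _ = ((I.M.H : ℝ) * (I.K + 1)) * N₂ ^ 2 * e := by ring
      _ ≤ (8 * I.T ^ 4) * N₂ ^ 2 * e := by
          have h4 : I.T ^ 1 ≤ I.T ^ 4 := pow_le_pow_right₀ (by linarith) (by norm_num)
          have h5 : (I.M.H : ℝ) * (I.K + 1) ≤ 8 * I.T ^ 4 := by linarith
          exact mul_le_mul_of_nonneg_right (mul_le_mul_of_nonneg_right h5 (by positivity)) he0
  have c3 : (I.M.H : ℝ) * (N₁ * (I.K * Real.exp (-La))) ≤ δ / 8 := by
    refine le_trans (le_of_eq ?_) hLa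
    rw [hTdef]; ring
  have c4 : (I.K * I.M.H : ℝ) / (8 * I.T / δ) ≤ δ / 8 := by
    rw [← hTdef]
    refine le_of_eq ?_
    field_simp
  refine le_trans (measure_mono (t := _ ∪ (_ ∪ (_ ∪ _))) fun ω hω => ?_)
    ((measure_union_le _ _).trans (le_trans (add_le_add b1 ((measure_union_le _ _).trans
      (add_le_add b2 ((measure_union_le _ _).trans (add_le_add b3 b4))))) ?_))
  · by_contra hcon
    simp only [Set.mem_union, not_or, Set.mem_ofPred_eq, not_exists, not_and, not_le,
      Finset.mem_range, Nat.lt_succ_iff] at hcon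
    obtain ⟨h1, h2, h3, h4⟩ := hcon
    exact hω ⟨fun h hh g₁ hg₁ g₂ hg₂ n hn m hm hgood => h1 h hh g₁ hg₁ g₂ hg₂ n hn m hm hgood,
      fun h hh g₁ hg₁ g₂ hg₂ n hn hgood => h2 h hh g₁ hg₁ g₂ hg₂ n hn hgood, h4,
      fun h hh g hg n hn => h3 h hh g hg n hn⟩
  · calc _ ≤ ENNReal.ofReal (δ / 8) + (ENNReal.ofReal (δ / 8)
          + (ENNReal.ofReal (δ / 8) + ENNReal.ofReal (δ / 8))) := by
          gcongr
      _ = _ := by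
          rw [← ENNReal.ofReal_add (by positivity) (by positivity),
            ← ENNReal.ofReal_add (by positivity) (by positivity),
            ← ENNReal.ofReal_add (by positivity) (by positivity)]
          congr 1
          ring

/-- The event on which the bounds of the theorem hold. -/
structure Favorable (R : Interaction S A Ω) (I : Input S A) (δ La Le L τ : ℝ)
    (C₁ C₂ : ℕ → Finset (Pt S A → ℝ)) (Ps : ℕ → SignedKernel S A) (πs : ℕ → S → A)
    (μ : Measure Ω) (filt : Filtration (ℕ ×ₗ ℕ) mΩ) (ω : Ω) : Prop where
  good : GoodEvent R I δ La C₁ C₂ Ps ω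
  coinProb_eq : ∀ k < I.K, ∀ h < I.M.H,
    coinProb R I μ filt k h ω = I.prob h (R.dataset I k h ω) (R.pt k h ω)
  coins : ∑ k ∈ Finset.range I.K, ∑ h ∈ Finset.range I.M.H,
    ((R.coin k h).indicator (fun _ => (1 : ℝ)) ω * 1 + -(2 * coinProb R I μ filt k h ω)) < L
  noise : ∀ h < I.M.H, ∀ i < I.K * I.M.H, noiseSum R I πs h (2 ^ i * (I.M.gapMin πs / 2)) ω < Le
  gaps : ∑ k ∈ Finset.range I.K, (subopt I.M πs (fun j => R.policy k j ω) 0 I.M.s₁ / (2 * I.M.H)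
    - (∑ h ∈ Finset.range I.M.H, I.M.gap πs h (R.state k h ω) (R.act k h ω)) / I.M.H) < τ

theorem exists_favorable_set [IsProbabilityMeasure μ] (hS : Setting I δ La C₁ C₂ Ps)
    (hR : R.IsExecution I μ filt) (hs : I.M.IsOptimal πs) (hK : 1 ≤ I.K) {N₁ N₂ Le L : ℝ}
    (hN₁ : ∀ h < I.M.H, ((C₁ h).card : ℝ) ≤ N₁) (hN₂ : ∀ h < I.M.H, ((C₂ h).card : ℝ) ≤ N₂)
    (hN₂1 : 1 ≤ N₂)
    (hLa : I.T * N₁ * Real.exp (-La) ≤ δ / 8)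
    (hlam : 8 * I.T ^ 4 * N₂ ^ 2 * Real.exp (-(I.lam / 16)) ≤ δ / 8)
    (hLe : I.T ^ 2 * Real.exp (-Le) ≤ δ / 8) (hL : Real.exp (-L) ≤ δ / 8) (τ : ℝ) :
    ∃ G : Set Ω, MeasurableSet G ∧ 1 - Real.exp (-τ) - δ ≤ μ.real G ∧
      ∀ ω ∈ G, Favorable R I δ La Le L τ C₁ C₂ Ps πs μ filt ω := by
  have hT := hS.two_le
  have hδ := hS.δ_pos
  have hH := hS.H_ge
  have hK' : (1 : ℝ) ≤ I.K := by exact_mod_cast hK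
  have hTdef : I.T = (I.K : ℝ) * I.M.H := rfl
  have hHT : (I.M.H : ℝ) ≤ I.T := by rw [hTdef]; nlinarith
  have b1 := measure_not_goodEvent_le hS hR hK hN₁ hN₂ hN₂1 hLa hlam
  have b2 : μ {ω | ¬ ∀ k < I.K, ∀ h < I.M.H,
      coinProb R I μ filt k h ω = I.prob h (R.dataset I k h ω) (R.pt k h ω)} = 0 := by
    refine ae_iff.1 (ae_all_iff.2 fun k => ?_)
    by_cases hk : k < I.K
    · have : ∀ᵐ ω ∂μ, ∀ h < I.M.H,
          coinProb R I μ filt k h ω = I.prob h (R.dataset I k h ω) (R.pt k h ω) := by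
        refine ae_all_iff.2 fun h => ?_
        by_cases hh : h < I.M.H
        · filter_upwards [ae_coinProb_eq hR hk hh] with ω hω _ using hω
        · exact Filter.Eventually.of_forall fun ω hh' => absurd hh' hh
      filter_upwards [this] with ω hω _ using hω
    · exact Filter.Eventually.of_forall fun ω hk' => absurd hk' hk
  have b3 := measure_coin_count_ge_le (μ := μ) hR L
  have b4 := measure_exists_le (μ := μ) (Finset.range I.M.H) _ (by positivity)
    (card_range_le _) fun h hh =>
    measure_exists_le (Finset.range (I.K * I.M.H)) _ (Real.exp_pos _).le
      (card_range_le _) fun i _ =>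
      measure_noiseSum_ge_le hR hs (Finset.mem_range.1 hh) (2 ^ i * (I.M.gapMin πs / 2)) Le
  have b5 := measure_gap_sum_le (μ := μ) hR hs τ
  have c4 : (I.M.H : ℝ) * (((I.K * I.M.H : ℕ) : ℝ) * Real.exp (-Le)) ≤ δ / 8 := by
    refine le_trans ?_ hLe
    push_cast
    rw [← hTdef]
    calc _ ≤ I.T * (I.T * Real.exp (-Le)) := by gcongr
      _ = _ := by ring
  have hbad : μ {ω | ¬ Favorable R I δ La Le L τ C₁ C₂ Ps πs μ filt ω}
      ≤ ENNReal.ofReal (Real.exp (-τ) + δ) := by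
    refine le_trans (measure_mono (t := _ ∪ (_ ∪ (_ ∪ (_ ∪ _)))) fun ω hω => ?_)
      ((measure_union_le _ _).trans (le_trans (add_le_add b1 ((measure_union_le _ _).trans
        (add_le_add b2.le ((measure_union_le _ _).trans (add_le_add b3
          ((measure_union_le _ _).trans (add_le_add b4 b5))))))) ?_))
    · by_contra hcon
      simp only [Set.mem_union, not_or, Set.mem_ofPred_eq, not_exists, not_and, not_le,
        Finset.mem_range, not_not] at hcon
      obtain ⟨h1, h2, h3, h4, h5⟩ := hcon
      exact hω ⟨h1, h2, h3, h4, h5⟩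
    · calc _ ≤ ENNReal.ofReal (δ / 2) + (0 + (ENNReal.ofReal (δ / 8)
            + (ENNReal.ofReal (δ / 8) + ENNReal.ofReal (Real.exp (-τ))))) := by
            gcongr
        _ ≤ _ := by
            rw [zero_add, ← ENNReal.ofReal_add (by positivity) (by positivity),
              ← ENNReal.ofReal_add (by positivity) (by positivity),
              ← ENNReal.ofReal_add (by positivity) (by positivity)]
            exact ENNReal.ofReal_le_ofReal (by linarith)
  -- The favourable event need not be measurable; the complement of a measurable hull of its failure
  -- is.
  refine ⟨(toMeasurable μ {ω | ¬ Favorable R I δ La Le L τ C₁ C₂ Ps πs μ filt ω})ᶜ,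
    (measurableSet_toMeasurable _ _).compl, ?_, fun ω hω => ?_⟩
  · rw [measureReal_compl (measurableSet_toMeasurable _ _), probReal_univ, Measure.real,
      measure_toMeasurable]
    have := ENNReal.toReal_le_of_le_ofReal (by positivity) hbad
    linarith
  · by_contra hcon
    exact hω (subset_toMeasurable _ _ hcon)

end Probability

/-! ### Regret on the favourable event. -/

section Regret

variable {S A Ω : Type*} [MeasurableSpace S] [MeasurableSpace A]
  {R : Interaction S A Ω} {I : Input S A} {δ La Le L τ : ℝ} {C₁ C₂ : ℕ → Finset (Pt S A → ℝ)}
  {Ps : ℕ → SignedKernel S A} {πs : ℕ → S → A} {ω : Ω}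

theorem regret_eq_sum_subopt : R.regret I πs ω
    = ∑ k ∈ Finset.range I.K, subopt I.M πs (fun h => R.policy k h ω) 0 I.M.s₁ := rfl

theorem subopt_eq_zero (hs : I.M.IsOptimal πs) {π : ℕ → S → A}
    (hπ : ∀ h < I.M.H, Measurable (π h)) (h0 : ¬ (I.M.gapSet πs).Nonempty) (n : ℕ) :
    ∀ h, h + n = I.M.H → ∀ s, subopt I.M πs π h s = 0 := by
  induction n with
  | zero =>
    intro h hh s
    obtain rfl : h = I.M.H := by omega
    rw [subopt, V_last, V_last, sub_zero]
  | succ n ih =>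
    intro h hh s
    have hlt : h < I.M.H := by omega
    rw [subopt_eq hs hπ hlt]
    simp_rw [ih (h + 1) (by omega)]
    rw [integral_zero, add_zero]
    by_contra hg
    exact h0 ⟨_, hg, h, hlt, s, _, rfl⟩

theorem gapMin_nonneg (hs : I.M.IsOptimal πs) : 0 ≤ I.M.gapMin πs := by
  refine Real.sInf_nonneg ?_
  rintro _ ⟨_, h, hh, s, a, rfl⟩
  exact gap_nonneg hs hh s a

variable [mΩ : MeasurableSpace Ω] {μ : Measure Ω} {filt : Filtration (ℕ ×ₗ ℕ) mΩ}

theorem regret_le_T (hR : R.IsExecution I μ filt) (hs : I.M.IsOptimal πs) :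
    R.regret I πs ω ≤ I.T := by
  rw [regret_eq_sum_subopt]
  calc _ ≤ ∑ k ∈ Finset.range I.K, (I.M.H : ℝ) := Finset.sum_le_sum fun k hk =>
        (subopt_mem_Icc hs (measurable_policy hR (Finset.mem_range.1 hk) ω) (Nat.zero_le _) _).2
    _ = I.T := by simp [Input.T]

theorem regret_eq_zero (hR : R.IsExecution I μ filt) (hs : I.M.IsOptimal πs)
    (h0 : ¬ (I.M.gapSet πs).Nonempty) : R.regret I πs ω = 0 := by
  rw [regret_eq_sum_subopt]
  exact Finset.sum_eq_zero fun k hk =>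
    subopt_eq_zero hs (measurable_policy hR (Finset.mem_range.1 hk) ω) h0 I.M.H 0 (by omega) _

theorem regret_le_of_diam (hS : Setting I δ La C₁ C₂ Ps) (hR : R.IsExecution I μ filt)
    (hs : I.M.IsOptimal πs) (hG : GoodEvent R I δ La C₁ C₂ Ps ω) {w : ℝ} (hw : 0 ≤ w)
    (hF : ∀ h < I.M.H, ∀ f ∈ I.F h, ∀ g ∈ I.F h, ∀ z ∈ dom S A I.M.H, |f z - g z| ≤ w) :
    R.regret I πs ω ≤ 2 * w * I.T := by
  rw [regret_eq_sum_subopt]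
  calc _ ≤ ∑ k ∈ Finset.range I.K, (I.M.H : ℝ) * (2 * w) := Finset.sum_le_sum fun k hk =>
        subopt_le_of_diam hS hR hs hG hw hF (Finset.mem_range.1 hk)
    _ = 2 * w * I.T := by
        rw [Finset.sum_const, Finset.card_range, nsmul_eq_mul, Input.T]; ring

/-- Multiplying the trajectory bound by `2 H` leaves `2 H τ` plus twice the sum of all gaps, to
which each of the `H` steps contributes by `sum_gap_le`. -/
theorem regret_le_of_favorable (hS : Setting I δ La C₁ C₂ Ps) (hR : R.IsExecution I μ filt)
    (hs : I.M.IsOptimal πs) (hF : Favorable R I δ La Le L τ C₁ C₂ Ps πs μ filt ω) {d : ℕ}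
    (hd1 : 1 ≤ d) (hd : ∀ h < I.M.H, eluderDim (I.F h) (dom S A I.M.H) (1 / I.T) ≤ d)
    (hgm : 16 * I.M.H / I.T ≤ I.M.gapMin πs) (hLe : (I.M.H : ℝ) ^ 2 * Le ≤ I.β) :
    R.regret I πs ω
      ≤ 49184 * I.β * d * (I.M.H : ℝ) ^ 3 / I.M.gapMin πs + 2 * I.M.H * τ := by
  have hH := hS.H_ge
  have h1 := hF.gaps
  rw [Finset.sum_sub_distrib, ← Finset.sum_div, ← Finset.sum_div, Finset.sum_comm,
    ← regret_eq_sum_subopt] at h1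
  have h2 : ∑ h ∈ Finset.range I.M.H, ∑ k ∈ Finset.range I.K,
      I.M.gap πs h (R.state k h ω) (R.act k h ω)
      ≤ ∑ h ∈ Finset.range I.M.H, 24592 * I.β * d * (I.M.H : ℝ) ^ 2 / I.M.gapMin πs :=
    Finset.sum_le_sum fun h hh => by
      have hh := Finset.mem_range.1 hh
      exact sum_gap_le hS hR hs hF.good hh hd1 hd hgm hLe (hF.noise h hh)
  rw [Finset.sum_const, Finset.card_range, nsmul_eq_mul] at h2
  set G := ∑ h ∈ Finset.range I.M.H, ∑ k ∈ Finset.range I.K,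
    I.M.gap πs h (R.state k h ω) (R.act k h ω)
  have h3 : R.regret I πs ω / (2 * I.M.H) < τ + G / I.M.H := by linarith
  rw [div_lt_iff₀ (by positivity)] at h3
  have h4 : (τ + G / I.M.H) * (2 * I.M.H) = 2 * I.M.H * τ + 2 * G := by
    field_simp
  have h5 : 49184 * I.β * d * (I.M.H : ℝ) ^ 3 / I.M.gapMin πs
      = 2 * ((I.M.H : ℝ) * (24592 * I.β * d * (I.M.H : ℝ) ^ 2 / I.M.gapMin πs)) := by ring
  rw [h5]
  linarith

end Regret

/-! ### Numerical inequalities for the parameters. -/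

section Parameters

variable {T N δ : ℝ}

theorem log_eight_mul_le (hT : 2 ≤ T) (hN : 1 ≤ N) (hδ : 0 < δ) (hδ1 : δ < 1) :
    Real.log (8 * T * N / δ) ≤ 2 * Real.log (2 * T * N / δ) := by
  have h2 : 2 ≤ T * N / δ := by
    rw [le_div_iff₀ hδ]
    nlinarith
  have e : 2 * Real.log (2 * T * N / δ) = Real.log ((2 * T * N / δ) ^ 2) := by
    rw [Real.log_pow]; norm_num
  rw [e]
  refine Real.log_le_log (by positivity) ?_
  have e1 : 8 * T * N / δ = 8 * (T * N / δ) := by ring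
  have e2 : 2 * T * N / δ = 2 * (T * N / δ) := by ring
  rw [e1, e2]
  nlinarith

theorem log_eight_sq_le (hT : 2 ≤ T) (hN : 1 ≤ N) (hδ : 0 < δ) (hδ1 : δ < 1) :
    Real.log (8 * T ^ 2 / δ) ≤ 3 * Real.log (2 * T * N / δ) := by
  have e : 3 * Real.log (2 * T * N / δ) = Real.log ((2 * T * N / δ) ^ 3) := by
    rw [Real.log_pow]; norm_num
  rw [e]
  refine Real.log_le_log (by positivity) ?_
  have h1 : 2 * T ≤ 2 * T * N / δ := by
    rw [le_div_iff₀ hδ]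
    nlinarith
  have h2 : 2 * T / δ ≤ 2 * T * N / δ := by
    rw [div_le_div_iff_of_pos_right hδ]
    nlinarith
  calc 8 * T ^ 2 / δ ≤ 2 * T * (2 * T) * (2 * T / δ) := by
        have : 2 * T * (2 * T) * (2 * T / δ) = 8 * T ^ 2 / δ * T := by ring
        rw [this]
        exact le_mul_of_one_le_right (by positivity) (by linarith)
    _ ≤ (2 * T * N / δ) * (2 * T * N / δ) * (2 * T * N / δ) := by gcongr
    _ = _ := by ring

theorem log_eight_div_le (hT : 2 ≤ T) (hN : 1 ≤ N) (hδ : 0 < δ) (hδ1 : δ < 1) :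
    Real.log (8 / δ) ≤ 3 * Real.log (T * N / δ) := by
  have e : 3 * Real.log (T * N / δ) = Real.log ((T * N / δ) ^ 3) := by
    rw [Real.log_pow]; norm_num
  rw [e]
  refine Real.log_le_log (by positivity) ?_
  have h1 : 2 ≤ T * N / δ := by
    rw [le_div_iff₀ hδ]
    nlinarith
  have h2 : 2 / δ ≤ T * N / δ := by
    gcongr
    nlinarith
  calc 8 / δ = 2 * 2 * (2 / δ) := by ring
    _ ≤ (T * N / δ) * (T * N / δ) * (T * N / δ) := by gcongr
    _ = _ := by ring

/-- Since `192 = 16 * 12`, the exponential is `(δ / (T N))^12`. Four of these factors pay for `T⁴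
N²` and a `δ`, the other eight for the constants. -/
theorem sampling_failure_le (hT : 2 ≤ T) (hN : 1 ≤ N) (hδ : 0 < δ) (hδ1 : δ < 1) :
    8 * T ^ 4 * N ^ 2 * Real.exp (-(192 * Real.log (T * N / δ) / 16)) ≤ δ / 8 := by
  have hq : 0 < T * N / δ := by positivity
  have e : Real.exp (-(192 * Real.log (T * N / δ) / 16)) = (δ / (T * N)) ^ 12 := by
    have e1 : -(192 * Real.log (T * N / δ) / 16) = ((12 : ℕ) : ℝ) * Real.log (T * N / δ)⁻¹ := by
      rw [Real.log_inv]; push_cast; ring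
    rw [e1, Real.exp_nat_mul, Real.exp_log (by positivity), inv_div]
  rw [e]
  have hx : 0 ≤ δ / (T * N) := by positivity
  have h1 : δ / (T * N) ≤ 1 / 2 := by
    rw [div_le_div_iff₀ (by positivity) (by norm_num)]
    nlinarith
  have h2 : (δ / (T * N)) ^ 8 ≤ (1 / 2) ^ 8 := pow_le_pow_left₀ hx h1 8
  have h3 : 8 * T ^ 4 * N ^ 2 * (δ / (T * N)) ^ 12
      = 8 * (δ ^ 4 / N ^ 2) * (δ / (T * N)) ^ 8 := by
    field_simp
  rw [h3]
  have h4 : δ ^ 4 / N ^ 2 ≤ δ := by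
    rw [div_le_iff₀ (by positivity)]
    have h5 : δ ^ 4 ≤ δ ^ 1 := pow_le_pow_of_le_one hδ.le hδ1.le (by norm_num)
    have h6 : 1 ≤ N ^ 2 := one_le_pow₀ hN
    nlinarith
  calc 8 * (δ ^ 4 / N ^ 2) * (δ / (T * N)) ^ 8 ≤ 8 * δ * (1 / 2) ^ 8 := by gcongr
    _ ≤ δ / 8 := by linarith

theorem bonus_parameter_ge {H : ℝ} (hH : 1 ≤ H) :
    2000 * H ^ 2 * Real.log (2 * T * N / δ) ≤ 500 * (4 * H ^ 2 * Real.log (2 * T * N / δ)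
      + 4 / H * (500 + Real.sqrt (H ^ 2 / 4 * Real.log (T / δ)))) := by
  have : 0 ≤ 4 / H * (500 + Real.sqrt (H ^ 2 / 4 * Real.log (T / δ))) := by positivity
  linarith

theorem one_lt_log (hT : 2 ≤ T) (hN : 1 ≤ N) (hδ : 0 < δ) (hδ1 : δ < 1) :
    1 < Real.log (2 * T * N / δ) := by
  have h1 : (4 : ℝ) ≤ 2 * T * N / δ := by
    rw [le_div_iff₀ hδ]
    nlinarith
  rw [Real.lt_log_iff_exp_lt (by linarith)]
  linarith [Real.exp_one_lt_three]

/-- The target is a product of logarithms, the parameter contains their sum; the sum is dominated by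
the product only when both are bounded below, which is the role of `hX`. -/
theorem bonus_parameter_le {H : ℝ} (hH : 1 ≤ H) (hT : 2 ≤ T) (hN : 1 ≤ N) (hδ : 0 < δ)
    (hδ1 : δ < 1) (hX : Real.log 2 ≤ Real.log (N / δ)) :
    500 * (4 * H ^ 2 * Real.log (2 * T * N / δ)
      + 4 / H * (500 + Real.sqrt (H ^ 2 / 4 * Real.log (T / δ))))
      ≤ 5100000 * H ^ 2 * (Real.log (N / δ) * Real.log T) := by
  have hlog := one_lt_log hT hN hδ hδ1
  have hH2 : 1 ≤ H ^ 2 := one_le_pow₀ hH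
  have h0 : 0 ≤ Real.log (T / δ) := Real.log_nonneg (by rw [le_div_iff₀ hδ]; linarith)
  have h1 : Real.log (T / δ) ≤ Real.log (2 * T * N / δ) := by
    refine Real.log_le_log (by positivity) ?_
    gcongr
    nlinarith
  have h2 : Real.sqrt (H ^ 2 / 4 * Real.log (T / δ)) ≤ H ^ 2 / 4 * Real.log (T / δ) + 1 := by
    rw [Real.sqrt_le_left (by positivity)]
    nlinarith [show 0 ≤ H ^ 2 / 4 * Real.log (T / δ) by positivity]
  have h3 : 4 / H * (500 + Real.sqrt (H ^ 2 / 4 * Real.log (T / δ)))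
      ≤ 2004 + H * Real.log (T / δ) := by
    calc _ ≤ 4 / H * (500 + (H ^ 2 / 4 * Real.log (T / δ) + 1)) := by gcongr
      _ = 2004 / H + H * Real.log (T / δ) := by field_simp; ring
      _ ≤ _ := by
        gcongr
        exact div_le_self (by norm_num) hH
  have h4 : H * Real.log (T / δ) ≤ H ^ 2 * Real.log (2 * T * N / δ) := by
    gcongr
    nlinarith
  have h5 : 1 * 1 ≤ H ^ 2 * Real.log (2 * T * N / δ) := by gcongr
  have h6 : Real.log (2 * T * N / δ) ≤ 5 * (Real.log (N / δ) * Real.log T) := by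
    have e : 2 * T * N / δ = 2 * T * (N / δ) := by ring
    rw [e, Real.log_mul (by positivity) (by positivity), Real.log_mul (by norm_num) (by positivity)]
    have h7 := half_lt_log hT
    have h8 : (0.69 : ℝ) < Real.log 2 := half_lt_log le_rfl
    have h9 : Real.log 2 ≤ Real.log T := Real.log_le_log (by norm_num) hT
    nlinarith
  have h7 : H ^ 2 * Real.log (2 * T * N / δ) ≤ H ^ 2 * (5 * (Real.log (N / δ) * Real.log T)) := by
    gcongr
  linarith

/-- Below the resolution `16 H / T` of the counting argument the trivial regret bound `T` is already
good enough. -/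
theorem T_le_of_small_gap {H X d g : ℝ} (hT : 2 ≤ T) (hH : 1 ≤ H) (hd : 1 ≤ d)
    (hX : 0.47 ≤ X * Real.log T) (hg : 0 < g) (hsmall : g < 16 * H / T) :
    T ≤ 10 ^ 12 * (X * d ^ 2) * H ^ 5 * Real.log T / g := by
  rw [lt_div_iff₀ (by linarith)] at hsmall
  rw [le_div_iff₀ hg]
  have h1 : H ^ 1 ≤ H ^ 5 := pow_le_pow_right₀ hH (by norm_num)
  have h2 : (1 : ℝ) ≤ d ^ 2 := one_le_pow₀ hd
  calc T * g ≤ 16 * H ^ 1 := by linarith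
    _ ≤ 10 ^ 12 * 0.47 * 1 * H ^ 5 := by linarith
    _ ≤ 10 ^ 12 * (X * Real.log T) * d ^ 2 * H ^ 5 := by gcongr
    _ = _ := by ring

theorem gap_bound_le {H X Y d g β : ℝ} (hH : 1 ≤ H) (hd : 1 ≤ d) (hXY : 0 ≤ X * Y) (hg : 0 < g)
    (hβ : β ≤ 5100000 * H ^ 2 * (X * Y)) :
    49184 * β * d * H ^ 3 / g ≤ 10 ^ 12 * (X * d ^ 2) * H ^ 5 * Y / g := by
  rw [div_le_div_iff_of_pos_right hg]
  have hdd : d ≤ d ^ 2 := by nlinarith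
  have h0 : 0 ≤ X * Y * d ^ 2 * H ^ 5 := by positivity
  calc 49184 * β * d * H ^ 3
      ≤ 49184 * (5100000 * H ^ 2 * (X * Y)) * d * H ^ 3 := by gcongr
    _ ≤ 49184 * (5100000 * H ^ 2 * (X * Y)) * d ^ 2 * H ^ 3 := by gcongr
    _ = 250838400000 * (X * Y * d ^ 2 * H ^ 5) := by ring
    _ ≤ 10 ^ 12 * (X * Y * d ^ 2 * H ^ 5) := by linarith
    _ = _ := by ring

theorem switch_bound_le {H d : ℝ} (hT : 2 ≤ T) (hN : 1 ≤ N) (hδ : 0 < δ) (hδ1 : δ < 1)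
    (hH : 1 ≤ H) :
    20000 * (192 * Real.log (T * N / δ)) * H * (max 1 d * Real.log T ^ 2) + Real.log (8 / δ)
      ≤ 10 ^ 12 * (H * Real.log (T * N / δ) * max 1 d * Real.log T ^ 2) := by
  have hlogT := half_lt_log hT
  have hℓ : (0.69 : ℝ) < Real.log (T * N / δ) :=
    half_lt_log (by rw [le_div_iff₀ hδ]; nlinarith)
  have h2 := log_eight_div_le hT hN hδ hδ1
  have h3 : (1 : ℝ) * 0.47 ≤ max 1 d * Real.log T ^ 2 := by
    gcongr
    · exact le_max_left _ _
    · nlinarith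
  have h4 : 1 * Real.log (T * N / δ) * (1 * 0.47)
      ≤ H * Real.log (T * N / δ) * (max 1 d * Real.log T ^ 2) := by gcongr
  have e1 : 10 ^ 12 * (H * Real.log (T * N / δ) * max 1 d * Real.log T ^ 2)
      = 10 ^ 12 * (H * Real.log (T * N / δ) * (max 1 d * Real.log T ^ 2)) := by ring
  have e2 : 20000 * (192 * Real.log (T * N / δ)) * H * (max 1 d * Real.log T ^ 2)
      = 3840000 * (H * Real.log (T * N / δ) * (max 1 d * Real.log T ^ 2)) := by ring
  rw [e1, e2]
  linarith

end Parameters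

/-- A separated pair would make the single point `x` an independent sequence of length one. -/
theorem diam_le_of_eluderDim_eq_zero {X : Type*} {F : Set (X → ℝ)} {D : Set X} {ε : ℝ}
    (hε : 0 < ε) (hd : eluderDim F D ε ≤ (0 : ℕ)) {f g : X → ℝ} (hf : f ∈ F) (hg : g ∈ F) {x : X}
    (hx : x ∈ D) : |f x - g x| ≤ ε := by
  by_contra! hcon
  have := card_le_of_separated hd le_rfl hε (le_refl 0) {0} (fun _ => x) (fun _ _ => hx)
    fun k hk => ⟨f, hf, g, hg, hcon, by
      rw [Finset.mem_singleton] at hk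
      subst hk
      simp⟩
  norm_num at this

theorem exists_covers {X : Type*} {F : ℕ → Set (X → ℝ)} {D : Set X} {H : ℕ} {N : ℕ → ℝ → ℕ}
    {Nmax : ℝ → ℕ} (hN : ∀ h < H, IsCoveringBound (F h) D (N h))
    (hmax : ∀ ε, Nmax ε = (Finset.range H).sup fun h => N h ε) {ε : ℝ} (hε : 0 < ε) :
    ∃ C : ℕ → Finset (X → ℝ), ∀ h < H, (C h : Set (X → ℝ)) ⊆ F h ∧ (C h).card ≤ Nmax ε ∧
      ∀ f ∈ F h, ∃ g ∈ C h, ∀ x ∈ D, |f x - g x| ≤ ε := by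
  choose! C h1 h2 h3 using fun h hh => hN h hh ε hε
  refine ⟨C, fun h hh => ⟨h1 h hh, (h2 h hh).trans ?_, h3 h hh⟩⟩
  rw [hmax]
  exact Finset.le_sup (f := fun h => N h ε) (Finset.mem_range.2 hh)

/-! ### The regret bound with its degenerate cases. -/

section Conclusion

variable {S A Ω : Type*} [MeasurableSpace S] [MeasurableSpace A]
  {R : Interaction S A Ω} {I : Input S A} {C₁ C₂ : ℕ → Finset (Pt S A → ℝ)}
  {Ps : ℕ → SignedKernel S A} {πs : ℕ → S → A} {ω : Ω}
  [mΩ : MeasurableSpace Ω] {μ : Measure Ω} {filt : Filtration (ℕ ×ₗ ℕ) mΩ}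

/-- The main estimate needs `d ≥ 1`, `log (N₁ / δ)` bounded below and a minimal gap of at least `16
H / T`. Each failure makes the regret small or the claimed bound large, and is settled directly. -/
theorem regret_bound {δ T N₁ L τ : ℝ} {d : ℕ}
    (hS : Setting I δ (Real.log (8 * T * N₁ / δ)) C₁ C₂ Ps) (hR : R.IsExecution I μ filt)
    (hs : I.M.IsOptimal πs)
    (hF : Favorable R I δ (Real.log (8 * T * N₁ / δ)) (Real.log (8 * T ^ 2 / δ)) L τ C₁ C₂ Ps πs μ
      filt ω) (hIT : I.T = T) (hcard₁ : ∀ h < I.M.H, ((C₁ h).card : ℝ) ≤ N₁) (hN₁1 : 1 ≤ N₁)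
    (hτ : 0 < τ) (hprob : Real.exp (-τ) < 1 - δ)
    (hdh : ∀ h < I.M.H, eluderDim (I.F h) (dom S A I.M.H) (1 / I.T) ≤ d)
    (hgm : (I.M.gapSet πs).Nonempty → 0 < I.M.gapMin πs)
    (hβ : I.β = 500 * (4 * (I.M.H : ℝ) ^ 2 * Real.log (2 * T * N₁ / δ)
        + 4 / (I.M.H : ℝ) * (500 + Real.sqrt ((I.M.H : ℝ) ^ 2 / 4 * Real.log (T / δ))))) :
    R.regret I πs ω ≤ 10 ^ 12 * (Real.log (N₁ / δ) * (d : ℝ) ^ 2) * (I.M.H : ℝ) ^ 5 * Real.log T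
        / I.M.gapMin πs + 16 * (I.M.H : ℝ) ^ 2 * τ / 3 + 2 := by
  have hδ := hS.δ_pos
  have hδ1 := hS.δ_lt
  have hT2 : 2 ≤ T := hIT ▸ hS.two_le
  have hH := hS.H_ge
  have hlogT := half_lt_log hT2
  have hgm0 : 0 ≤ I.M.gapMin πs := gapMin_nonneg hs
  have hΛ := one_lt_log hT2 hN₁1 hδ hδ1
  have hβ_ge : 2000 * (I.M.H : ℝ) ^ 2 * Real.log (2 * T * N₁ / δ) ≤ I.β :=
    (bonus_parameter_ge hH).trans_eq hβ.symm
  have hX0 : 0 ≤ Real.log (N₁ / δ) := Real.log_nonneg (by rw [le_div_iff₀ hδ]; linarith)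
  have hτ0 : 0 ≤ 16 * (I.M.H : ℝ) ^ 2 * τ / 3 := by positivity
  have hmain0 : 0 ≤ 10 ^ 12 * (Real.log (N₁ / δ) * (d : ℝ) ^ 2) * (I.M.H : ℝ) ^ 5 * Real.log T
      / I.M.gapMin πs := by
    have : 0 ≤ Real.log T := by linarith
    positivity
  by_cases hne : (I.M.gapSet πs).Nonempty
  swap
  · rw [regret_eq_zero hR hs hne]
    linarith
  have hgm1 := hgm hne
  -- For `d = 0` all functions agree up to `1 / T`, so the regret is at most `2`: this is the
  -- additive constant of the bound.
  rcases Nat.eq_zero_or_pos d with hd0 | hd1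
  · have h1 := regret_le_of_diam hS hR hs hF.good (w := 1 / T) (by positivity)
      fun h hh f hf g hg z hz => diam_le_of_eluderDim_eq_zero (by positivity)
        (by have := hdh h hh; rwa [hIT, hd0] at this) hf hg hz
    rw [hIT, mul_assoc, one_div, inv_mul_cancel₀ (by linarith)] at h1
    linarith
  have hd1' : (1 : ℝ) ≤ d := by exact_mod_cast hd1
  -- If `N₁ < 2 δ`, the cover has a single element, so functions agree up to `2 / T` and the regret
  -- is at most `4`. Also `δ > 1 / 2`, so `hprob` forces `τ ≥ 1 / 2`, and the term in `τ` supplies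
  -- what exceeds `2`.
  rcases lt_or_ge (Real.log (N₁ / δ)) (Real.log 2) with hX | hX
  · rw [Real.log_lt_log_iff (by positivity) (by norm_num), div_lt_iff₀ hδ] at hX
    have hτ2 : 1 / 2 ≤ τ := by
      have := Real.add_one_le_exp (-τ)
      linarith
    have h1 := regret_le_of_diam hS hR hs hF.good (w := 2 / T) (by positivity)
      fun h hh f hf g hg z hz => by
        obtain ⟨f', hf', h1⟩ := hS.C₁_cover h hh f hf
        obtain ⟨g', hg', h2⟩ := hS.C₁_cover h hh g hg
        have h3 : (C₁ h).card ≤ 1 := by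
          have h4 : ((C₁ h).card : ℝ) < 2 := by linarith [hcard₁ h hh]
          have h5 : (C₁ h).card < 2 := by exact_mod_cast h4
          omega
        rw [Finset.card_le_one.1 h3 _ hf' _ hg'] at h1
        have h4 := h1 z hz
        have h5 := h2 z hz
        rw [hIT] at h4 h5
        rw [abs_sub_comm] at h5
        have h6 := abs_sub_le (f z) (g' z) (g z)
        have h7 : 2 / T = 1 / T + 1 / T := by ring
        linarith
    have h2 : 2 * (2 / T) * T = 4 := by field_simp; norm_num
    rw [hIT, h2] at h1
    have h3 : 16 * 1 * (1 / 2) / 3 ≤ 16 * (I.M.H : ℝ) ^ 2 * τ / 3 := by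
      gcongr
      exact one_le_pow₀ hH
    linarith
  have hX1 : (0.69 : ℝ) < Real.log (N₁ / δ) := (half_lt_log le_rfl).trans_le hX
  have hXT : (0.47 : ℝ) ≤ Real.log (N₁ / δ) * Real.log T := by nlinarith
  have hdd : (d : ℝ) ≤ (d : ℝ) ^ 2 := by nlinarith
  rcases lt_or_ge (I.M.gapMin πs) (16 * I.M.H / T) with hsmall | hlarge
  · have h1 := hIT ▸ regret_le_T (ω := ω) hR hs
    have h2 := T_le_of_small_gap hT2 hH hd1' hXT hgm1 hsmall
    linarith
  · have hLe : (I.M.H : ℝ) ^ 2 * Real.log (8 * T ^ 2 / δ) ≤ I.β := by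
      have h1 := log_eight_sq_le hT2 hN₁1 hδ hδ1
      have h2 : (I.M.H : ℝ) ^ 2 * Real.log (8 * T ^ 2 / δ)
          ≤ (I.M.H : ℝ) ^ 2 * (3 * Real.log (2 * T * N₁ / δ)) := by gcongr
      have h3 : 0 ≤ (I.M.H : ℝ) ^ 2 * Real.log (2 * T * N₁ / δ) := by positivity
      linarith
    have h1 := regret_le_of_favorable hS hR hs hF hd1 hdh (by rw [hIT]; exact hlarge) hLe
    have hβ_le := bonus_parameter_le hH hT2 hN₁1 hδ hδ1 hX
    rw [← hβ] at hβ_le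
    have h2 := gap_bound_le hH hd1' (by linarith) hgm1 hβ_le
    have h3 : 2 * I.M.H * τ ≤ 16 * (I.M.H : ℝ) ^ 2 * τ / 3 := by
      have : (I.M.H : ℝ) * τ ≤ (I.M.H : ℝ) ^ 2 * τ := by
        gcongr
        nlinarith
      have h4 : 0 ≤ (I.M.H : ℝ) ^ 2 * τ := by positivity
      linarith
    linarith

end Conclusion

end ModelBasedRL

/-! ### The theorem. -/

open ModelBasedRL in
theorem theorem2 :
    -- absolute constants: in the bounds, in the bonus parameter, in the sampling routine
    ∃ C Cβ Cs : ℝ, 0 < C ∧ 0 < Cβ ∧ 0 < Cs ∧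
    ∀ (S A Ω : Type*) [MeasurableSpace S] [MeasurableSpace A] [mΩ : MeasurableSpace Ω]
      (μ : Measure Ω) [IsProbabilityMeasure μ]
      -- the MDP, the known model classes, the number of episodes, the total number of steps
      (M : MDP S A) (cP : ℕ → Set (SignedKernel S A)) (K : ℕ) (T : ℝ)
      -- covering numbers, their maximum over the steps, and the maximal eluder dimension
      (N : ℕ → ℝ → ℕ) (Nmax : ℝ → ℕ) (d : ℕ)
      (δ τ β lam : ℝ) (πs : ℕ → S → A)
      (filt : Filtration (ℕ ×ₗ ℕ) mΩ) (R : Interaction S A Ω),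
      1 ≤ K → T = (K : ℝ) * M.H →
      Realizable M cP →
      (∀ h < M.H, ∀ f ∈ modelFunClass (cP h), ∀ g ∈ modelFunClass (cP h),
        ∀ z ∈ dom S A M.H, |f z - g z| ≤ (M.H : ℝ) + 1) →
      (∀ h < M.H, IsCoveringBound (modelFunClass (cP h)) (dom S A M.H) (N h)) →
      (∀ ε, Nmax ε = (Finset.range M.H).sup fun h => N h ε) →
      ((Finset.range M.H).sup fun h =>
        eluderDim (modelFunClass (cP h)) (dom S A M.H) (1 / T)) = (d : ℕ∞) →
      M.IsOptimal πs →
      ((M.gapSet πs).Nonempty → 0 < M.gapMin πs) →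
      0 < δ → δ < 1 → 0 < τ →
      β = Cβ * (4 * (M.H : ℝ) ^ 2 * Real.log (2 * T * Nmax (1 / T) / δ)
        + 4 / (M.H : ℝ) * (Cβ + Real.sqrt ((M.H : ℝ) ^ 2 / 4 * Real.log (T / δ)))) →
      lam = Cs * Real.log (T * Nmax (Real.sqrt (δ / (64 * T ^ 3))) / δ) →
      R.IsExecution ⟨M, cP, K, β, lam⟩ μ filt →
      ∃ G : Set Ω, MeasurableSet G ∧
        1 - (⌈Real.log T⌉₊ : ℝ) * Real.exp (-τ) - δ ≤ μ.real G ∧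
        ∀ ω ∈ G,
          R.regret ⟨M, cP, K, β, lam⟩ πs ω ≤
            C * (Real.log (Nmax (1 / T) / δ) * (d : ℝ) ^ 2) * (M.H : ℝ) ^ 5 * Real.log T
                / M.gapMin πs
              + 16 * (M.H : ℝ) ^ 2 * τ / 3 + 2 ∧
          (R.switches ⟨M, cP, K, β, lam⟩ ω : ℝ) ≤
            C * ((M.H : ℝ) * Real.log (T * Nmax (Real.sqrt (δ / (64 * T ^ 3))) / δ)
              * max 1 (d : ℝ) * Real.log T ^ 2) := by
  -- `500 * 4 = 2000` exceeds `2 * 976`, as `β_ge` demands after `log_eight_mul_le`; `192` is `16 *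
  -- 12` from `sampling_failure_le`; `10 ^ 12` absorbs the product of `49184` and `5100000`.
  refine ⟨10 ^ 12, 500, 192, by norm_num, by norm_num, by norm_num, ?_⟩
  intro S A Ω _ _ mΩ μ _ M cP K T N Nmax d δ τ β lam πs filt R hK hT hreal hdiam hN hmax hd hs
    hgm hδ hδ1 hτ hβ hlam hR
  set I : Input S A := ⟨M, cP, K, β, lam⟩ with hI
  have hIT : I.T = T := hT.symm
  have hH : (1 : ℝ) ≤ M.H := by exact_mod_cast M.H_pos
  have hregT : ∀ ω, R.regret I πs ω ≤ T := fun ω => hIT ▸ regret_le_T hR hs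
  -- Here `T = 1` and all logarithms of `T` vanish; the regret is at most `1` and there is no
  -- switch. Otherwise `T ≥ 2`, so `log T` is bounded away from zero.
  by_cases hone : K = 1 ∧ M.H = 1
  · have hT1 : T = 1 := by rw [hT, hone.1, hone.2]; norm_num
    refine ⟨Set.univ, MeasurableSet.univ, ?_, fun ω _ => ⟨?_, ?_⟩⟩
    · rw [probReal_univ]
      have : 0 ≤ (⌈Real.log T⌉₊ : ℝ) * Real.exp (-τ) := by positivity
      linarith
    · have h1 := hregT ω
      have h2 : 0 ≤ 16 * (M.H : ℝ) ^ 2 * τ / 3 := by positivity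
      rw [hT1, Real.log_one, mul_zero, zero_div]
      linarith
    · have h0 : R.switches I ω = 0 := by simp [Interaction.switches, hI, hone.1]
      rw [h0, hT1, Real.log_one]
      simp
  have hT2 : 2 ≤ T := by
    have h1 : 2 ≤ K * M.H := by
      have := M.H_pos
      rcases Nat.lt_or_ge K 2 with h | h
      · have : M.H ≠ 1 := fun h' => hone ⟨by omega, h'⟩
        have h3 : 2 ≤ M.H := by omega
        nlinarith
      · nlinarith
    rw [hT]
    exact_mod_cast h1
  -- If the claimed probability is not positive the empty set serves. Otherwise `δ` and `exp (-τ)`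
  -- are constrained, as needed when `N₁ / δ` is small.
  by_cases hprob : 1 - (⌈Real.log T⌉₊ : ℝ) * Real.exp (-τ) - δ ≤ 0
  · exact ⟨∅, MeasurableSet.empty, by simpa using hprob, fun ω hω => absurd hω (by simp)⟩
  have hlogT := half_lt_log hT2
  have hceil : Real.exp (-τ) ≤ (⌈Real.log T⌉₊ : ℝ) * Real.exp (-τ) := by
    refine le_mul_of_one_le_left (Real.exp_pos _).le ?_
    exact_mod_cast Nat.one_le_ceil_iff.2 (by linarith)
  have hε₂ : 0 < Real.sqrt (δ / (64 * T ^ 3)) := Real.sqrt_pos.2 (by positivity)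
  obtain ⟨C₁, hC₁⟩ := exists_covers hN hmax (ε := 1 / T) (by positivity)
  obtain ⟨C₂, hC₂⟩ := exists_covers hN hmax hε₂
  set N₁ : ℝ := (Nmax (1 / T) : ℝ) with hN₁
  set N₂ : ℝ := (Nmax (Real.sqrt (δ / (64 * T ^ 3))) : ℝ) with hN₂
  have hcard₁ : ∀ h < M.H, ((C₁ h).card : ℝ) ≤ N₁ := fun h hh =>
    Nat.cast_le.2 (hC₁ h hh).2.1
  have hcard₂ : ∀ h < M.H, ((C₂ h).card : ℝ) ≤ N₂ := fun h hh =>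
    Nat.cast_le.2 (hC₂ h hh).2.1
  obtain ⟨P₀, hP₀, -⟩ := hreal 0 M.H_pos
  have : Nonempty (SignedKernel S A) := ⟨P₀⟩
  -- Realizability makes the class nonempty, hence every cover has an element.
  have hN₁1 : 1 ≤ N₁ := by
    obtain ⟨g, hg, -⟩ := (hC₁ 0 M.H_pos).2.2 _ ⟨P₀, hP₀, rfl⟩
    exact le_trans (by exact_mod_cast Finset.card_pos.2 ⟨g, hg⟩) (hcard₁ 0 M.H_pos)
  have hN₂1 : 1 ≤ N₂ := by
    obtain ⟨g, hg, -⟩ := (hC₂ 0 M.H_pos).2.2 _ ⟨P₀, hP₀, rfl⟩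
    exact le_trans (by exact_mod_cast Finset.card_pos.2 ⟨g, hg⟩) (hcard₂ 0 M.H_pos)
  choose! Ps hPs_mem hPs_eq using hreal
  have hΛ := one_lt_log hT2 hN₁1 hδ hδ1
  have hβ_ge : 2000 * (M.H : ℝ) ^ 2 * Real.log (2 * T * N₁ / δ) ≤ β :=
    (bonus_parameter_ge hH).trans_eq hβ.symm
  have hℓ : (0.69 : ℝ) < Real.log (T * N₂ / δ) :=
    half_lt_log (by rw [le_div_iff₀ hδ]; nlinarith)
  have hdh : ∀ h < M.H, eluderDim (I.F h) (dom S A M.H) (1 / I.T) ≤ d := fun h hh => by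
    rw [hIT, ← hd]
    exact Finset.le_sup (f := fun h => eluderDim (modelFunClass (cP h)) (dom S A M.H) (1 / T))
      (Finset.mem_range.2 hh)
  have hLa1 : 1 ≤ Real.log (8 * T * N₁ / δ) :=
    hΛ.le.trans (Real.log_le_log (by positivity) (by gcongr; norm_num))
  have hS : Setting I δ (Real.log (8 * T * N₁ / δ)) C₁ C₂ Ps :=
    { two_le := hIT ▸ hT2
      δ_pos := hδ
      δ_lt := hδ1
      Ps_mem := hPs_mem
      Ps_eq := hPs_eq
      diam := hdiam
      C₁_sub := fun h hh => (hC₁ h hh).1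
      C₁_cover := fun h hh => hIT ▸ (hC₁ h hh).2.2
      C₂_sub := fun h hh => (hC₂ h hh).1
      C₂_cover := fun h hh => hIT ▸ (hC₂ h hh).2.2
      lam_ge := by
        change 1 ≤ lam
        rw [hlam]
        linarith
      La_ge := hLa1
      β_ge := by
        have h1 := log_eight_mul_le hT2 hN₁1 hδ hδ1
        have h2 : 976 * (M.H : ℝ) ^ 2 * Real.log (8 * T * N₁ / δ)
            ≤ 976 * (M.H : ℝ) ^ 2 * (2 * Real.log (2 * T * N₁ / δ)) := by gcongr
        have h3 : 0 ≤ (M.H : ℝ) ^ 2 * Real.log (2 * T * N₁ / δ) := by positivity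
        change 976 * (M.H : ℝ) ^ 2 * Real.log (8 * T * N₁ / δ) ≤ β
        linarith }
  obtain ⟨G, hGm, hGp, hG⟩ := exists_favorable_set hS hR hs hK hcard₁ hcard₂ hN₂1
    (Le := Real.log (8 * T ^ 2 / δ)) (L := Real.log (8 / δ))
    (by
      rw [hIT, Real.exp_neg, Real.exp_log (by positivity)]
      exact le_of_eq (by field_simp))
    (by
      rw [hIT]
      change 8 * T ^ 4 * N₂ ^ 2 * Real.exp (-(lam / 16)) ≤ δ / 8
      rw [hlam]
      exact sampling_failure_le hT2 hN₂1 hδ hδ1)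
    (by
      rw [hIT, Real.exp_neg, Real.exp_log (by positivity)]
      exact le_of_eq (by field_simp))
    (by
      rw [Real.exp_neg, Real.exp_log (by positivity), inv_div]) τ
  refine ⟨G, hGm, by linarith, fun ω hω => ⟨?_, ?_⟩⟩
  · exact regret_bound hS hR hs (hG ω hω) hIT hcard₁ hN₁1 hτ (by linarith) hdh hgm hβ
  · have hF := hG ω hω
    have h1 := switches_le_of_good hS hR hs hF.good hK hdh hF.coinProb_eq hF.coins
    rw [hIT] at h1
    change (R.switches I ω : ℝ) ≤ 20000 * lam * M.H * (max 1 (d : ℝ) * Real.log T ^ 2)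
      + Real.log (8 / δ) at h1
    rw [hlam] at h1
    exact h1.trans (switch_bound_le hT2 hN₂1 hδ hδ1 hH)
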